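/- Let $k\ge 2$ be an integer and $c>0$. There is a constant $C>0$, depending only on $k$ and $c$, with the following property. **Mesh.** Let $0=x_{1/2}<x_{3/2}<\dots<x_{N+1/2}=2\pi$, $\tau_j=(x_{j-1/2},x_{j+1/2})$, $h_j=x_{j+1/2}-x_{j-1/2}$, $\bar h_j=h_j/2$, $h=\max_j h_j$, and assume that $h\le c\,h_j$ for all $j$. Let $V_h$ be the space of functions that are a polynomial of degree at most $k$ on each $\tau_j$, and let $v^\mp|_{j+1/2}$ denote the left and right limits of $v$ at $x_{j+1/2}$. **Exact solution.** Let $T>0$ and let $u$, continuous on $[0,2\pi]\times[0,T]$, be a classical solution of $u_t=u_{xx}$ on $[0,2\pi]\times(0,T]$ (twice continuously differentiable in $x$ on $[0,2\pi]$ for each $t\in[0,T]$) with $\sup_{0\le s\le T}\|u(\cdot,s)\|_{k+4,\infty}<\infty$, where $\|\cdot\|_{m,\infty}$ is the norm of $W^{m,\infty}(0,2\pi)$; put $q=u_x$. **Fluxes and boundary conditions.** Consider the alternating fluxes (1) $\hat u_h=u_h^-,\ \hat q_h=q_h^+$ or (2) $\hat u_h=u_h^+,\ \hat q_h=q_h^-$.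 Assume either the periodic condition $u(0,t)=u(2\pi,t)$, $u_x(0,t)=u_x(2\pi,t)$ (with fluxes (1) or (2)), or the mixed condition $u(0,t)=g_0(t)$, $u_x(2\pi,t)=g_1(t)$ with fluxes (1), or the mixed condition $u_x(0,t)=g_0(t)$, $u(2\pi,t)=g_1(t)$ with fluxes (2), for $0\le t\le T$. **Scheme.** For $0\le t\le T$ let $u_h(\cdot,t),q_h(\cdot,t)\in V_h$, with $u_h$ differentiable in $t$, satisfy for all $j$ and all $v,w\in V_h$ $$\int_{\tau_j}u_{ht}v\,dx=-\int_{\tau_j}q_hv_x\,dx+\hat q_hv^-|_{j+1/2}-\hat q_hv^+|_{j-1/2},\qquad \int_{\tau_j}q_hw\,dx=-\int_{\tau_j}u_hw_x\,dx+\hat u_hw^-|_{j+1/2}-\hat u_hw^+|_{j-1/2}.$$ A one-sided limit from outside $[0,2\pi]$ in a flux is taken by periodicity in the periodic case and is the boundary datum $g_0(t)$ at $0$, $g_1(t)$ at $2\pi$ in the mixed cases. **Projections and initial value.** On each $\tau_j$, $P_h^-v$ and $P_h^+v$ are the polynomials of degree at most $k$ with $\int_{\tau_j}(P_h^\mp v)w\,dx=\int_{\tau_j}vw\,dx$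 for all polynomials $w$ of degree at most $k-1$, and with $P_h^-v(x_{j+1/2}^-)=v(x_{j+1/2}^-)$, respectively $P_h^+v(x_{j-1/2}^+)=v(x_{j-1/2}^+)$. Let $L_{j,m}$ be the Legendre polynomial of degree $m$ on $\tau_j$ with $L_{j,m}(x_{j+1/2})=1$, let $D_s^{-1}v(x)=\bar h_j^{-1}\int_{x_{j-1/2}}^xv\,dx'$ on $\tau_j$, and put $$\bar v_{j,k}=-v(x_{j+1/2}^-)+\frac1{h_j}\int_{\tau_j}v\sum_{m=0}^k(2m+1)L_{j,m}\,dx,\qquad \tilde v_{j,k}=(-1)^{k+1}v(x_{j-1/2}^+)+\frac1{h_j}\int_{\tau_j}v\sum_{m=0}^k(-1)^{k+m}(2m+1)L_{j,m}\,dx,$$ $$F_1=P_h^+D_s^{-1}L_{j,k},\quad F_2=P_h^-D_s^{-1}L_{j,k},\quad \bar F_1=P_h^-D_s^{-1}F_1,\quad \bar F_2=P_h^+D_s^{-1}F_2 .$$ On $\tau_j$ define $$u_I^2=P_h^-u-\bar h_j^2\,(\partial_t\bar u_{j,k})\,\bar F_1-\bar h_j\,\tilde q_{j,k}\,F_2\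 \text{ for fluxes (1)},\qquad u_I^2=P_h^+u-\bar h_j\,\bar q_{j,k}\,F_1-\bar h_j^2\,(\partial_t\tilde u_{j,k})\,\bar F_2\ \text{ for fluxes (2)},$$ and assume that $u_h(\cdot,0)=u_I^2(\cdot,0)$ (with the one-sided time derivative at $t=0$). **Conclusion.** Let $\xi_u=P_h^-u-u_h$, $\xi_q=P_h^+q-q_h$ for fluxes (1), and $\xi_u=P_h^+u-u_h$, $\xi_q=P_h^-q-q_h$ for fluxes (2). Then for all $t\in[0,T]$ $$\|\xi_u(\cdot,t)\|_{L^2(0,2\pi)}\le C(1+th)\,h^{k+2}\sup_{0\le s\le t}\|u(\cdot,s)\|_{k+4,\infty},\qquad \|\xi_q(\cdot,t)\|_{L^2(0,2\pi)}\le C(1+t^{1/2}h)\,h^{k+2}\sup_{0\le s\le t}\|u(\cdot,s)\|_{k+4,\infty}.$$ -/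

import Mathlib

open Set MeasureTheory
open scoped ENNReal ContDiff

noncomputable section

namespace LDG

/-! ## Sobolev spaces `W^{m,∞}(0, 2π)` -/

/-- Lebesgue measure on `Ω = (0, 2π)`. -/
def muOmega : Measure ℝ := volume.restrict (Ioo 0 (2 * Real.pi))

/-- `g` is an `i`-th weak derivative of `v` on `(0, 2π)`; the definition is used for
`v, g ∈ L^∞(0, 2π)` only, so that all the integrals converge. -/
def IsWeakDeriv (i : ℕ) (v g : ℝ → ℝ) : Prop :=
  ∀ φ : ℝ → ℝ, ContDiff ℝ ∞ φ → HasCompactSupport φ → tsupport φ ⊆ Ioo 0 (2 * Real.pi) →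
    ∫ x, v x * iteratedDeriv i φ x ∂muOmega = (-1) ^ i * ∫ x, g x * φ x ∂muOmega

/-- `‖v‖_{m,∞}`, the largest of the `L^∞` norms of the weak derivatives of order at most `m`.
It is finite exactly if `v ∈ W^{m,∞}(0, 2π)`: the infimum is `∞` if `v` is not in `L^∞` or has no
`i`-th weak derivative in `L^∞`, and otherwise it is the norm of that derivative, which is unique
almost everywhere. -/
def sobolevNorm (m : ℕ) (v : ℝ → ℝ) : ℝ≥0∞ :=
  ⨆ (i : ℕ) (_ : i ≤ m), ⨅ (g : ℝ → ℝ)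
    (_ : MemLp v ∞ muOmega ∧ MemLp g ∞ muOmega ∧ IsWeakDeriv i v g), eLpNorm g ∞ muOmega

/-! ## Meshes, numerical fluxes and boundary conditions -/

/-- A mesh `0 = x 0 < x 1 < ⋯ < x N = 2π`. The cells are the intervals `(x j, x (j + 1))`,
`j < N`; the values `x i` with `i > N` play no role. -/
structure Mesh where
  N : ℕ
  x : ℕ → ℝ
  x_zero : x 0 = 0
  x_last : x N = 2 * Real.pi
  x_lt : ∀ j < N, x j < x (j + 1)

/-- The length of the cell `j`. -/
def Mesh.len (M : Mesh) (j : ℕ) : ℝ := M.x (j + 1) - M.x j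

/-- The mesh size: the largest length of a cell. -/
def Mesh.h (M : Mesh) : ℝ := ⨆ j : Fin M.N, M.len j

/-- The mesh is quasi-uniform with the constant `c`. -/
def Mesh.QuasiUniform (M : Mesh) (c : ℝ) : Prop := ∀ j < M.N, M.h ≤ c * M.len j

/-- The two choices of alternating fluxes: `minusPlus` is `û = u⁻, q̂ = q⁺` and
`plusMinus` is `û = u⁺, q̂ = q⁻`. -/
inductive Flux where
  | minusPlus
  | plusMinus

/-- The boundary conditions: periodic, or mixed with datum `g₀` at `x = 0` and datum `g₁` at
`x = 2π`. Which of `u`, `u_x` is prescribed at which end depends on the fluxes that the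
condition is used with, see `SatisfiesBC`. -/
inductive Boundary where
  | periodic
  | mixed (g₀ g₁ : ℝ → ℝ)

/-! ## The exact solution -/

/-- `q = u_x` (one-sided derivatives at `0` and `2π`). -/
def dx (u : ℝ → ℝ → ℝ) (x t : ℝ) : ℝ :=
  derivWithin (fun y => u y t) (Icc 0 (2 * Real.pi)) x

/-- `u` (a function of `x` and `t`) solves `u_t = u_xx` on `[0, 2π] × (0, T]` in the classical
sense and is continuous up to `t = 0`. -/
structure IsHeatSolution (T : ℝ) (u : ℝ → ℝ → ℝ) : Prop where
  continuousOn :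
    ContinuousOn (fun p : ℝ × ℝ => u p.1 p.2) (Icc 0 (2 * Real.pi) ×ˢ Icc 0 T)
  contDiffOn : ∀ t ∈ Icc 0 T, ContDiffOn ℝ 2 (fun x => u x t) (Icc 0 (2 * Real.pi))
  heat_eq : ∀ t ∈ Ioc 0 T, ∀ x ∈ Icc 0 (2 * Real.pi),
    HasDerivWithinAt (fun s => u x s) (dx (dx u) x t) (Icc 0 T) t

/-- The boundary conditions of the exact solution. With the fluxes `û = u⁻, q̂ = q⁺` the mixed
condition is `u(0,t) = g₀(t), u_x(2π,t) = g₁(t)`; with the fluxes `û = u⁺, q̂ = q⁻` it is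
`u_x(0,t) = g₀(t), u(2π,t) = g₁(t)`. -/
def SatisfiesBC (T : ℝ) (u : ℝ → ℝ → ℝ) : Flux → Boundary → Prop
  | _, .periodic => ∀ t ∈ Icc 0 T,
      u 0 t = u (2 * Real.pi) t ∧ dx u 0 t = dx u (2 * Real.pi) t
  | .minusPlus, .mixed g₀ g₁ => ∀ t ∈ Icc 0 T, u 0 t = g₀ t ∧ dx u (2 * Real.pi) t = g₁ t
  | .plusMinus, .mixed g₀ g₁ => ∀ t ∈ Icc 0 T, dx u 0 t = g₀ t ∧ u (2 * Real.pi) t = g₁ t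

/-! ## The LDG scheme

A function `v` in the finite element space is given by the polynomials `v j`, `j < N`, that it
equals on the cells. -/

/-- The left limit `v⁻` at the node `i ≤ N`. At the node `0` it is the left limit at the node `N`
in the periodic case, and the boundary datum in the mixed case. (The mixed conditions prescribe
at `x = 0` exactly the variable whose flux is its left limit.) -/
def traceMinus (M : Mesh) (bc : Boundary) (t : ℝ) (v : ℕ → Polynomial ℝ) (i : ℕ) : ℝ :=
  if i = 0 then
    match bc with
    | .periodic => (v (M.N - 1)).eval (M.x M.N)
    | .mixed g₀ _ => g₀ t
  else (v (i - 1)).eval (M.x i)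

/-- The right limit `v⁺` at the node `i ≤ N`. At the node `N` it is the right limit at the
node `0` in the periodic case, and the boundary datum in the mixed case. (The mixed conditions
prescribe at `x = 2π` exactly the variable whose flux is its right limit.) -/
def tracePlus (M : Mesh) (bc : Boundary) (t : ℝ) (v : ℕ → Polynomial ℝ) (i : ℕ) : ℝ :=
  if i = M.N then
    match bc with
    | .periodic => (v 0).eval (M.x 0)
    | .mixed _ g₁ => g₁ t
  else (v i).eval (M.x i)

/-- The numerical flux `û`. -/
def uHat (M : Mesh) (bc : Boundary) (t : ℝ) (v : ℕ → Polynomial ℝ) (i : ℕ) : Flux → ℝ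
  | .minusPlus => traceMinus M bc t v i
  | .plusMinus => tracePlus M bc t v i

/-- The numerical flux `q̂`. -/
def qHat (M : Mesh) (bc : Boundary) (t : ℝ) (v : ℕ → Polynomial ℝ) (i : ℕ) : Flux → ℝ
  | .minusPlus => tracePlus M bc t v i
  | .plusMinus => traceMinus M bc t v i

/-- `(u_h, q_h)` solves the semi-discrete LDG scheme of degree `k` on `[0, T]`: on each cell both
are polynomials of degree at most `k` in `x`, with coefficients that depend on `t`. -/
structure IsLDGSolution (k : ℕ) (T : ℝ) (M : Mesh) (fl : Flux) (bc : Boundary)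
    (uh qh : ℝ → ℕ → Polynomial ℝ) : Prop where
  natDegree_uh : ∀ t ∈ Icc 0 T, ∀ j < M.N, (uh t j).natDegree ≤ k
  natDegree_qh : ∀ t ∈ Icc 0 T, ∀ j < M.N, (qh t j).natDegree ≤ k
  differentiableOn_uh : ∀ j < M.N, ∀ m : ℕ,
    DifferentiableOn ℝ (fun t => (uh t j).coeff m) (Icc 0 T)
  eq_u : ∀ t ∈ Icc 0 T, ∀ j < M.N, ∀ v : Polynomial ℝ, v.natDegree ≤ k →
    ∫ x in M.x j..M.x (j + 1), derivWithin (fun s => (uh s j).eval x) (Icc 0 T) t * v.eval x =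
      -(∫ x in M.x j..M.x (j + 1), (qh t j).eval x * v.derivative.eval x)
        + qHat M bc t (qh t) (j + 1) fl * v.eval (M.x (j + 1))
        - qHat M bc t (qh t) j fl * v.eval (M.x j)
  eq_q : ∀ t ∈ Icc 0 T, ∀ j < M.N, ∀ w : Polynomial ℝ, w.natDegree ≤ k →
    ∫ x in M.x j..M.x (j + 1), (qh t j).eval x * w.eval x =
      -(∫ x in M.x j..M.x (j + 1), (uh t j).eval x * w.derivative.eval x)
        + uHat M bc t (uh t) (j + 1) fl * w.eval (M.x (j + 1))
        - uHat M bc t (uh t) j fl * w.eval (M.x j)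

/-! ## Gauss–Radau projections -/

/-- `p` is the Gauss–Radau projection of `v` to the polynomials of degree at most `k` on the cell
`(a, b)`, with interpolation at `e` (an endpoint of the cell). -/
structure IsRadau (k : ℕ) (a b e : ℝ) (v : ℝ → ℝ) (p : Polynomial ℝ) : Prop where
  natDegree_le : p.natDegree ≤ k
  moments : ∀ w : Polynomial ℝ, w.degree < k →
    ∫ x in a..b, p.eval x * w.eval x = ∫ x in a..b, v x * w.eval x
  interp : p.eval e = v e

theorem IsRadau.existsUnique {k : ℕ} {a b e : ℝ} {v : ℝ → ℝ} (hab : a < b)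
    (he : e = a ∨ e = b) (hv : ContinuousOn v (Icc a b)) :
    ∃! p : Polynomial ℝ, IsRadau k a b e v p := by
  have key : ∀ d : Polynomial ℝ, d.natDegree ≤ k →
      (∀ w : Polynomial ℝ, w.degree < k → ∫ x in a..b, d.eval x * w.eval x = 0) →
      d.eval e = 0 → d = 0 := by
    intro d hd hw h0
    obtain ⟨r, rfl⟩ := Polynomial.dvd_iff_isRoot.mpr (show d.IsRoot e from h0)
    by_contra hne
    have hr : r ≠ 0 := by rintro rfl; simp at hne
    have hdeg : r.degree < k := by
      rw [Polynomial.natDegree_mul (Polynomial.X_sub_C_ne_zero e) hr,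
        Polynomial.natDegree_X_sub_C] at hd
      rw [Polynomial.degree_eq_natDegree hr]
      exact_mod_cast (by omega : r.natDegree < k)
    have hint := hw r hdeg
    have hpos : ∀ s : ℝ, (∀ x ∈ Icc a b, 0 ≤ s * (x - e)) → s ≠ 0 → False := by
      intro s hs hs0
      have h1 : ∫ x in a..b, s * (((Polynomial.X - Polynomial.C e) * r).eval x * r.eval x) = 0 := by
        rw [intervalIntegral.integral_const_mul, hint, mul_zero]
      have hcont : Continuous fun x : ℝ =>
          s * (((Polynomial.X - Polynomial.C e) * r).eval x * r.eval x) := by fun_prop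
      have h2 : ∀ x ∈ Ioo a b,
          s * (((Polynomial.X - Polynomial.C e) * r).eval x * r.eval x) = 0 := by
        by_contra! hcon
        obtain ⟨x, hx, hx0⟩ := hcon
        refine (intervalIntegral.integral_pos hab hcont.continuousOn ?_
          ⟨x, Ioo_subset_Icc_self hx, ?_⟩).ne' h1
        · intro y hy
          have := mul_nonneg (hs y (Ioc_subset_Icc_self hy)) (sq_nonneg (r.eval y))
          simp only [Polynomial.eval_mul, Polynomial.eval_sub, Polynomial.eval_X,
            Polynomial.eval_C]
          nlinarith
        · refine lt_of_le_of_ne ?_ hx0.symm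
          have := mul_nonneg (hs x (Ioo_subset_Icc_self hx)) (sq_nonneg (r.eval x))
          simp only [Polynomial.eval_mul, Polynomial.eval_sub, Polynomial.eval_X,
            Polynomial.eval_C]
          nlinarith
      apply hr
      refine Polynomial.eq_zero_of_infinite_isRoot r ((Ioo_infinite hab).mono fun x hx => ?_)
      have h3 := h2 x hx
      have hxe : x - e ≠ 0 := by
        rcases he with rfl | rfl
        · exact (sub_pos.mpr hx.1).ne'
        · exact (sub_neg.mpr hx.2).ne
      simp only [Polynomial.eval_mul, Polynomial.eval_sub, Polynomial.eval_X,
        Polynomial.eval_C] at h3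
      simpa [hs0, hxe] using h3
    rcases he with rfl | rfl
    · exact hpos 1 (fun x hx => by linarith [hx.1]) one_ne_zero
    · exact hpos (-1) (fun x hx => by linarith [hx.2]) (by norm_num)
  have hii : ∀ p w : Polynomial ℝ,
      IntervalIntegrable (fun x => p.eval x * w.eval x) volume a b := fun p w =>
    Continuous.intervalIntegrable (by fun_prop) a b
  have hvi : ∀ w : Polynomial ℝ,
      IntervalIntegrable (fun x => v x * w.eval x) volume a b := fun w => by
    refine ContinuousOn.intervalIntegrable ?_
    rw [uIcc_of_le hab.le]
    exact hv.mul (by fun_prop)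
  let L : (Polynomial.degreeLT ℝ k) →ₗ[ℝ] ℝ :=
    { toFun := fun w => ∫ x in a..b, v x * w.1.eval x
      map_add' := fun w z => by
        rw [← intervalIntegral.integral_add (hvi _) (hvi _)]
        simp [mul_add]
      map_smul' := fun c w => by
        simp only [RingHom.id_apply, smul_eq_mul]
        rw [← intervalIntegral.integral_const_mul]
        simp [mul_left_comm] }
  let A : (Polynomial.degreeLT ℝ (k + 1)) →ₗ[ℝ] (Module.Dual ℝ (Polynomial.degreeLT ℝ k)) × ℝ :=
    { toFun := fun p =>
        ({ toFun := fun w => ∫ x in a..b, p.1.eval x * w.1.eval x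
           map_add' := fun w z => by
            rw [← intervalIntegral.integral_add (hii _ _) (hii _ _)]
            simp [mul_add]
           map_smul' := fun c w => by
            simp only [RingHom.id_apply, smul_eq_mul]
            rw [← intervalIntegral.integral_const_mul]
            simp [mul_left_comm] }, p.1.eval e)
      map_add' := fun p q => by
        refine Prod.ext (LinearMap.ext fun w => ?_) (by simp)
        simp only [LinearMap.coe_mk, AddHom.coe_mk, Prod.fst_add, LinearMap.add_apply]
        rw [← intervalIntegral.integral_add (hii _ _) (hii _ _)]
        simp [add_mul]
      map_smul' := fun c p => by
        refine Prod.ext (LinearMap.ext fun w => ?_) (by simp)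
        simp only [LinearMap.coe_mk, AddHom.coe_mk, Prod.smul_fst, LinearMap.smul_apply,
          RingHom.id_apply, smul_eq_mul]
        rw [← intervalIntegral.integral_const_mul]
        simp [mul_assoc] }
  have hmem : ∀ p : Polynomial ℝ, p ∈ Polynomial.degreeLT ℝ (k + 1) ↔ p.natDegree ≤ k := by
    intro p
    rw [Polynomial.mem_degreeLT]
    rcases eq_or_ne p 0 with rfl | hp
    · simp
    · rw [Polynomial.degree_eq_natDegree hp, Nat.cast_lt, Nat.lt_succ_iff]
  have hinj : Function.Injective A := by
    rw [← LinearMap.ker_eq_bot, LinearMap.ker_eq_bot']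
    intro p hp
    refine Subtype.ext (key p.1 ((hmem _).1 p.2) (fun w hw => ?_) (congrArg Prod.snd hp))
    exact LinearMap.congr_fun (congrArg Prod.fst hp) ⟨w, Polynomial.mem_degreeLT.2 hw⟩
  have hfin : ∀ n, FiniteDimensional ℝ (Polynomial.degreeLT ℝ n) := fun n =>
    Module.Finite.equiv (Polynomial.degreeLTEquiv ℝ n).symm
  have hrank : ∀ n, Module.finrank ℝ (Polynomial.degreeLT ℝ n) = n := fun n => by
    rw [(Polynomial.degreeLTEquiv ℝ n).finrank_eq, Module.finrank_fin_fun]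
  have hsurj : Function.Surjective A := by
    refine (LinearMap.injective_iff_surjective_of_finrank_eq_finrank ?_).1 hinj
    rw [Module.finrank_prod, Subspace.dual_finrank_eq, hrank, hrank, Module.finrank_self]
  obtain ⟨p, hp⟩ := hsurj (L, v e)
  refine ⟨p.1, ⟨(hmem _).1 p.2, fun w hw => ?_, congrArg Prod.snd hp⟩, fun q hq => ?_⟩
  · exact LinearMap.congr_fun (congrArg Prod.fst hp) ⟨w, Polynomial.mem_degreeLT.2 hw⟩
  · refine sub_eq_zero.1 (key _ ((hmem _).1 (Submodule.sub_mem _ ((hmem _).2 hq.natDegree_le) p.2))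
      (fun w hw => ?_) ?_)
    · have h1 := hq.moments w hw
      have h2 : ∫ x in a..b, p.1.eval x * w.eval x = ∫ x in a..b, v x * w.eval x :=
        LinearMap.congr_fun (congrArg Prod.fst hp) ⟨w, Polynomial.mem_degreeLT.2 hw⟩
      simp only [Polynomial.eval_sub, sub_mul]
      rw [intervalIntegral.integral_sub (hii _ _) (hii _ _), h1, h2, sub_self]
    · have h2 : p.1.eval e = v e := congrArg Prod.snd hp
      rw [Polynomial.eval_sub, hq.interp, h2, sub_self]

open Classical in
/-- The Gauss–Radau projection. It exists and is unique for continuous `v`; the value `0` is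
never used then. -/
def radau (k : ℕ) (a b e : ℝ) (v : ℝ → ℝ) : Polynomial ℝ :=
  if h : ∃ p, IsRadau k a b e v p then h.choose else 0

/-- The restriction of `P_h^- v` to the cell `(a, b)`: interpolation at the right endpoint. -/
def radauMinus (k : ℕ) (a b : ℝ) (v : ℝ → ℝ) : Polynomial ℝ := radau k a b b v

/-- The restriction of `P_h^+ v` to the cell `(a, b)`: interpolation at the left endpoint. -/
def radauPlus (k : ℕ) (a b : ℝ) (v : ℝ → ℝ) : Polynomial ℝ := radau k a b a v

/-! ## Correction functions and the initial value -/

/-- The Legendre polynomial of degree `m` on `[-1, 1]`, by Rodrigues' formula. -/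
def legendre (m : ℕ) : Polynomial ℝ :=
  Polynomial.C (1 / (2 ^ m * (m.factorial : ℝ))) *
    (Polynomial.derivative)^[m] ((Polynomial.X ^ 2 - 1) ^ m)

/-- The Legendre polynomial of degree `m` on the cell `(a, b)`, as a function of `x`. -/
def cellLegendre (m : ℕ) (a b x : ℝ) : ℝ :=
  (legendre m).eval ((x - (a + b) / 2) / ((b - a) / 2))

/-- The operator `D_s⁻¹` on the cell `(a, b)`. -/
def dInv (a b : ℝ) (v : ℝ → ℝ) (x : ℝ) : ℝ := 1 / ((b - a) / 2) * ∫ y in a..x, v y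

/-- `v̄_{j,k}`, the coefficient of the Legendre polynomial of degree `k` in the expansion of
`v - P_h^- v` on the cell `(a, b)`. -/
def coefMinus (k : ℕ) (a b : ℝ) (v : ℝ → ℝ) : ℝ :=
  -v b + 1 / (b - a) *
    ∫ x in a..b, v x * ∑ m ∈ Finset.range (k + 1), (2 * (m : ℝ) + 1) * cellLegendre m a b x

/-- `ṽ_{j,k}`, the coefficient of the Legendre polynomial of degree `k` in the expansion of
`v - P_h^+ v` on the cell `(a, b)`. -/
def coefPlus (k : ℕ) (a b : ℝ) (v : ℝ → ℝ) : ℝ :=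
  (-1) ^ (k + 1) * v a + 1 / (b - a) *
    ∫ x in a..b, v x *
      ∑ m ∈ Finset.range (k + 1), (-1) ^ (k + m) * (2 * (m : ℝ) + 1) * cellLegendre m a b x

/-- `F_{1,1} = P_h^+ D_s⁻¹ L_{j,k}`. -/
def F1 (k : ℕ) (a b : ℝ) : Polynomial ℝ := radauPlus k a b (dInv a b (cellLegendre k a b))

/-- `F_{2,1} = P_h^- D_s⁻¹ L_{j,k}`. -/
def F2 (k : ℕ) (a b : ℝ) : Polynomial ℝ := radauMinus k a b (dInv a b (cellLegendre k a b))

/-- `F̄_{1,1} = P_h^- D_s⁻¹ F_{1,1}`. -/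
def F1bar (k : ℕ) (a b : ℝ) : Polynomial ℝ :=
  radauMinus k a b (dInv a b fun x => (F1 k a b).eval x)

/-- `F̄_{2,1} = P_h^+ D_s⁻¹ F_{2,1}`. -/
def F2bar (k : ℕ) (a b : ℝ) : Polynomial ℝ :=
  radauPlus k a b (dInv a b fun x => (F2 k a b).eval x)

/-- The restriction to the cell `(a, b)` of the correction function `W_2^l(·, t)`, `l = 2`,
of the solution `u` on `[0, T]`: `w̄_{1,1} + w_{2,1}` for the fluxes `û = u⁻, q̂ = q⁺`, and
`w_{1,1} + w̄_{2,1}` for the fluxes `û = u⁺, q̂ = q⁻`. -/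
def correctionU (k : ℕ) (T : ℝ) (u : ℝ → ℝ → ℝ) (a b t : ℝ) : Flux → Polynomial ℝ
  | .minusPlus =>
      Polynomial.C (((b - a) / 2) ^ 2 *
          derivWithin (fun s => coefMinus k a b fun x => u x s) (Icc 0 T) t) * F1bar k a b
        + Polynomial.C ((b - a) / 2 * coefPlus k a b fun x => dx u x t) * F2 k a b
  | .plusMinus =>
      Polynomial.C ((b - a) / 2 * coefMinus k a b fun x => dx u x t) * F1 k a b
        + Polynomial.C (((b - a) / 2) ^ 2 *
          derivWithin (fun s => coefPlus k a b fun x => u x s) (Icc 0 T) t) * F2bar k a b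

/-- The Gauss–Radau projection of `u(·, t)` that belongs to the fluxes: `P_h^- u` if `û = u⁻`
and `P_h^+ u` if `û = u⁺`. -/
def projU (k : ℕ) (M : Mesh) (u : ℝ → ℝ → ℝ) (t : ℝ) (j : ℕ) : Flux → Polynomial ℝ
  | .minusPlus => radauMinus k (M.x j) (M.x (j + 1)) fun x => u x t
  | .plusMinus => radauPlus k (M.x j) (M.x (j + 1)) fun x => u x t

/-- The Gauss–Radau projection of `q(·, t) = u_x(·, t)` that belongs to the fluxes: `P_h^+ q` if
`q̂ = q⁺` and `P_h^- q` if `q̂ = q⁻`. -/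
def projQ (k : ℕ) (M : Mesh) (u : ℝ → ℝ → ℝ) (t : ℝ) (j : ℕ) : Flux → Polynomial ℝ
  | .minusPlus => radauPlus k (M.x j) (M.x (j + 1)) fun x => dx u x t
  | .plusMinus => radauMinus k (M.x j) (M.x (j + 1)) fun x => dx u x t

/-- The interpolation function `u_I^l(·, t)`, `l = 2`, on the cell `j`. -/
def interpU (k : ℕ) (T : ℝ) (M : Mesh) (u : ℝ → ℝ → ℝ) (t : ℝ) (j : ℕ) (fl : Flux) :
    Polynomial ℝ :=
  projU k M u t j fl - correctionU k T u (M.x j) (M.x (j + 1)) t fl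

/-- The norm of `L²(0, 2π)` of a function in the finite element space. -/
def normL2 (M : Mesh) (v : ℕ → Polynomial ℝ) : ℝ :=
  Real.sqrt (∑ j ∈ Finset.range M.N, ∫ x in M.x j..M.x (j + 1), (v j).eval x ^ 2)

end LDG

end

namespace LDG

noncomputable section

open Polynomial (derivative X C)

/-! ## Legendre polynomials -/

/-! The discrete solution is compared not with the Gauss–Radau projections themselves but with
corrected ones. Against derivatives of polynomials of degree at most k the error of such a
projection vanishes; against the polynomials themselves it reduces to a multiple of L_k
(`integral_radauPoly_mul`). Since L_k is a derivative, integration by parts turns this multiple into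
a term of the kind ∫ F w_x, which a correction of the other unknown cancels at the price of one cell
length. In this way `cellWq` removes the residual of u_t, one term of `cellWu` removes the residual
of q, and its other term removes what `cellWq` itself leaves in the equation for q. All corrections
vanish at the end of the cell from which the flux is taken, so fluxes and boundary conditions do not
notice them; for the second order correction this uses k ≥ 2 (`integral_corr`).

Let z be the corrected projection of u minus u_h, W the correction of u and G the discrete gradient
`grad`. Then G z is exactly the corrected projection of q minus q_h (`grad_error_eq`). Since
alternating fluxes make the two forms of the scheme negative adjoints, also (z_t, v) = -(G z, G v) -
(W_t, v) for all v (`inner_error_eq`). The prescribed initial value is precisely z(0) = 0.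

A discrete Poincaré inequality (`poincare`), with a constant independent of the mesh, controls v by
G v up to the kernel of G. It gives exponential damping of ‖G z‖ in the abstract estimate
`norm_le_of_energy`. The kernel component is controlled because the mean of z + W is conserved.
Hence z and G z are bounded by W and W_t uniformly in time, and the growth factors of the theorem
are at least 1.

It remains to see that the corrections and W_t are O(h^{k+2}). A function in W^{k+4,∞} has k + 3
classical derivatives, the last one Lipschitz continuous, and by the heat equation a time derivative
is two space derivatives. So W_t contains the L_k coefficient of u_xxx, of size h^{k+1}, with a
factor h, and that of u_xxxx, of size h^k, with a factor h² (`exists_norm_correction_bound`). -/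

theorem integral_derivative_mul (p q : Polynomial ℝ) (a b : ℝ) :
    ∫ x in a..b, (derivative p).eval x * q.eval x =
      p.eval b * q.eval b - p.eval a * q.eval a
        - ∫ x in a..b, p.eval x * (derivative q).eval x := by
  have h := intervalIntegral.integral_mul_deriv_eq_deriv_mul (a := a) (b := b)
    (fun x _ => q.hasDerivAt x) (fun x _ => p.hasDerivAt x)
    (Continuous.intervalIntegrable (by fun_prop) _ _)
    (Continuous.intervalIntegrable (by fun_prop) _ _)
  simp only [mul_comm (Polynomial.eval _ (derivative p)),
    mul_comm (Polynomial.eval _ p)]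
  exact h

theorem degree_derivative_lt_of_natDegree_le {k : ℕ} {w : Polynomial ℝ} (hw : w.natDegree ≤ k) :
    (derivative w).degree < k := by
  rcases eq_or_ne w 0 with rfl | h0
  · simp
  · exact (Polynomial.degree_derivative_lt h0).trans_le (Polynomial.natDegree_le_iff_degree_le.1 hw)

theorem eval_iterate_derivative_of_lt (m j : ℕ) (h : j < m) (r : ℝ) (q : Polynomial ℝ) :
    ((derivative)^[j] ((X - C r) ^ m * q)).eval r = 0 := by
  have := Polynomial.aeval_iterate_derivative_of_lt ((X - C r) ^ m * q) m r (p' := q) (by simp) h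
  simpa using this

theorem eval_iterate_derivative_self (m : ℕ) (r : ℝ) (q : Polynomial ℝ) :
    ((derivative)^[m] ((X - C r) ^ m * q)).eval r = m.factorial * q.eval r := by
  have := Polynomial.aeval_iterate_derivative_self ((X - C r) ^ m * q) m r (p' := q) (by simp)
  simpa using this

theorem sq_sub_one_pow_right (m : ℕ) :
    ((X : Polynomial ℝ) ^ 2 - 1) ^ m = (X - C 1) ^ m * (X + 1) ^ m := by
  rw [← mul_pow]; congr 1; simp; ring

theorem sq_sub_one_pow_left (m : ℕ) :
    ((X : Polynomial ℝ) ^ 2 - 1) ^ m = (X - C (-1)) ^ m * (X - 1) ^ m := by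
  rw [← mul_pow]; congr 1; simp; ring

theorem legendre_eval_one (m : ℕ) : (legendre m).eval 1 = 1 := by
  have h : (m.factorial : ℝ) ≠ 0 := by exact_mod_cast m.factorial_ne_zero
  rw [legendre, sq_sub_one_pow_right, Polynomial.eval_mul, eval_iterate_derivative_self]
  simp
  norm_num
  field_simp

theorem legendre_eval_neg_one (m : ℕ) : (legendre m).eval (-1) = (-1) ^ m := by
  have h : (m.factorial : ℝ) ≠ 0 := by exact_mod_cast m.factorial_ne_zero
  rw [legendre, sq_sub_one_pow_left, Polynomial.eval_mul, eval_iterate_derivative_self]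
  simp
  have : (-1 - 1 : ℝ) = (-1) * 2 := by norm_num
  rw [this, mul_pow]
  field_simp

theorem legendre_natDegree_le (m : ℕ) : (legendre m).natDegree ≤ m := by
  rw [legendre]
  refine (Polynomial.natDegree_C_mul_le _ _).trans ?_
  refine (Polynomial.natDegree_iterate_derivative _ _).trans ?_
  have : ((X ^ 2 - 1 : Polynomial ℝ) ^ m).natDegree ≤ m * 2 := by
    refine Polynomial.natDegree_pow_le_of_le m ?_
    compute_degree
  omega

/-- By Rodrigues' formula, m integrations by parts put all derivatives on `w`. The boundary terms
vanish because (x² - 1)^m has zeros of order m at ±1. -/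
theorem legendre_ortho (m : ℕ) (w : Polynomial ℝ) (hw : w.degree < m) :
    ∫ x in (-1 : ℝ)..1, (legendre m).eval x * w.eval x = 0 := by
  have key : ∀ j ≤ m, ∀ w : Polynomial ℝ,
      ∫ x in (-1 : ℝ)..1, ((derivative)^[j] ((X ^ 2 - 1) ^ m)).eval x * w.eval x =
        (-1) ^ j * ∫ x in (-1 : ℝ)..1,
          ((X ^ 2 - 1 : Polynomial ℝ) ^ m).eval x * ((derivative)^[j] w).eval x := by
    intro j
    induction j with
    | zero => intro _ w; simp
    | succ j ih =>
      intro hj w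
      rw [Function.iterate_succ_apply', integral_derivative_mul]
      have h1 : ((derivative)^[j] ((X ^ 2 - 1 : Polynomial ℝ) ^ m)).eval 1 = 0 := by
        rw [sq_sub_one_pow_right]; exact eval_iterate_derivative_of_lt m j (by omega) 1 _
      have h2 : ((derivative)^[j] ((X ^ 2 - 1 : Polynomial ℝ) ^ m)).eval (-1) = 0 := by
        rw [sq_sub_one_pow_left]; exact eval_iterate_derivative_of_lt m j (by omega) (-1) _
      rw [h1, h2, ih (by omega), Function.iterate_succ_apply, pow_succ]
      ring
  have h0 : (derivative)^[m] w = 0 := Polynomial.iterate_derivative_eq_zero_of_degree_lt hw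
  have h := key m le_rfl w
  rw [h0] at h
  simp only [Polynomial.eval_zero, mul_zero, intervalIntegral.integral_zero] at h
  simp only [legendre, Polynomial.eval_mul, Polynomial.eval_C, mul_assoc]
  rw [intervalIntegral.integral_const_mul, h, mul_zero]

/-- The leading terms of x L' and m L agree, so L is orthogonal to x L' - m L. Integrating ∫ L' · x
L by parts gives 2 ∫ x L L' = 2 - ∫ L², and the two relations determine ∫ L². -/
theorem legendre_norm (m : ℕ) :
    ∫ x in (-1 : ℝ)..1, (legendre m).eval x * (legendre m).eval x = 2 / (2 * m + 1) := by
  set L := legendre m with hL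
  have hR : (X * derivative L - C (m : ℝ) * L).degree < (m : WithBot ℕ) := by
    rw [Polynomial.degree_lt_iff_coeff_zero]
    intro n hn
    rcases n with _ | n
    · have : m = 0 := by omega
      subst this; simp
    · rw [Polynomial.coeff_sub, Polynomial.coeff_X_mul, Polynomial.coeff_C_mul,
        Polynomial.coeff_derivative]
      rcases hn.eq_or_lt with h | h
      · rw [h]; push_cast; ring
      · rw [Polynomial.coeff_eq_zero_of_natDegree_lt ((legendre_natDegree_le m).trans_lt h)]; simp
  have h1 := legendre_ortho m _ hR
  have h2 := integral_derivative_mul L (X * L) (-1) 1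
  have hc : ∀ p q : Polynomial ℝ, IntervalIntegrable (fun x => p.eval x * q.eval x) volume (-1) 1 :=
    fun p q => Continuous.intervalIntegrable (by fun_prop) _ _
  have e1 : ∫ x in (-1 : ℝ)..1, L.eval x * (X * derivative L - C (m : ℝ) * L).eval x =
      (∫ x in (-1 : ℝ)..1, L.eval x * (X * derivative L).eval x)
        - m * ∫ x in (-1 : ℝ)..1, L.eval x * L.eval x := by
    rw [← intervalIntegral.integral_const_mul, ← intervalIntegral.integral_sub (hc _ _)
      ((hc _ _).const_mul _)]
    congr 1; ext x; simp; ring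
  have e2 : ∫ x in (-1 : ℝ)..1, L.eval x * (derivative (X * L)).eval x =
      (∫ x in (-1 : ℝ)..1, L.eval x * L.eval x)
        + ∫ x in (-1 : ℝ)..1, L.eval x * (X * derivative L).eval x := by
    rw [← intervalIntegral.integral_add (hc _ _) (hc _ _)]
    congr 1; ext x; simp; ring
  have e3 : ∫ x in (-1 : ℝ)..1, (derivative L).eval x * (X * L).eval x =
      ∫ x in (-1 : ℝ)..1, L.eval x * (X * derivative L).eval x := by
    congr 1; ext x; simp; ring
  have b1 : L.eval 1 = 1 := legendre_eval_one m
  have b2 : L.eval (-1) = (-1) ^ m := legendre_eval_neg_one m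
  have b3 : ((-1 : ℝ) ^ m) * (-1) ^ m = 1 := by rw [← mul_pow]; simp
  rw [← hL] at h1
  rw [e1] at h1
  rw [e2, e3, Polynomial.eval_mul, Polynomial.eval_mul, b1, b2] at h2
  simp only [Polynomial.eval_X] at h2
  rw [eq_div_iff (by positivity)]
  linarith

/-! ### Legendre polynomials on a cell -/

/-- The Legendre polynomial of degree `m` on the cell `(a, b)`, as a polynomial. -/
def cellLeg (m : ℕ) (a b : ℝ) : Polynomial ℝ :=
  (legendre m).comp (C (2 / (b - a)) * X - C ((a + b) / (b - a)))

theorem cellLeg_eval {a b : ℝ} (hab : a < b) (m : ℕ) (x : ℝ) :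
    (cellLeg m a b).eval x = cellLegendre m a b x := by
  have : b - a ≠ 0 := (sub_pos.2 hab).ne'
  simp only [cellLeg, cellLegendre, Polynomial.eval_comp, Polynomial.eval_sub, Polynomial.eval_mul,
    Polynomial.eval_C, Polynomial.eval_X]
  congr 1
  field_simp

theorem cellLeg_natDegree_le (m : ℕ) (a b : ℝ) : (cellLeg m a b).natDegree ≤ m := by
  refine (Polynomial.natDegree_comp_le).trans ?_
  calc _ ≤ m * 1 := Nat.mul_le_mul (legendre_natDegree_le m) (by compute_degree)
    _ = m := mul_one m

theorem integral_comp_cell {a b : ℝ} (hab : a < b) (f : ℝ → ℝ) :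
    ∫ x in a..b, f (2 / (b - a) * x - (a + b) / (b - a)) = (b - a) / 2 * ∫ s in (-1 : ℝ)..1, f s := by
  have h0 : b - a ≠ 0 := (sub_pos.2 hab).ne'
  rw [intervalIntegral.integral_comp_mul_sub _ (by positivity)]
  have h1 : 2 / (b - a) * a - (a + b) / (b - a) = -1 := by field_simp; ring
  have h2 : 2 / (b - a) * b - (a + b) / (b - a) = 1 := by field_simp; ring
  rw [h1, h2, smul_eq_mul, inv_div]

theorem cellLeg_ortho {a b : ℝ} (hab : a < b) (m : ℕ) (w : Polynomial ℝ) (hw : w.degree < m) :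
    ∫ x in a..b, (cellLeg m a b).eval x * w.eval x = 0 := by
  have h0 : b - a ≠ 0 := (sub_pos.2 hab).ne'
  set w' := w.comp (C ((b - a) / 2) * X + C ((a + b) / 2)) with hw'
  have hdeg : w'.degree < m := by
    rcases eq_or_ne w' 0 with h | h
    · simp [h]
    · have hw0 : w ≠ 0 := by rintro rfl; simp [hw'] at h
      rw [Polynomial.degree_eq_natDegree h]
      rw [Polynomial.degree_eq_natDegree hw0] at hw
      have h1 : w'.natDegree ≤ w.natDegree * 1 :=
        (Polynomial.natDegree_comp_le).trans (Nat.mul_le_mul le_rfl (by compute_degree))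
      have h2 : w.natDegree < m := by exact_mod_cast hw
      exact_mod_cast (by omega : w'.natDegree < m)
  have h1 := integral_comp_cell hab fun s => (legendre m).eval s * w'.eval s
  rw [legendre_ortho m w' hdeg, mul_zero] at h1
  rw [← h1]
  congr 1; ext x
  simp only [cellLeg, hw', Polynomial.eval_comp, Polynomial.eval_sub, Polynomial.eval_mul,
    Polynomial.eval_C, Polynomial.eval_X, Polynomial.eval_add]
  congr 2
  field_simp
  ring

theorem cellLeg_norm {a b : ℝ} (hab : a < b) (m : ℕ) :
    ∫ x in a..b, (cellLeg m a b).eval x * (cellLeg m a b).eval x = (b - a) / (2 * m + 1) := by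
  have h1 := integral_comp_cell hab fun s => (legendre m).eval s * (legendre m).eval s
  rw [legendre_norm] at h1
  simp only [cellLeg, Polynomial.eval_comp, Polynomial.eval_sub, Polynomial.eval_mul,
    Polynomial.eval_C, Polynomial.eval_X]
  rw [h1]; field_simp

/-- `e` is the endpoint of the cell `(a, b)` with the reference coordinate `ε = ±1`. -/
def IsEnd (a b e ε : ℝ) : Prop := e = b ∧ ε = 1 ∨ e = a ∧ ε = -1

theorem IsEnd.pow_mul {a b e ε : ℝ} (h : IsEnd a b e ε) (m : ℕ) : ε ^ m * ε ^ m = 1 := by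
  rcases h with ⟨-, rfl⟩ | ⟨-, rfl⟩ <;> simp [← mul_pow]

theorem IsEnd.abs_pow {a b e ε : ℝ} (h : IsEnd a b e ε) (m : ℕ) : |ε ^ m| = 1 := by
  rcases h with ⟨-, rfl⟩ | ⟨-, rfl⟩ <;> simp

theorem IsEnd.or {a b e ε : ℝ} (h : IsEnd a b e ε) : e = a ∨ e = b := by
  rcases h with ⟨h, -⟩ | ⟨h, -⟩ <;> simp [h]

theorem IsEnd.mem {a b e ε : ℝ} (hab : a < b) (h : IsEnd a b e ε) : e ∈ Icc a b := by
  rcases h with ⟨rfl, -⟩ | ⟨rfl, -⟩ <;> simp [hab.le]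

theorem IsEnd.cellLeg_eval {a b e ε : ℝ} (hab : a < b) (h : IsEnd a b e ε) (m : ℕ) :
    (cellLeg m a b).eval e = ε ^ m := by
  have h0 : b - a ≠ 0 := (sub_pos.2 hab).ne'
  simp only [cellLeg, Polynomial.eval_comp, Polynomial.eval_sub, Polynomial.eval_mul,
    Polynomial.eval_C, Polynomial.eval_X]
  rcases h with ⟨rfl, rfl⟩ | ⟨rfl, rfl⟩
  · rw [show 2 / (e - a) * e - (a + e) / (e - a) = 1 by field_simp; ring, legendre_eval_one,
      one_pow]
  · rw [show 2 / (b - e) * e - (e + b) / (b - e) = -1 by field_simp; ring, legendre_eval_neg_one]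

/-! ### Legendre expansions and the Gauss–Radau projection -/

/-- The Legendre coefficient of `v` on a cell. -/
def legCoef (a b : ℝ) (v : ℝ → ℝ) (m : ℕ) : ℝ :=
  (2 * m + 1) / (b - a) * ∫ x in a..b, v x * (cellLeg m a b).eval x

/-- The coefficient of the Legendre polynomial of degree `k` in the expansion of `v - P v`, where
`P` is the Gauss–Radau projection that interpolates at the end `e` of the cell. -/
def coefAt (k : ℕ) (a b e ε : ℝ) (v : ℝ → ℝ) : ℝ :=
  ε ^ k * (-v e + ∑ m ∈ Finset.range (k + 1), ε ^ m * legCoef a b v m)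

theorem intervalIntegrable_mul_eval {a b : ℝ} (hab : a < b) {v : ℝ → ℝ}
    (hv : ContinuousOn v (Icc a b)) (p : Polynomial ℝ) :
    IntervalIntegrable (fun x => v x * p.eval x) volume a b := by
  refine ContinuousOn.intervalIntegrable ?_
  rw [uIcc_of_le hab.le]
  exact hv.mul (by fun_prop)

theorem integral_mul_legendre_sum {a b : ℝ} (hab : a < b) {v : ℝ → ℝ}
    (hv : ContinuousOn v (Icc a b)) (k : ℕ) (c : ℕ → ℝ) :
    1 / (b - a) * ∫ x in a..b, v x *
        ∑ m ∈ Finset.range (k + 1), c m * (2 * (m : ℝ) + 1) * cellLegendre m a b x =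
      ∑ m ∈ Finset.range (k + 1), c m * legCoef a b v m := by
  simp_rw [← cellLeg_eval hab, Finset.mul_sum]
  rw [intervalIntegral.integral_finsetSum]
  · rw [Finset.mul_sum]
    refine Finset.sum_congr rfl fun m _ => ?_
    rw [legCoef]
    have : (fun x => v x * (c m * (2 * (m : ℝ) + 1) * (cellLeg m a b).eval x)) =
      fun x => (c m * (2 * (m : ℝ) + 1)) * (v x * (cellLeg m a b).eval x) := by ext; ring
    rw [this, intervalIntegral.integral_const_mul]
    ring
  · intro m _
    have := (intervalIntegrable_mul_eval hab hv (cellLeg m a b)).const_mul (c m * (2 * (m : ℝ) + 1))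
    refine this.congr ?_
    intro x _
    simp only
    ring

/-- The coefficients for the two projections are the cases ε = 1 and ε = -1 of one formula, since
L_m takes the value ε ^ m at the end ε. From here on both choices of fluxes are treated together. -/
theorem coefMinus_eq {a b : ℝ} (hab : a < b) {v : ℝ → ℝ} (hv : ContinuousOn v (Icc a b)) (k : ℕ) :
    coefMinus k a b v = coefAt k a b b 1 v := by
  have := integral_mul_legendre_sum hab hv k 1
  simp only [Pi.one_apply, one_mul] at this
  simp [coefMinus, coefAt, ← this]

theorem coefPlus_eq {a b : ℝ} (hab : a < b) {v : ℝ → ℝ} (hv : ContinuousOn v (Icc a b)) (k : ℕ) :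
    coefPlus k a b v = coefAt k a b a (-1) v := by
  rw [coefPlus, coefAt, integral_mul_legendre_sum hab hv k fun m => (-1) ^ (k + m)]
  rw [mul_add, Finset.mul_sum]
  congr 1
  · ring
  · refine Finset.sum_congr rfl fun m _ => ?_
    ring

theorem integral_legendre_mul_legendre {a b : ℝ} (hab : a < b) {m n : ℕ} (h : m ≠ n) :
    ∫ x in a..b, (cellLeg m a b).eval x * (cellLeg n a b).eval x = 0 := by
  have key : ∀ {m n : ℕ}, m < n →
      ∫ x in a..b, (cellLeg n a b).eval x * (cellLeg m a b).eval x = 0 := fun {m n} h =>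
    cellLeg_ortho hab n _ ((Polynomial.natDegree_le_iff_degree_le.1
      (cellLeg_natDegree_le m a b)).trans_lt (by exact_mod_cast h))
  rcases h.lt_or_gt with h | h
  · simpa only [mul_comm] using key h
  · exact key h

/-- The Legendre polynomials of degree at most `n` span the polynomials of degree at most `n`. -/
theorem exists_eq_sum_cellLeg {a b : ℝ} (hab : a < b) (n : ℕ) (p : Polynomial ℝ)
    (hp : p.degree < n) : ∃ c : ℕ → ℝ, p = ∑ m ∈ Finset.range n, C (c m) * cellLeg m a b := by
  induction n generalizing p with
  | zero =>
    refine ⟨0, ?_⟩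
    have : p = 0 := by
      ext m
      exact (Polynomial.degree_lt_iff_coeff_zero _ _).1 hp m m.zero_le
    simp [this]
  | succ n ih =>
    -- With a vanishing leading coefficient, L_n would have degree below n and be orthogonal to
    -- itself.
    have hc : (cellLeg n a b).coeff n ≠ 0 := by
      intro h0
      have hdeg : (cellLeg n a b).degree < n := by
        rw [Polynomial.degree_lt_iff_coeff_zero]
        intro m hm
        rcases hm.eq_or_lt with rfl | h
        · exact h0
        · exact Polynomial.coeff_eq_zero_of_natDegree_lt ((cellLeg_natDegree_le n a b).trans_lt h)
      have h1 := cellLeg_ortho hab n _ hdeg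
      rw [cellLeg_norm hab] at h1
      have : 0 < (b - a) / (2 * (n : ℝ) + 1) := div_pos (sub_pos.2 hab) (by positivity)
      linarith
    set r := p.coeff n / (cellLeg n a b).coeff n
    obtain ⟨c, hcs⟩ := ih (p - C r * cellLeg n a b) (by
      rw [Polynomial.degree_lt_iff_coeff_zero]
      intro m hm
      rw [Polynomial.coeff_sub, Polynomial.coeff_C_mul]
      rcases hm.eq_or_lt with rfl | h
      · simp only [r]; field_simp; ring
      · rw [Polynomial.coeff_eq_zero_of_natDegree_lt ((cellLeg_natDegree_le n a b).trans_lt h),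
          (Polynomial.degree_lt_iff_coeff_zero _ _).1 hp m (by omega)]
        simp)
    refine ⟨Function.update c n r, ?_⟩
    rw [Finset.sum_range_succ, Function.update_self]
    rw [Finset.sum_congr rfl (g := fun m => C (c m) * cellLeg m a b), ← hcs]
    · ring
    · intro m hm
      rw [Function.update_of_ne (by have := Finset.mem_range.1 hm; omega)]

/-- The Gauss–Radau projection in terms of Legendre coefficients. -/
def radauPoly (k : ℕ) (a b e ε : ℝ) (v : ℝ → ℝ) : Polynomial ℝ :=
  ∑ m ∈ Finset.range (k + 1), C (legCoef a b v m) * cellLeg m a b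
    - C (coefAt k a b e ε v) * cellLeg k a b

theorem integral_sum_legendre {a b : ℝ} (n : ℕ) (c : ℕ → ℝ) (w : Polynomial ℝ) :
    ∫ x in a..b, (∑ m ∈ Finset.range n, C (c m) * cellLeg m a b).eval x * w.eval x =
      ∑ m ∈ Finset.range n, c m * ∫ x in a..b, (cellLeg m a b).eval x * w.eval x := by
  have : ∀ x, (∑ m ∈ Finset.range n, C (c m) * cellLeg m a b).eval x * w.eval x =
      ∑ m ∈ Finset.range n, c m * ((cellLeg m a b).eval x * w.eval x) := by
    intro x
    rw [Polynomial.eval_finsetSum, Finset.sum_mul]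
    refine Finset.sum_congr rfl fun m _ => ?_
    simp; ring
  simp_rw [this]
  rw [intervalIntegral.integral_finsetSum]
  · simp_rw [intervalIntegral.integral_const_mul]
  · intro m _
    exact Continuous.intervalIntegrable (by fun_prop) _ _

theorem integral_mul_sum_legendre {a b : ℝ} (hab : a < b) {v : ℝ → ℝ}
    (hv : ContinuousOn v (Icc a b)) (n : ℕ) (c : ℕ → ℝ) :
    ∫ x in a..b, v x * (∑ m ∈ Finset.range n, C (c m) * cellLeg m a b).eval x =
      ∑ m ∈ Finset.range n, c m * ((b - a) / (2 * m + 1) * legCoef a b v m) := by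
  have h0 : b - a ≠ 0 := (sub_pos.2 hab).ne'
  have : ∀ x, v x * (∑ m ∈ Finset.range n, C (c m) * cellLeg m a b).eval x =
      ∑ m ∈ Finset.range n, c m * (v x * (cellLeg m a b).eval x) := by
    intro x
    rw [Polynomial.eval_finsetSum, Finset.mul_sum]
    refine Finset.sum_congr rfl fun m _ => ?_
    simp; ring
  simp_rw [this]
  rw [intervalIntegral.integral_finsetSum]
  · simp_rw [intervalIntegral.integral_const_mul]
    refine Finset.sum_congr rfl fun m _ => ?_
    rw [legCoef]
    have : (2 * (m : ℝ) + 1) ≠ 0 := by positivity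
    field_simp
  · intro m _
    exact (intervalIntegrable_mul_eval hab hv _).const_mul _

theorem integral_legendre_sum_mul {a b : ℝ} (hab : a < b) (k : ℕ) (c d : ℕ → ℝ) {n : ℕ}
    (hn : n ≤ k) :
    ∫ x in a..b, (∑ m ∈ Finset.range k, C (c m) * cellLeg m a b).eval x *
        (∑ m ∈ Finset.range n, C (d m) * cellLeg m a b).eval x =
      ∑ m ∈ Finset.range n, d m * ((b - a) / (2 * m + 1) * c m) := by
  rw [integral_mul_sum_legendre hab (by fun_prop)]
  refine Finset.sum_congr rfl fun m hm => ?_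
  congr 2
  rw [legCoef, integral_sum_legendre, Finset.sum_eq_single m]
  · rw [cellLeg_norm hab]
    have : (2 * (m : ℝ) + 1) ≠ 0 := by positivity
    have : b - a ≠ 0 := (sub_pos.2 hab).ne'
    field_simp
  · intro l _ hl
    rw [integral_legendre_mul_legendre hab hl, mul_zero]
  · intro h
    exact absurd (Finset.mem_range.2 ((Finset.mem_range.1 hm).trans_le hn)) h

theorem natDegree_le_iff_degree_lt {p : Polynomial ℝ} {k : ℕ} :
    p.natDegree ≤ k ↔ p.degree < (k + 1 : ℕ) := by
  rw [Polynomial.degree_lt_iff_coeff_zero, Polynomial.natDegree_le_iff_coeff_eq_zero]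
  exact ⟨fun h m hm => h m (by omega), fun h m hm => h m (by omega)⟩

/-- The projection error, tested with a polynomial of degree at most `k`, only sees the Legendre
polynomial of degree `k`. -/
theorem integral_radauPoly_mul {k : ℕ} {a b e ε : ℝ} (hab : a < b) {v : ℝ → ℝ}
    (hv : ContinuousOn v (Icc a b)) (w : Polynomial ℝ) (hw : w.natDegree ≤ k) :
    ∫ x in a..b, (radauPoly k a b e ε v).eval x * w.eval x =
      (∫ x in a..b, v x * w.eval x)
        - coefAt k a b e ε v * ∫ x in a..b, (cellLeg k a b).eval x * w.eval x := by
  obtain ⟨d, rfl⟩ := exists_eq_sum_cellLeg hab (k + 1) w (natDegree_le_iff_degree_lt.1 hw)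
  rw [integral_mul_sum_legendre hab hv, ← integral_legendre_sum_mul hab (k + 1) _ d le_rfl,
    ← intervalIntegral.integral_const_mul, ← intervalIntegral.integral_sub]
  · congr 1; ext x
    rw [radauPoly]
    simp only [Polynomial.eval_sub, Polynomial.eval_mul, Polynomial.eval_C]
    ring
  · exact Continuous.intervalIntegrable (by fun_prop) _ _
  · exact Continuous.intervalIntegrable (by fun_prop) _ _

/-- The Legendre expansion up to degree k has the right moments, and a multiple of L_k does not
affect those below degree k. `coefAt` is the multiple that corrects the value at `e`. -/
theorem isRadau_radauPoly {k : ℕ} {a b e ε : ℝ} (hab : a < b) (he : IsEnd a b e ε) {v : ℝ → ℝ}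
    (hv : ContinuousOn v (Icc a b)) : IsRadau k a b e v (radauPoly k a b e ε v) where
  natDegree_le := by
    refine (Polynomial.natDegree_sub_le _ _).trans (max_le ?_ ?_)
    · refine Polynomial.natDegree_sum_le_of_forall_le _ _ fun m hm => ?_
      exact (Polynomial.natDegree_C_mul_le _ _).trans ((cellLeg_natDegree_le m a b).trans
        (Nat.lt_succ_iff.1 (Finset.mem_range.1 hm)))
    · exact (Polynomial.natDegree_C_mul_le _ _).trans (cellLeg_natDegree_le k a b)
  moments := fun w hw => by
    have hw' : w.natDegree ≤ k :=
      natDegree_le_iff_degree_lt.2 (hw.trans (by exact_mod_cast k.lt_succ_self))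
    rw [integral_radauPoly_mul hab hv w hw', cellLeg_ortho hab k w hw, mul_zero, sub_zero]
  interp := by
    rw [radauPoly, Polynomial.eval_sub, Polynomial.eval_finsetSum]
    simp only [Polynomial.eval_mul, Polynomial.eval_C, he.cellLeg_eval hab]
    rw [coefAt, mul_right_comm, he.pow_mul, one_mul]
    simp_rw [mul_comm (legCoef a b v _)]
    ring

theorem radau_eq {k : ℕ} {a b e ε : ℝ} (hab : a < b) (he : IsEnd a b e ε) {v : ℝ → ℝ}
    (hv : ContinuousOn v (Icc a b)) : radau k a b e v = radauPoly k a b e ε v := by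
  have hex : ∃ p, IsRadau k a b e v p := ⟨_, isRadau_radauPoly hab he hv⟩
  rw [radau, dif_pos hex]
  exact (IsRadau.existsUnique hab he.or hv).unique hex.choose_spec (isRadau_radauPoly hab he hv)

end

noncomputable section

open Polynomial (derivative X C)

/-! ## Correction functions on a cell -/

theorem cellLegendre_eq {a b : ℝ} (hab : a < b) (m : ℕ) :
    cellLegendre m a b = fun x => (cellLeg m a b).eval x :=
  funext fun x => (cellLeg_eval hab m x).symm

theorem hasDerivAt_dInv (a b : ℝ) (p : Polynomial ℝ) (x : ℝ) :
    HasDerivAt (dInv a b fun y => p.eval y) (1 / ((b - a) / 2) * p.eval x) x := by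
  refine HasDerivAt.const_mul _ ?_
  exact intervalIntegral.integral_hasDerivAt_right (Continuous.intervalIntegrable (by fun_prop) _ _)
    (p.continuous.stronglyMeasurableAtFilter _ _) p.continuous.continuousAt

theorem continuous_dInv (a b : ℝ) (p : Polynomial ℝ) : Continuous (dInv a b fun y => p.eval y) :=
  continuous_iff_continuousAt.2 fun x => (hasDerivAt_dInv a b p x).continuousAt

theorem dInv_left (a b : ℝ) (v : ℝ → ℝ) : dInv a b v a = 0 := by simp [dInv]

theorem dInv_right {a b : ℝ} {v : ℝ → ℝ} (h : ∫ x in a..b, v x = 0) : dInv a b v b = 0 := by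
  simp [dInv, h]

theorem IsEnd.dInv_eq_zero {a b e ε : ℝ} (he : IsEnd a b e ε) {v : ℝ → ℝ}
    (h : ∫ x in a..b, v x = 0) : dInv a b v e = 0 := by
  rcases he with ⟨rfl, -⟩ | ⟨rfl, -⟩
  · exact dInv_right h
  · exact dInv_left _ _ _

/-- The zero mean of `p` makes D_s⁻¹ p vanish at both ends, so that integration by parts has no
boundary terms. -/
theorem integral_dInv_mul_derivative {a b : ℝ} (hab : a < b) (p w : Polynomial ℝ)
    (h : ∫ x in a..b, p.eval x = 0) :
    ∫ x in a..b, p.eval x * w.eval x =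
      -((b - a) / 2 * ∫ x in a..b, dInv a b (fun y => p.eval y) x * (derivative w).eval x) := by
  have h0 : b - a ≠ 0 := (sub_pos.2 hab).ne'
  rw [intervalIntegral.integral_mul_deriv_eq_deriv_mul
    (u := dInv a b fun y => p.eval y) (v := fun x => w.eval x)
    (fun x _ => hasDerivAt_dInv a b p x) (fun x _ => w.hasDerivAt x)
    (Continuous.intervalIntegrable (by fun_prop) _ _)
    (Continuous.intervalIntegrable (by fun_prop) _ _), dInv_left, dInv_right h]
  simp_rw [mul_assoc]
  rw [intervalIntegral.integral_const_mul]
  field_simp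
  ring

/-- The Gauss–Radau projection at the end `e` of `D_s⁻¹ L_k`. -/
def corr (k : ℕ) (a b e : ℝ) : Polynomial ℝ := radau k a b e (dInv a b (cellLegendre k a b))

/-- The Gauss–Radau projection at the end `e` of `D_s⁻¹` of `corr` at the other end. -/
def corrBar (k : ℕ) (a b e e' : ℝ) : Polynomial ℝ :=
  radau k a b e (dInv a b fun x => (corr k a b e').eval x)

variable {k : ℕ} {a b e ε e' ε' : ℝ}

theorem isRadau_radau (hab : a < b) (he : IsEnd a b e ε) {v : ℝ → ℝ}
    (hv : ContinuousOn v (Icc a b)) : IsRadau k a b e v (radau k a b e v) := by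
  rw [radau_eq hab he hv]
  exact isRadau_radauPoly hab he hv

theorem isRadau_corr (hab : a < b) (he : IsEnd a b e ε) :
    IsRadau k a b e (dInv a b fun x => (cellLeg k a b).eval x) (corr k a b e) := by
  rw [corr, cellLegendre_eq hab]
  exact isRadau_radau hab he (continuous_dInv _ _ _).continuousOn

theorem isRadau_corrBar (hab : a < b) (he : IsEnd a b e ε) :
    IsRadau k a b e (dInv a b fun x => (corr k a b e').eval x) (corrBar k a b e e') :=
  isRadau_radau hab he (continuous_dInv _ _ _).continuousOn

theorem integral_cellLeg (hab : a < b) (hk : 0 < k) : ∫ x in a..b, (cellLeg k a b).eval x = 0 := by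
  have := cellLeg_ortho hab k 1 (by rw [Polynomial.degree_one]; exact_mod_cast hk)
  simpa using this

/-- This is what keeps the corrections invisible to the fluxes: the primitive of L_k vanishes at
both ends and the projection interpolates it at `e`. -/
theorem corr_eval_end (hab : a < b) (hk : 0 < k) (he : IsEnd a b e ε) :
    (corr k a b e).eval e = 0 := by
  rw [(isRadau_corr hab he).interp, he.dInv_eq_zero (integral_cellLeg hab hk)]

/-- After integration by parts the test polynomial is a derivative, of degree below k, so the
primitive may be replaced by its projection. The end `e` is arbitrary; the L_k residual of one
equation can thus be moved into the derivative term of the same equation, onto the other unknown. -/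
theorem integral_cellLeg_mul (hab : a < b) (hk : 0 < k) (he : IsEnd a b e ε) (w : Polynomial ℝ)
    (hw : w.natDegree ≤ k) :
    ∫ x in a..b, (cellLeg k a b).eval x * w.eval x =
      -((b - a) / 2 * ∫ x in a..b, (corr k a b e).eval x * (derivative w).eval x) := by
  rw [(isRadau_corr hab he).moments _ (degree_derivative_lt_of_natDegree_le hw),
    integral_dInv_mul_derivative hab _ _ (integral_cellLeg hab hk)]

/-- Take `w = X` in the preceding identity: for k ≥ 2 the left side vanishes by orthogonality, and
w' = 1. Zero mean is what lets the construction be repeated once more for `corrBar`. -/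
theorem integral_corr (hab : a < b) (hk : 2 ≤ k) (he : IsEnd a b e ε) :
    ∫ x in a..b, (corr k a b e).eval x = 0 := by
  have h0 : b - a ≠ 0 := (sub_pos.2 hab).ne'
  have h1 := integral_cellLeg_mul hab (by omega : 0 < k) he X (by rw [Polynomial.natDegree_X]; omega)
  rw [cellLeg_ortho hab k X (by rw [Polynomial.degree_X]; exact_mod_cast hk)] at h1
  simp only [Polynomial.derivative_X, Polynomial.eval_one, mul_one] at h1
  rcases mul_eq_zero.1 (neg_eq_zero.1 h1.symm) with h | h
  · exact absurd h (by positivity)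
  · exact h

theorem corrBar_eval_end (hab : a < b) (hk : 2 ≤ k) (he : IsEnd a b e ε) (he' : IsEnd a b e' ε') :
    (corrBar k a b e e').eval e = 0 := by
  rw [(isRadau_corrBar hab he).interp, he.dInv_eq_zero (integral_corr hab hk he')]

theorem integral_corr_mul (hab : a < b) (hk : 2 ≤ k) (he : IsEnd a b e ε) (he' : IsEnd a b e' ε')
    (w : Polynomial ℝ) (hw : w.natDegree ≤ k) :
    ∫ x in a..b, (corr k a b e').eval x * w.eval x =
      -((b - a) / 2 * ∫ x in a..b, (corrBar k a b e e').eval x * (derivative w).eval x) := by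
  rw [(isRadau_corrBar hab he).moments _ (degree_derivative_lt_of_natDegree_le hw),
    integral_dInv_mul_derivative hab _ _ (integral_corr hab hk he')]

theorem integral_radau_mul (hab : a < b) (he : IsEnd a b e ε) {v : ℝ → ℝ}
    (hv : ContinuousOn v (Icc a b)) (w : Polynomial ℝ) (hw : w.natDegree ≤ k) :
    ∫ x in a..b, (radau k a b e v).eval x * w.eval x =
      (∫ x in a..b, v x * w.eval x)
        - coefAt k a b e ε v * ∫ x in a..b, (cellLeg k a b).eval x * w.eval x := by
  rw [radau_eq hab he hv, integral_radauPoly_mul hab hv w hw]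

/-- The correction function of `u` with coefficients `α`, `β`. -/
def cellWu (k : ℕ) (a b e e' α β : ℝ) : Polynomial ℝ :=
  C (((b - a) / 2) ^ 2 * α) * corrBar k a b e e' + C ((b - a) / 2 * β) * corr k a b e

/-- The correction function of `q` with coefficient `α`. -/
def cellWq (k : ℕ) (a b e' α : ℝ) : Polynomial ℝ := C ((b - a) / 2 * α) * corr k a b e'

theorem cellWu_eval_end (hab : a < b) (hk : 2 ≤ k) (he : IsEnd a b e ε) (he' : IsEnd a b e' ε')
    (α β : ℝ) : (cellWu k a b e e' α β).eval e = 0 := by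
  simp [cellWu, corr_eval_end hab (by omega : 0 < k) he, corrBar_eval_end hab hk he he']

theorem cellWq_eval_end (hab : a < b) (hk : 2 ≤ k) (he' : IsEnd a b e' ε') (α : ℝ) :
    (cellWq k a b e' α).eval e' = 0 := by
  simp [cellWq, corr_eval_end hab (by omega : 0 < k) he']

theorem cellWu_natDegree_le (hab : a < b) (he : IsEnd a b e ε) (α β : ℝ) :
    (cellWu k a b e e' α β).natDegree ≤ k :=
  Polynomial.natDegree_add_le_of_degree_le
    ((Polynomial.natDegree_C_mul_le _ _).trans (isRadau_corrBar hab he).natDegree_le)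
    ((Polynomial.natDegree_C_mul_le _ _).trans (isRadau_corr hab he).natDegree_le)

theorem cellWq_natDegree_le (hab : a < b) (he' : IsEnd a b e' ε') (α : ℝ) :
    (cellWq k a b e' α).natDegree ≤ k :=
  (Polynomial.natDegree_C_mul_le _ _).trans (isRadau_corr hab he').natDegree_le

theorem integral_eval_mul_sub (p q w : Polynomial ℝ) (a b : ℝ) :
    ∫ x in a..b, (p - q).eval x * w.eval x =
      (∫ x in a..b, p.eval x * w.eval x) - ∫ x in a..b, q.eval x * w.eval x := by
  rw [← intervalIntegral.integral_sub (Continuous.intervalIntegrable (by fun_prop) _ _)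
    (Continuous.intervalIntegrable (by fun_prop) _ _)]
  simp [sub_mul]

theorem integral_eval_mul_add (p q w : Polynomial ℝ) (a b : ℝ) :
    ∫ x in a..b, (p + q).eval x * w.eval x =
      (∫ x in a..b, p.eval x * w.eval x) + ∫ x in a..b, q.eval x * w.eval x := by
  rw [← intervalIntegral.integral_add (Continuous.intervalIntegrable (by fun_prop) _ _)
    (Continuous.intervalIntegrable (by fun_prop) _ _)]
  simp [add_mul]

theorem integral_eval_C_mul (c : ℝ) (p w : Polynomial ℝ) (a b : ℝ) :
    ∫ x in a..b, (C c * p).eval x * w.eval x = c * ∫ x in a..b, p.eval x * w.eval x := by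
  rw [← intervalIntegral.integral_const_mul]
  simp [mul_assoc]

/-- The corrected projections satisfy the second equation of the scheme exactly. -/
theorem cell_consistency_q (hab : a < b) (hk : 2 ≤ k) (he : IsEnd a b e ε) (he' : IsEnd a b e' ε')
    {u q : ℝ → ℝ} (hu : ContinuousOn u (Icc a b)) (hq : ContinuousOn q (Icc a b)) (α : ℝ)
    (w : Polynomial ℝ) (hw : w.natDegree ≤ k) :
    (∫ x in a..b, (radau k a b e' q - cellWq k a b e' α).eval x * w.eval x) +
      (∫ x in a..b, (radau k a b e u - cellWu k a b e e' α (coefAt k a b e' ε' q)).eval x *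
        (derivative w).eval x) =
      (∫ x in a..b, q x * w.eval x) + ∫ x in a..b, u x * (derivative w).eval x := by
  -- Two cancellations: the L_k residual of the projection of q against the `corr` term of `cellWu`,
  -- and `cellWq` against the `corrBar` term.
  rw [integral_eval_mul_sub, integral_eval_mul_sub, integral_radau_mul hab he' hq w hw,
    (isRadau_radau hab he hu).moments _ (degree_derivative_lt_of_natDegree_le hw), cellWu,
    integral_eval_mul_add, integral_eval_C_mul, integral_eval_C_mul, cellWq, integral_eval_C_mul,
    integral_corr_mul hab hk he he' w hw, integral_cellLeg_mul hab (by omega) he w hw]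
  ring

/-- The first equation of the scheme for the corrected projection of `q`. -/
theorem cell_consistency_u (hab : a < b) (hk : 2 ≤ k) (he : IsEnd a b e ε) (he' : IsEnd a b e' ε')
    {ut q : ℝ → ℝ} (hut : ContinuousOn ut (Icc a b)) (hq : ContinuousOn q (Icc a b))
    (v : Polynomial ℝ) (hv : v.natDegree ≤ k) :
    (∫ x in a..b, (radau k a b e ut).eval x * v.eval x) +
      (∫ x in a..b, (radau k a b e' q - cellWq k a b e' (coefAt k a b e ε ut)).eval x *
        (derivative v).eval x) =
      (∫ x in a..b, ut x * v.eval x) + ∫ x in a..b, q x * (derivative v).eval x := by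
  -- The L_k residual of the projection of u_t cancels against `cellWq`, whose coefficient is chosen
  -- for this.
  rw [integral_eval_mul_sub, integral_radau_mul hab he hut v hv,
    (isRadau_radau hab he' hq).moments _ (degree_derivative_lt_of_natDegree_le hv), cellWq,
    integral_eval_C_mul, integral_cellLeg_mul hab (by omega) he' v hv]
  ring

/-! ## Bounds on a cell -/

theorem exists_legendre_bound (k : ℕ) :
    ∃ B : ℝ, 1 ≤ B ∧ ∀ m ≤ k, ∀ s ∈ Icc (-1 : ℝ) 1, |(legendre m).eval s| ≤ B := by
  have h1 : ∀ m : ℕ, ∃ B : ℝ, 0 ≤ B ∧ ∀ s ∈ Icc (-1 : ℝ) 1, |(legendre m).eval s| ≤ B := fun m => by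
    obtain ⟨B, hB⟩ := isCompact_Icc.exists_bound_of_continuousOn
      (s := Icc (-1 : ℝ) 1) (f := fun s => (legendre m).eval s) (by fun_prop)
    exact ⟨|B|, abs_nonneg B, fun s hs => (hB s hs).trans (le_abs_self B)⟩
  choose B hB0 hB using h1
  refine ⟨1 + ∑ m ∈ Finset.range (k + 1), B m, ?_, fun m hm s hs => (hB m s hs).trans ?_⟩
  · linarith [Finset.sum_nonneg fun m (_ : m ∈ Finset.range (k + 1)) => hB0 m]
  · have := Finset.single_le_sum (f := B) (fun m _ => hB0 m)
      (Finset.mem_range.2 (Nat.lt_succ_of_le hm))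
    linarith

theorem cellLeg_bound {B : ℝ} (hB : ∀ m ≤ k, ∀ s ∈ Icc (-1 : ℝ) 1, |(legendre m).eval s| ≤ B)
    (hab : a < b) {m : ℕ} (hm : m ≤ k) {x : ℝ} (hx : x ∈ Icc a b) :
    |(cellLeg m a b).eval x| ≤ B := by
  have h0 : 0 < b - a := sub_pos.2 hab
  rw [cellLeg_eval hab, cellLegendre]
  refine hB m hm _ ⟨?_, ?_⟩
  · rw [le_div_iff₀ (by linarith)]; linarith [hx.1]
  · rw [div_le_iff₀ (by linarith)]; linarith [hx.2]

theorem legCoef_bound {B V : ℝ} (hB1 : 1 ≤ B)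
    (hB : ∀ m ≤ k, ∀ s ∈ Icc (-1 : ℝ) 1, |(legendre m).eval s| ≤ B)
    (hab : a < b) {m : ℕ} (hm : m ≤ k) {v : ℝ → ℝ} (hV : 0 ≤ V) (hv : ∀ x ∈ Icc a b, |v x| ≤ V) :
    |legCoef a b v m| ≤ (2 * k + 1) * B * V := by
  have h0 : 0 < b - a := sub_pos.2 hab
  have h1 : |∫ x in a..b, v x * (cellLeg m a b).eval x| ≤ V * B * |b - a| := by
    rw [← Real.norm_eq_abs]
    refine intervalIntegral.norm_integral_le_of_norm_le_const fun x hx => ?_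
    rw [uIoc_of_le hab.le] at hx
    have hx' := Ioc_subset_Icc_self hx
    rw [Real.norm_eq_abs, abs_mul]
    exact mul_le_mul (hv x hx') (cellLeg_bound hB hab hm hx') (abs_nonneg _) hV
  rw [abs_of_pos h0] at h1
  rw [legCoef, abs_mul, abs_of_nonneg (by positivity)]
  calc _ ≤ (2 * (m : ℝ) + 1) / (b - a) * (V * B * (b - a)) := by gcongr
    _ = (2 * m + 1) * B * V := by field_simp
    _ ≤ _ := by gcongr

/-- Everything is invariant under scaling of the cell: Legendre coefficients are averages against
polynomials that are bounded on the reference cell. So the constant depends on k only. -/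
theorem exists_radau_bound (k : ℕ) :
    ∃ A : ℝ, 1 ≤ A ∧ ∀ a b e ε : ℝ, a < b → IsEnd a b e ε →
      (∀ x ∈ Icc a b, |(cellLeg k a b).eval x| ≤ A) ∧
      ∀ (v : ℝ → ℝ) (V : ℝ), 0 ≤ V → (∀ x ∈ Icc a b, |v x| ≤ V) → 
        |coefAt k a b e ε v| ≤ A * V ∧
        (ContinuousOn v (Icc a b) → ∀ x ∈ Icc a b, |(radau k a b e v).eval x| ≤ A * V) := by
  obtain ⟨B, hB1, hB⟩ := exists_legendre_bound k
  -- `G` accounts for one point value and k + 1 Legendre coefficients, each bounded by (2k + 1) B.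
  -- In 2 G B, one half is for the truncated expansion and the other for the multiple of L_k.
  set G : ℝ := 1 + (k + 1) * ((2 * k + 1) * B) with hG
  have hG1 : 1 ≤ G := by
    have : 0 ≤ ((k : ℝ) + 1) * ((2 * k + 1) * B) := by positivity
    linarith
  refine ⟨2 * G * B, by nlinarith, fun a b e ε hab he => ⟨fun x hx => ?_, fun v V hV hv => ?_⟩⟩
  · refine (cellLeg_bound hB hab le_rfl hx).trans ?_
    nlinarith
  · have hc : |coefAt k a b e ε v| ≤ G * V := by
      rw [coefAt, abs_mul, he.abs_pow, one_mul]
      refine (abs_add_le _ _).trans ?_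
      rw [abs_neg, hG, add_mul, one_mul]
      refine add_le_add (hv e (he.mem hab)) ?_
      refine (Finset.abs_sum_le_sum_abs _ _).trans ?_
      refine (Finset.sum_le_card_nsmul _ _ ((2 * k + 1) * B * V) fun m hm => ?_).trans ?_
      · rw [abs_mul, he.abs_pow, one_mul]
        exact legCoef_bound hB1 hB hab (Nat.lt_succ_iff.1 (Finset.mem_range.1 hm)) hV hv
      · rw [Finset.card_range, nsmul_eq_mul]; push_cast; linarith
    have hGV : 0 ≤ G * V := by positivity
    refine ⟨hc.trans (by nlinarith), fun hvc x hx => ?_⟩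
    rw [radau_eq hab he hvc, radauPoly, Polynomial.eval_sub, Polynomial.eval_finsetSum]
    refine (abs_sub _ _).trans ?_
    have h1 : |∑ m ∈ Finset.range (k + 1), (C (legCoef a b v m) * cellLeg m a b).eval x| ≤
        (k + 1) * ((2 * k + 1) * B * V * B) := by
      refine (Finset.abs_sum_le_sum_abs _ _).trans ?_
      refine (Finset.sum_le_card_nsmul _ _ ((2 * k + 1) * B * V * B) fun m hm => ?_).trans ?_
      · have hm' := Nat.lt_succ_iff.1 (Finset.mem_range.1 hm)
        rw [Polynomial.eval_mul, Polynomial.eval_C, abs_mul]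
        exact mul_le_mul (legCoef_bound hB1 hB hab hm' hV hv) (cellLeg_bound hB hab hm' hx)
          (abs_nonneg _) (by positivity)
      · rw [Finset.card_range, nsmul_eq_mul]; push_cast; linarith
    have h2 : |(C (coefAt k a b e ε v) * cellLeg k a b).eval x| ≤ G * V * B := by
      rw [Polynomial.eval_mul, Polynomial.eval_C, abs_mul]
      exact mul_le_mul hc (cellLeg_bound hB hab le_rfl hx) (abs_nonneg _) hGV
    have h3 : ((k : ℝ) + 1) * ((2 * k + 1) * B * V * B) ≤ G * V * B := by
      have : 0 ≤ V * B := by positivity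
      calc _ = ((k : ℝ) + 1) * ((2 * k + 1) * B) * (V * B) := by ring
        _ ≤ G * (V * B) := by gcongr; linarith
        _ = _ := by ring
    linarith

theorem dInv_bound (hab : a < b) {v : ℝ → ℝ} {V : ℝ} (hv : ∀ x ∈ Icc a b, |v x| ≤ V) {x : ℝ}
    (hx : x ∈ Icc a b) : |dInv a b v x| ≤ 2 * V := by
  have h0 : 0 < b - a := sub_pos.2 hab
  have hV : 0 ≤ V := (abs_nonneg _).trans (hv x hx)
  have h1 : |∫ y in a..x, v y| ≤ V * |x - a| := by
    rw [← Real.norm_eq_abs]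
    refine intervalIntegral.norm_integral_le_of_norm_le_const fun y hy => ?_
    rw [uIoc_of_le hx.1] at hy
    exact hv y ⟨hy.1.le, hy.2.trans hx.2⟩
  rw [abs_of_nonneg (sub_nonneg.2 hx.1)] at h1
  rw [dInv, abs_mul, abs_of_pos (by positivity)]
  calc _ ≤ 1 / ((b - a) / 2) * (V * (b - a)) := by
        gcongr; exact h1.trans (by gcongr; exact hx.2)
    _ = 2 * V := by field_simp

/-- The correction functions are bounded independently of the cell. -/
theorem exists_corr_bound (k : ℕ) :
    ∃ A : ℝ, 1 ≤ A ∧ ∀ a b e ε e' ε' : ℝ, a < b → IsEnd a b e ε → IsEnd a b e' ε' →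
      (∀ x ∈ Icc a b, |(corr k a b e).eval x| ≤ A) ∧
      (∀ x ∈ Icc a b, |(corrBar k a b e e').eval x| ≤ A) := by
  obtain ⟨A, hA1, hA⟩ := exists_radau_bound k
  have key : ∀ a b e ε : ℝ, a < b → IsEnd a b e ε →
      ∀ x ∈ Icc a b, |(corr k a b e).eval x| ≤ A * (2 * A) := fun a b e ε hab he x hx => by
    rw [corr, cellLegendre_eq hab]
    exact ((hA a b e ε hab he).2 _ (2 * A) (by positivity) fun x hx =>
      dInv_bound hab (hA a b e ε hab he).1 hx).2 (continuous_dInv _ _ _).continuousOn x hx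
  have hA0 : 0 ≤ A := by linarith
  -- Starting from |L_k| ≤ A, each D_s⁻¹ contributes a factor 2 and each projection a factor A.
  refine ⟨A * (2 * (A * (2 * A))), ?_, fun a b e ε e' ε' hab he he' => ⟨fun x hx => ?_, ?_⟩⟩
  · have : 1 ≤ A * A := by nlinarith
    nlinarith
  · refine (key a b e ε hab he x hx).trans ?_
    have : A * (2 * A) ≤ A * (A * (2 * A)) := le_mul_of_one_le_left (by positivity) hA1
    nlinarith
  · exact ((hA a b e ε hab he).2 _ (2 * (A * (2 * A))) (by positivity) fun x hx =>
      dInv_bound hab (key a b e' ε' hab he') hx).2 (continuous_dInv _ _ _).continuousOn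

/-! ### Polynomial approximation and the order of the coefficients -/

theorem exists_derivative_eq (p : Polynomial ℝ) {n : ℕ} (hp : p.natDegree ≤ n) :
    ∃ P : Polynomial ℝ, derivative P = p ∧ P.natDegree ≤ n + 1 := by
  refine ⟨∑ i ∈ Finset.range (n + 1), Polynomial.monomial (i + 1) (p.coeff i / (i + 1)), ?_, ?_⟩
  · rw [Polynomial.derivative_sum]
    conv_rhs => rw [p.as_sum_range' (n + 1) (Nat.lt_succ_of_le hp)]
    refine Finset.sum_congr rfl fun i _ => ?_
    rw [Polynomial.derivative_monomial]
    have : (i : ℝ) + 1 ≠ 0 := by positivity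
    simp
    field_simp
  · refine Polynomial.natDegree_sum_le_of_forall_le _ _ fun i hi => ?_
    refine (Polynomial.natDegree_monomial_le _).trans ?_
    have := Finset.mem_range.1 hi
    omega

/-- Here `f i` is the derivative of order i of `f 0`. Integrate an approximation of `f 1` and match
the value at `a`; the mean value inequality then gains a factor b - a in each step of the induction.
-/
theorem exists_taylor (n : ℕ) : ∀ (f : ℕ → ℝ → ℝ) (K : ℝ), 
    (∀ i < n, ∀ x, HasDerivAt (f i) (f (i + 1) x) x) →
    (∀ x ∈ Icc a b, ∀ y ∈ Icc a b, |f n x - f n y| ≤ K * |x - y|) → a < b → 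
    ∃ p : Polynomial ℝ, p.natDegree ≤ n ∧ ∀ x ∈ Icc a b, |f 0 x - p.eval x| ≤ K * (b - a) ^ (n + 1) := by
  induction n with
  | zero =>
    intro f K _ hK hab
    have hK0 : 0 ≤ K := by
      have := (abs_nonneg _).trans (hK b (right_mem_Icc.2 hab.le) a (left_mem_Icc.2 hab.le))
      exact nonneg_of_mul_nonneg_left this (abs_pos.2 (sub_pos.2 hab).ne')
    refine ⟨C (f 0 a), by simp, fun x hx => ?_⟩
    have := hK x hx a (left_mem_Icc.2 hab.le)
    rw [abs_of_nonneg (sub_nonneg.2 hx.1)] at this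
    simp only [Polynomial.eval_C, zero_add, pow_one]
    exact this.trans (by gcongr; exact hx.2)
  | succ n ih =>
    intro f K hf hK hab
    obtain ⟨p, hp, hpK⟩ := ih (fun i => f (i + 1)) K (fun i hi => hf (i + 1) (by omega)) hK hab
    obtain ⟨P, hP, hPn⟩ := exists_derivative_eq p hp
    refine ⟨P + C (f 0 a - P.eval a), ?_, fun x hx => ?_⟩
    · exact Polynomial.natDegree_add_le_of_degree_le hPn (by simp)
    · have hd : ∀ y ∈ Icc a b, HasDerivWithinAt (fun y => f 0 y - P.eval y) (f 1 y - p.eval y)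
          (Icc a b) y := fun y _ => by
        have := (hf 0 (by omega) y).sub (P.hasDerivAt y)
        rw [hP] at this
        exact this.hasDerivWithinAt
      have h1 := (convex_Icc a b).norm_image_sub_le_of_norm_hasDerivWithin_le hd
        (fun y hy => by simpa using hpK y hy) (left_mem_Icc.2 hab.le) hx
      simp only [Real.norm_eq_abs] at h1
      rw [abs_of_nonneg (sub_nonneg.2 hx.1)] at h1
      have h2 : f 0 x - (P + C (f 0 a - P.eval a)).eval x = f 0 x - P.eval x - (f 0 a - P.eval a) := by
        simp; ring
      rw [h2]
      refine h1.trans ?_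
      have hK0 : 0 ≤ K * (b - a) ^ (n + 1) := (abs_nonneg _).trans (hpK x hx)
      calc _ ≤ K * (b - a) ^ (n + 1) * (b - a) := by gcongr; exact hx.2
        _ = _ := by ring

/-- The projection reproduces polynomials of degree at most k, so its residual is zero; testing the
residual with L_k itself isolates the coefficient. -/
theorem coefAt_polynomial (hab : a < b) (he : IsEnd a b e ε) (p : Polynomial ℝ)
    (hp : p.natDegree ≤ k) : coefAt k a b e ε (fun x => p.eval x) = 0 := by
  have hpc : ContinuousOn (fun x => p.eval x) (Icc a b) := by fun_prop
  have h1 : radau k a b e (fun x => p.eval x) = p :=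
    (IsRadau.existsUnique hab he.or hpc).unique (isRadau_radau hab he hpc)
      ⟨hp, fun _ _ => rfl, rfl⟩
  have h2 := integral_radau_mul hab he hpc (cellLeg k a b) (cellLeg_natDegree_le k a b)
  rw [h1, cellLeg_norm hab] at h2
  have h3 : 0 < (b - a) / (2 * (k : ℝ) + 1) := div_pos (sub_pos.2 hab) (by positivity)
  nlinarith

theorem legCoef_sub (hab : a < b) {v w : ℝ → ℝ} (hv : ContinuousOn v (Icc a b))
    (hw : ContinuousOn w (Icc a b)) (m : ℕ) :
    legCoef a b (fun x => v x - w x) m = legCoef a b v m - legCoef a b w m := by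
  rw [legCoef, legCoef, legCoef, ← mul_sub, ← intervalIntegral.integral_sub
    (intervalIntegrable_mul_eval hab hv _) (intervalIntegrable_mul_eval hab hw _)]
  simp only [sub_mul]

theorem coefAt_sub (hab : a < b) {v w : ℝ → ℝ} (hv : ContinuousOn v (Icc a b))
    (hw : ContinuousOn w (Icc a b)) :
    coefAt k a b e ε (fun x => v x - w x) = coefAt k a b e ε v - coefAt k a b e ε w := by
  simp only [coefAt, legCoef_sub hab hv hw, mul_sub, Finset.sum_sub_distrib]
  ring

/-- The coefficient of a function with a Lipschitz continuous derivative of order `n ≤ k` is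
`O(h ^ (n + 1))`. -/
theorem exists_coefAt_bound (k : ℕ) :
    ∃ A : ℝ, 1 ≤ A ∧ ∀ a b e ε : ℝ, a < b → IsEnd a b e ε → ∀ n ≤ k, ∀ (f : ℕ → ℝ → ℝ) (K : ℝ),
      Continuous (f 0) → (∀ i < n, ∀ x, HasDerivAt (f i) (f (i + 1) x) x) →
      (∀ x ∈ Icc a b, ∀ y ∈ Icc a b, |f n x - f n y| ≤ K * |x - y|) →
      |coefAt k a b e ε (f 0)| ≤ A * (K * (b - a) ^ (n + 1)) := by
  obtain ⟨A, hA1, hA⟩ := exists_radau_bound k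
  refine ⟨A, hA1, fun a b e ε hab he n hn f K hf0 hf hK => ?_⟩
  obtain ⟨p, hp, hpK⟩ := exists_taylor n f K hf hK hab
  -- A Bramble–Hilbert argument: the coefficient is bounded in the supremum norm and does not change
  -- when the Taylor polynomial is subtracted.
  have h1 := coefAt_sub (k := k) (e := e) (ε := ε) hab hf0.continuousOn
    (w := fun x => p.eval x) (by fun_prop)
  rw [coefAt_polynomial hab he p (hp.trans hn), sub_zero] at h1
  rw [← h1]
  exact ((hA a b e ε hab he).2 _ _ ((abs_nonneg _).trans (hpK a (left_mem_Icc.2 hab.le))) hpK).1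

end

noncomputable section

/-! ## Weak derivatives and classical derivatives -/

/-- Test functions on `(0, 2π)`. -/
structure IsTest (φ : ℝ → ℝ) : Prop where
  contDiff : ContDiff ℝ ∞ φ
  hasCompactSupport : HasCompactSupport φ
  tsupport_subset : tsupport φ ⊆ Ioo 0 (2 * Real.pi)

instance : IsFiniteMeasure muOmega := by unfold muOmega; infer_instance

theorem IsTest.eq_zero {φ : ℝ → ℝ} (hφ : IsTest φ) {x : ℝ} (hx : x ∉ Ioo 0 (2 * Real.pi)) :
    φ x = 0 := image_eq_zero_of_notMem_tsupport fun h => hx (hφ.tsupport_subset h)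

theorem IsTest.deriv {φ : ℝ → ℝ} (hφ : IsTest φ) : IsTest (deriv φ) where
  contDiff := (contDiff_infty_iff_deriv.1 hφ.contDiff).2
  hasCompactSupport := hφ.hasCompactSupport.deriv
  tsupport_subset := tsupport_deriv_subset.trans hφ.tsupport_subset

theorem integral_muOmega (f : ℝ → ℝ) :
    ∫ x, f x ∂muOmega = ∫ x in (0 : ℝ)..2 * Real.pi, f x := by
  rw [intervalIntegral.integral_of_le Real.two_pi_pos.le, integral_Ioc_eq_integral_Ioo]; rfl

theorem intervalIntegrable_of_muOmega {f : ℝ → ℝ} (hf : Integrable f muOmega) :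
    IntervalIntegrable f volume 0 (2 * Real.pi) := by
  rw [intervalIntegrable_iff_integrableOn_Ioo_of_le Real.two_pi_pos.le]; exact hf

theorem IsTest.integrable_mul {φ : ℝ → ℝ} (hφ : IsTest φ) {f : ℝ → ℝ} (hf : Integrable f muOmega) :
    Integrable (fun x => f x * φ x) muOmega := by
  obtain ⟨B, hB⟩ := hφ.hasCompactSupport.exists_bound_of_continuous hφ.contDiff.continuous
  exact hf.mul_bdd hφ.contDiff.continuous.aestronglyMeasurable (ae_of_all _ hB)

theorem ae_eq_zero_of_integral_test {f : ℝ → ℝ} (hf : Integrable f muOmega)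
    (h : ∀ φ, IsTest φ → ∫ x, f x * φ x ∂muOmega = 0) : f =ᵐ[muOmega] 0 := by
  have h1 := isOpen_Ioo.ae_eq_zero_of_integral_contDiff_smul_eq_zero (μ := volume)
    (U := Ioo 0 (2 * Real.pi)) (f := f) (IntegrableOn.locallyIntegrableOn hf) fun φ h1 h2 h3 => by
      have hφ : IsTest φ := ⟨h1, h2, h3⟩
      rw [← h φ hφ, muOmega, setIntegral_eq_integral_of_forall_compl_eq_zero fun x hx => by
        rw [hφ.eq_zero hx, mul_zero]]
      simp [mul_comm]
  rw [muOmega, Filter.EventuallyEq, ae_restrict_iff' measurableSet_Ioo]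
  exact h1

theorem exists_isTest_integral_eq_one : ∃ ρ, IsTest ρ ∧ ∫ x, ρ x ∂muOmega = 1 := by
  have hpi := Real.pi_pos
  let f : ContDiffBump (Real.pi : ℝ) := ⟨Real.pi / 4, Real.pi / 2, by positivity, by linarith⟩
  have hf : IsTest (f.normed volume) := ⟨f.contDiff_normed, f.hasCompactSupport_normed, by
    rw [f.tsupport_normed_eq, Real.closedBall_eq_Icc]
    intro x hx
    have h1 : Real.pi - Real.pi / 2 ≤ x := hx.1
    have h2 : x ≤ Real.pi + Real.pi / 2 := hx.2
    constructor <;> linarith⟩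
  refine ⟨_, hf, ?_⟩
  rw [muOmega, setIntegral_eq_integral_of_forall_compl_eq_zero fun x hx => hf.eq_zero hx]
  exact f.integral_normed

/-- A test function with zero mean is the derivative of a test function. -/
theorem IsTest.exists_deriv_eq {ψ : ℝ → ℝ} (hψ : IsTest ψ) (h0 : ∫ x, ψ x ∂muOmega = 0) :
    ∃ φ, IsTest φ ∧ _root_.deriv φ = ψ := by
  rw [integral_muOmega] at h0
  have hc := hψ.contDiff.continuous
  have hd : ∀ x, HasDerivAt (fun x => ∫ y in (0 : ℝ)..x, ψ y) (ψ x) x := fun x =>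
    intervalIntegral.integral_hasDerivAt_right (hc.intervalIntegrable _ _)
      (hc.stronglyMeasurableAtFilter _ _) hc.continuousAt
  have hderiv : _root_.deriv (fun x => ∫ y in (0 : ℝ)..x, ψ y) = ψ := funext fun x => (hd x).deriv
  -- The primitive vanishes to the left of [α, β] trivially and to the right of it by the zero mean.
  -- For an empty support, α = 1 and β = 0 make the interval empty.
  obtain ⟨α, β, hα, hβ, hαβ⟩ : ∃ α β : ℝ, 0 < α ∧ β < 2 * Real.pi ∧ tsupport ψ ⊆ Icc α β := by
    rcases (tsupport ψ).eq_empty_or_nonempty with h | h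
    · exact ⟨1, 0, one_pos, Real.two_pi_pos, by simp [h]⟩
    · obtain ⟨α, hα⟩ := IsCompact.exists_isLeast hψ.hasCompactSupport h
      obtain ⟨β, hβ⟩ := IsCompact.exists_isGreatest hψ.hasCompactSupport h
      exact ⟨α, β, (hψ.tsupport_subset hα.1).1, (hψ.tsupport_subset hβ.1).2,
        fun x hx => ⟨hα.2 hx, hβ.2 hx⟩⟩
  have hz : ∀ x, x ∉ Icc α β → ψ x = 0 := fun x hx =>
    image_eq_zero_of_notMem_tsupport fun h => hx (hαβ h)
  have hsub : tsupport (fun x => ∫ y in (0 : ℝ)..x, ψ y) ⊆ Icc α β := by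
    refine closure_minimal (fun x hx => ?_) isClosed_Icc
    by_contra hx'
    refine hx ?_
    rcases lt_or_ge x α with h | h
    · refine intervalIntegral.integral_zero_ae (ae_of_all _ fun y hy => hz y fun hy' => ?_)
      rcases le_total 0 x with h' | h'
      · rw [uIoc_of_le h'] at hy; linarith [hy.2, hy'.1]
      · rw [uIoc_of_ge h'] at hy; linarith [hy.2, hy'.1]
    · have hβx : β < x := not_le.1 fun h2 => hx' ⟨h, h2⟩
      have h1 : ∫ y in x..2 * Real.pi, ψ y = 0 := by
        refine intervalIntegral.integral_zero_ae (ae_of_all _ fun y hy => hz y fun hy' => ?_)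
        rcases le_total x (2 * Real.pi) with h' | h'
        · rw [uIoc_of_le h'] at hy; linarith [hy.1, hy'.2]
        · rw [uIoc_of_ge h'] at hy; linarith [hy.1, hy'.2]
      have h2 := intervalIntegral.integral_add_adjacent_intervals (hc.intervalIntegrable 0 x)
        (hc.intervalIntegrable x (2 * Real.pi)) (μ := volume)
      simp only [h1, h0, add_zero] at h2
      exact h2
  refine ⟨_, ⟨?_, ?_, ?_⟩, hderiv⟩
  · rw [contDiff_infty_iff_deriv, hderiv]
    exact ⟨fun x => (hd x).differentiableAt, hψ.contDiff⟩
  · exact IsCompact.of_isClosed_subset isCompact_Icc (isClosed_tsupport _) hsub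
  · exact hsub.trans fun x hx => ⟨hα.trans_le hx.1, hx.2.trans_lt hβ⟩

/-- The lemma of du Bois-Reymond. -/
theorem ae_eq_const_of_integral_deriv_test {f : ℝ → ℝ} (hf : Integrable f muOmega)
    (h : ∀ φ, IsTest φ → ∫ x, f x * deriv φ x ∂muOmega = 0) :
    ∃ c : ℝ, f =ᵐ[muOmega] fun _ => c := by
  obtain ⟨ρ, hρ, hρ1⟩ := exists_isTest_integral_eq_one
  set c := ∫ x, f x * ρ x ∂muOmega with hc
  refine ⟨c, ?_⟩
  have h1 : (fun x => f x - c) =ᵐ[muOmega] 0 := by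
    refine ae_eq_zero_of_integral_test (hf.sub (integrable_const c)) fun ψ hψ => ?_
    set I := ∫ x, ψ x ∂muOmega with hI
    have iψ : Integrable ψ muOmega := by simpa using hψ.integrable_mul (integrable_const (1 : ℝ))
    have iρ : Integrable ρ muOmega := by simpa using hρ.integrable_mul (integrable_const (1 : ℝ))
    -- Subtracting a multiple of ρ gives a test function with zero mean, hence a derivative of a
    -- test function, to which the hypothesis applies.
    have hχ : IsTest fun x => ψ x - I * ρ x := by
      have hsupp : tsupport (fun x => ψ x - I * ρ x) ⊆ tsupport ψ ∪ tsupport ρ := by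
        refine closure_minimal (fun x hx => ?_)
          ((isClosed_tsupport _).union (isClosed_tsupport _))
        by_contra hx'
        rw [mem_union, not_or] at hx'
        apply hx
        simp [image_eq_zero_of_notMem_tsupport hx'.1, image_eq_zero_of_notMem_tsupport hx'.2]
      refine ⟨hψ.contDiff.sub (contDiff_const.mul hρ.contDiff), ?_, ?_⟩
      · exact IsCompact.of_isClosed_subset
          (IsCompact.union hψ.hasCompactSupport hρ.hasCompactSupport) (isClosed_tsupport _) hsupp
      · exact hsupp.trans (union_subset hψ.tsupport_subset hρ.tsupport_subset)
    obtain ⟨φ, hφ, hφψ⟩ := hχ.exists_deriv_eq (by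
      rw [integral_sub iψ (iρ.const_mul I), integral_const_mul, hρ1]; simp [hI])
    have h2 := h φ hφ
    rw [hφψ] at h2
    have h3 : ∫ x, f x * (ψ x - I * ρ x) ∂muOmega =
        (∫ x, f x * ψ x ∂muOmega) - I * c := by
      rw [hc, ← integral_const_mul, ← integral_sub (hψ.integrable_mul hf)
        ((hρ.integrable_mul hf).const_mul I)]
      congr 1; ext x; ring
    have h4 : ∫ x, (f x - c) * ψ x ∂muOmega = (∫ x, f x * ψ x ∂muOmega) - c * I := by
      rw [hI, ← integral_const_mul, ← integral_sub (hψ.integrable_mul hf) (iψ.const_mul c)]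
      congr 1; ext x; ring
    rw [h4]; linarith
  filter_upwards [h1] with x hx
  exact sub_eq_zero.1 hx

/-- As `g` is only integrable, its primitive is merely absolutely continuous and is differentiable
almost everywhere. The boundary terms vanish with φ. -/
theorem integral_primitive_mul_deriv {g : ℝ → ℝ} (hg : Integrable g muOmega) {φ : ℝ → ℝ}
    (hφ : IsTest φ) :
    ∫ x, (∫ y in (0 : ℝ)..x, g y) * deriv φ x ∂muOmega = -∫ x, g x * φ x ∂muOmega := by
  have hi := intervalIntegrable_of_muOmega hg
  have h1 := (hi.absolutelyContinuousOnInterval_intervalIntegral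
    (c := 0) (by simp)).integral_mul_deriv_eq_deriv_mul
    ((hφ.contDiff.of_le (by simp)).contDiffOn.absolutelyContinuousOnInterval)
  rw [hφ.eq_zero (x := 0) (by simp), hφ.eq_zero (x := 2 * Real.pi) (by simp)] at h1
  rw [integral_muOmega, integral_muOmega, h1]
  simp only [mul_zero, sub_zero, zero_sub]
  congr 1
  refine intervalIntegral.integral_congr_ae ?_
  filter_upwards [hi.ae_hasDerivAt_integral] with x hx hx'
  rw [(hx (uIoc_subset_uIcc hx') 0 (by simp)).deriv]

theorem integrable_primitive {g : ℝ → ℝ} (hg : Integrable g muOmega) :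
    Integrable (fun x => ∫ y in (0 : ℝ)..x, g y) muOmega := by
  have h := (intervalIntegral.continuousOn_primitive_interval'
    (intervalIntegrable_of_muOmega hg) (a := 0) (by simp))
  rw [uIcc_of_le Real.two_pi_pos.le] at h
  exact (h.integrableOn_Icc).mono_set Ioo_subset_Icc_self

/-- Testing `g` with φ' and `g'` with φ shows that `g` minus the primitive of `g'` annihilates all
derivatives of test functions; du Bois-Reymond makes it constant. -/
theorem IsWeakDeriv.ae_eq_primitive {i : ℕ} {v g g' : ℝ → ℝ} (h : IsWeakDeriv i v g)
    (h' : IsWeakDeriv (i + 1) v g') (hg : Integrable g muOmega) (hg' : Integrable g' muOmega) :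
    ∃ c : ℝ, g =ᵐ[muOmega] fun x => c + ∫ y in (0 : ℝ)..x, g' y := by
  obtain ⟨c, hc⟩ := ae_eq_const_of_integral_deriv_test (hg.sub (integrable_primitive hg'))
    fun φ hφ => by
      have h1 := h _ hφ.deriv.1 hφ.deriv.2 hφ.deriv.3
      have h2 := h' φ hφ.1 hφ.2 hφ.3
      rw [iteratedDeriv_succ', h1, pow_succ, mul_assoc] at h2
      have h3 := mul_left_cancel₀ (pow_ne_zero i (by norm_num : (-1 : ℝ) ≠ 0)) h2
      have h4 := integral_primitive_mul_deriv hg' hφ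
      simp only [Pi.sub_apply, sub_mul]
      rw [integral_sub (hφ.deriv.integrable_mul hg)
        (hφ.deriv.integrable_mul (integrable_primitive hg')), h3, h4]
      ring
  refine ⟨c, ?_⟩
  filter_upwards [hc] with x hx
  simp only [Pi.sub_apply] at hx
  linarith

theorem IsWeakDeriv.ae_unique {i : ℕ} {v g g' : ℝ → ℝ} (h : IsWeakDeriv i v g)
    (h' : IsWeakDeriv i v g') (hg : Integrable g muOmega) (hg' : Integrable g' muOmega) :
    g =ᵐ[muOmega] g' := by
  have h1 : (fun x => g x - g' x) =ᵐ[muOmega] 0 := by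
    refine ae_eq_zero_of_integral_test (hg.sub hg') fun φ hφ => ?_
    have h1 := h φ hφ.1 hφ.2 hφ.3
    rw [h' φ hφ.1 hφ.2 hφ.3] at h1
    have h3 := mul_left_cancel₀ (pow_ne_zero i (by norm_num : (-1 : ℝ) ≠ 0)) h1
    simp only [sub_mul]
    rw [integral_sub (hφ.integrable_mul hg) (hφ.integrable_mul hg'), h3, sub_self]
  filter_upwards [h1] with x hx
  exact sub_eq_zero.1 hx

/-- By uniqueness all competitors in the infimum of `sobolevNorm` agree almost everywhere, so any
one of them attains it. -/
theorem exists_weakDeriv {m : ℕ} {v : ℝ → ℝ} (h : sobolevNorm m v < ⊤) {i : ℕ} (hi : i ≤ m) :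
    ∃ g, MemLp v ∞ muOmega ∧ MemLp g ∞ muOmega ∧ IsWeakDeriv i v g ∧
      eLpNorm g ∞ muOmega ≤ sobolevNorm m v := by
  have h1 : ⨅ (g : ℝ → ℝ) (_ : MemLp v ∞ muOmega ∧ MemLp g ∞ muOmega ∧ IsWeakDeriv i v g),
      eLpNorm g ∞ muOmega ≤ sobolevNorm m v :=
    le_iSup₂ (f := fun (i : ℕ) (_ : i ≤ m) => ⨅ (g : ℝ → ℝ)
      (_ : MemLp v ∞ muOmega ∧ MemLp g ∞ muOmega ∧ IsWeakDeriv i v g), eLpNorm g ∞ muOmega) i hi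
  have h2 := h1.trans_lt h
  simp only [iInf_lt_iff] at h2
  obtain ⟨g, ⟨hv, hg, hw⟩, -⟩ := h2
  refine ⟨g, hv, hg, hw, le_trans (le_iInf₂ fun g' hg' => ?_) h1⟩
  exact (eLpNorm_congr_ae (hw.ae_unique hg'.2.2 (hg.integrable le_top)
    (hg'.2.1.integrable le_top))).le

/-- Iterated primitives, with constants of integration `c n, c (n - 1), …`. -/
def iterPrimitive (c : ℕ → ℝ) (g : ℝ → ℝ) (n : ℕ) : ℕ → ℝ → ℝ
  | 0 => fun x => c n + ∫ y in (0 : ℝ)..x, (Ioo 0 (2 * Real.pi)).indicator g y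
  | j + 1 => fun x => c (n - (j + 1)) + ∫ y in (0 : ℝ)..x, iterPrimitive c g n j y

theorem continuous_iterPrimitive (c : ℕ → ℝ) {g : ℝ → ℝ} (hg : Integrable g muOmega) (n j : ℕ) :
    Continuous (iterPrimitive c g n j) := by
  induction j with
  | zero =>
    refine continuous_const.add (intervalIntegral.continuous_primitive (fun a b => ?_) 0)
    exact (((integrable_indicator_iff measurableSet_Ioo).2 hg).intervalIntegrable)
  | succ j ih =>
    exact continuous_const.add (intervalIntegral.continuous_primitive
      (fun a b => ih.intervalIntegrable a b) 0)

theorem eqOn_of_ae_muOmega {f g : ℝ → ℝ} (h : f =ᵐ[muOmega] g)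
    (hf : ContinuousOn f (Icc 0 (2 * Real.pi))) (hg : ContinuousOn g (Icc 0 (2 * Real.pi))) :
    EqOn f g (Icc 0 (2 * Real.pi)) := by
  refine Measure.eqOn_Icc_of_ae_eq volume Real.two_pi_pos.ne ?_ hf hg
  rwa [← restrict_Ioo_eq_restrict_Icc]

theorem ae_abs_le {g : ℝ → ℝ} {B : ℝ≥0∞} (hB : B ≠ ⊤) (h : eLpNorm g ∞ muOmega ≤ B) :
    ∀ᵐ x ∂muOmega, |g x| ≤ B.toReal := by
  filter_upwards [ae_le_eLpNormEssSup (f := g) (μ := muOmega)] with x hx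
  rw [eLpNorm_exponent_top] at h
  have := ENNReal.toReal_mono hB (hx.trans h)
  simpa using this

/-- A continuous function in `W^{n+1,∞}(0, 2π)` has `n` classical derivatives, the last of which is
Lipschitz continuous. -/
theorem exists_classical_derivatives {n : ℕ} {v : ℝ → ℝ}
    (hv : ContinuousOn v (Icc 0 (2 * Real.pi))) (h : sobolevNorm (n + 1) v < ⊤) :
    ∃ D : ℕ → ℝ → ℝ, (∀ x ∈ Icc 0 (2 * Real.pi), D 0 x = v x) ∧
      (∀ i < n, ∀ x, HasDerivAt (D i) (D (i + 1) x) x) ∧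
      (∀ i, Continuous (D i)) ∧
      (∀ i ≤ n, ∀ x ∈ Icc 0 (2 * Real.pi), |D i x| ≤ (sobolevNorm (n + 1) v).toReal) ∧
      (∀ x ∈ Icc 0 (2 * Real.pi), ∀ y ∈ Icc 0 (2 * Real.pi),
        |D n x - D n y| ≤ (sobolevNorm (n + 1) v).toReal * |x - y|) := by
  set K := (sobolevNorm (n + 1) v).toReal with hK
  have hK0 : 0 ≤ K := ENNReal.toReal_nonneg
  have hex : ∀ i : ℕ, ∃ g : ℝ → ℝ, i ≤ n + 1 → MemLp v ∞ muOmega ∧ Integrable g muOmega ∧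
      IsWeakDeriv i v g ∧ ∀ᵐ x ∂muOmega, |g x| ≤ K := fun i => by
    by_cases hi : i ≤ n + 1
    · obtain ⟨g, h1, h2, h3, h4⟩ := exists_weakDeriv h hi
      exact ⟨g, fun _ => ⟨h1, h2.integrable le_top, h3, ae_abs_le h.ne h4⟩⟩
    · exact ⟨0, fun h => absurd h hi⟩
  choose g hg using hex
  have hcex : ∀ i : ℕ, ∃ c : ℝ, i ≤ n →
      g i =ᵐ[muOmega] fun x => c + ∫ y in (0 : ℝ)..x, g (i + 1) y := fun i => by
    by_cases hi : i ≤ n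
    · obtain ⟨-, h2, h3, -⟩ := hg i (by omega)
      obtain ⟨-, h2', h3', -⟩ := hg (i + 1) (by omega)
      obtain ⟨c, hc⟩ := h3.ae_eq_primitive h3' h2 h2'
      exact ⟨c, fun _ => hc⟩
    · exact ⟨0, fun h => absurd h hi⟩
  choose c hc using hcex
  have hcont := continuous_iterPrimitive c (hg (n + 1) le_rfl).2.1 n
  have prim_congr : ∀ f f' : ℝ → ℝ, f =ᵐ[muOmega] f' → ∀ x ∈ Ioo 0 (2 * Real.pi),
      ∫ y in (0 : ℝ)..x, f y = ∫ y in (0 : ℝ)..x, f' y := fun f f' hff x hx => by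
    refine intervalIntegral.integral_congr_ae ?_
    rw [muOmega, Filter.EventuallyEq, ae_restrict_iff' measurableSet_Ioo] at hff
    filter_upwards [hff] with y hy hy'
    rw [uIoc_of_le hx.1.le] at hy'
    exact hy ⟨hy'.1, hy'.2.trans_lt hx.2⟩
  have hmem : ∀ᵐ x ∂muOmega, x ∈ Ioo 0 (2 * Real.pi) := ae_restrict_mem measurableSet_Ioo
  have hae : ∀ j ≤ n, iterPrimitive c (g (n + 1)) n j =ᵐ[muOmega] g (n - j) := by
    intro j
    induction j with
    | zero =>
      intro _
      filter_upwards [hc n le_rfl, hmem] with x hx hxm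
      rw [Nat.sub_zero, hx, iterPrimitive]
      refine congrArg (c n + ·) (prim_congr _ _ ?_ x hxm)
      filter_upwards [hmem] with y hy
      rw [indicator_of_mem hy]
    | succ j ih =>
      intro hj
      filter_upwards [hc (n - (j + 1)) (by omega), hmem] with x hx hxm
      rw [hx, iterPrimitive, show n - (j + 1) + 1 = n - j by omega]
      exact congrArg (c (n - (j + 1)) + ·) (prim_congr _ _ (ih (by omega)) x hxm)
  -- `iterPrimitive c g n j` integrates j + 1 times starting from the weak derivative of order n +
  -- 1, so it represents the one of order n - j. For i > n the truncated subtraction repeats the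
  -- derivative of order n, for which only continuity is claimed.
  refine ⟨fun i => iterPrimitive c (g (n + 1)) n (n - i), ?_, ?_, fun i => hcont _, ?_, ?_⟩
  · refine eqOn_of_ae_muOmega ?_ (hcont _).continuousOn hv
    obtain ⟨hvL, h2, h3, -⟩ := hg 0 (by omega)
    have h4 : IsWeakDeriv 0 v v := fun φ _ _ _ => by simp
    have h5 := hae n le_rfl
    rw [Nat.sub_self] at h5
    exact h5.trans (h3.ae_unique h4 h2 (hvL.integrable le_top))
  · intro i hi x
    show HasDerivAt (iterPrimitive c (g (n + 1)) n (n - i))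
      (iterPrimitive c (g (n + 1)) n (n - (i + 1)) x) x
    rw [show n - i = n - (i + 1) + 1 by omega]
    refine HasDerivAt.const_add _ ?_
    exact intervalIntegral.integral_hasDerivAt_right ((hcont _).intervalIntegrable _ _)
      ((hcont _).stronglyMeasurableAtFilter _ _) (hcont _).continuousAt
  · intro i hi
    -- The almost everywhere bound |·| ≤ K is written as an equality of continuous functions,
    -- max(|·|, K) = K, and therefore holds everywhere.
    have h1 : EqOn (fun x => max |iterPrimitive c (g (n + 1)) n (n - i) x| K) (fun _ => K)
        (Icc 0 (2 * Real.pi)) := by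
      refine eqOn_of_ae_muOmega ?_ (Continuous.continuousOn (by have := hcont (n - i); fun_prop))
        continuousOn_const
      have h5 := hae (n - i) (by omega)
      rw [show n - (n - i) = i by omega] at h5
      filter_upwards [h5, (hg i (by omega)).2.2.2] with x hx hx'
      rw [hx, max_eq_right hx']
    exact fun x hx => max_eq_right_iff.1 (h1 hx)
  · intro x hx y hy
    simp only [Nat.sub_self]
    have hint : ∀ a b : ℝ, IntervalIntegrable ((Ioo 0 (2 * Real.pi)).indicator (g (n + 1))) volume a b :=
      fun a b => ((integrable_indicator_iff measurableSet_Ioo).2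
        (hg (n + 1) le_rfl).2.1).intervalIntegrable
    rw [iterPrimitive, add_sub_add_left_eq_sub,
      intervalIntegral.integral_interval_sub_left (hint _ _) (hint _ _)]
    rw [← Real.norm_eq_abs (∫ z in y..x, _)]
    refine intervalIntegral.norm_integral_le_of_norm_le_const_ae ?_
    have := (hg (n + 1) le_rfl).2.2.2
    rw [muOmega, ae_restrict_iff' measurableSet_Ioo] at this
    filter_upwards [this] with z hz _
    by_cases hzm : z ∈ Ioo 0 (2 * Real.pi)
    · rw [indicator_of_mem hzm]; exact hz hzm
    · rw [indicator_of_notMem hzm]; simpa using hK0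

end

noncomputable section

/-! ## Regularity of the exact solution in time -/

/-- `D t i` is the `i`-th derivative of `u(·, t)` with respect to `x`, for `i ≤ n`, and the last
derivative is Lipschitz continuous. -/
structure IsDerivFamily (T : ℝ) (n : ℕ) (u : ℝ → ℝ → ℝ) (D : ℝ → ℕ → ℝ → ℝ) : Prop where
  eq : ∀ t ∈ Icc 0 T, ∀ x ∈ Icc 0 (2 * Real.pi), D t 0 x = u x t
  deriv : ∀ t ∈ Icc 0 T, ∀ i < n, ∀ x, HasDerivAt (D t i) (D t (i + 1) x) x
  cont : ∀ t ∈ Icc 0 T, ∀ i, Continuous (D t i)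
  lip : ∀ t ∈ Icc 0 T, ∀ i ≤ n, ∀ x ∈ Icc 0 (2 * Real.pi), ∀ y ∈ Icc 0 (2 * Real.pi),
    |D t i x - D t i y| ≤ (sobolevNorm (n + 1) fun x => u x t).toReal * |x - y|

theorem exists_isDerivFamily {T : ℝ} {n : ℕ} {u : ℝ → ℝ → ℝ} (hu : IsHeatSolution T u)
    (h : ∀ t ∈ Icc 0 T, sobolevNorm (n + 1) (fun x => u x t) < ⊤) :
    ∃ D, IsDerivFamily T n u D := by
  have h1 : ∀ t : ℝ, ∃ D : ℕ → ℝ → ℝ, t ∈ Icc 0 T →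
      (∀ x ∈ Icc 0 (2 * Real.pi), D 0 x = u x t) ∧
      (∀ i < n, ∀ x, HasDerivAt (D i) (D (i + 1) x) x) ∧
      (∀ i, Continuous (D i)) ∧
      (∀ i ≤ n, ∀ x ∈ Icc 0 (2 * Real.pi), |D i x| ≤
        (sobolevNorm (n + 1) fun x => u x t).toReal) ∧
      (∀ x ∈ Icc 0 (2 * Real.pi), ∀ y ∈ Icc 0 (2 * Real.pi),
        |D n x - D n y| ≤ (sobolevNorm (n + 1) fun x => u x t).toReal * |x - y|) := fun t => by
    by_cases ht : t ∈ Icc 0 T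
    · obtain ⟨D, hD⟩ := exists_classical_derivatives (hu.contDiffOn t ht).continuousOn (h t ht)
      exact ⟨D, fun _ => hD⟩
    · exact ⟨0, fun h => absurd h ht⟩
  choose D hD using h1
  refine ⟨D, fun t ht => (hD t ht).1, fun t ht => (hD t ht).2.1, fun t ht => (hD t ht).2.2.1,
    fun t ht i hi x hx y hy => ?_⟩
  -- Below the top order, the bound of the next derivative serves as the Lipschitz constant.
  rcases hi.eq_or_lt with rfl | hi
  · exact (hD t ht).2.2.2.2 x hx y hy
  · have := (convex_Icc 0 (2 * Real.pi)).norm_image_sub_le_of_norm_hasDerivWithin_le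
      (fun z _ => ((hD t ht).2.1 i hi z).hasDerivWithinAt)
      (fun z hz => (hD t ht).2.2.2.1 (i + 1) hi z hz) hy hx
    exact this

namespace IsDerivFamily

variable {T : ℝ} {n : ℕ} {u : ℝ → ℝ → ℝ} {D : ℝ → ℕ → ℝ → ℝ}

/-- Continuity in time passes from one space derivative to the next: the next one is the limit of
difference quotients in x, and the limit is uniform in t because the Lipschitz constants are bounded
by `K`. -/
theorem continuousOn_time (hD : IsDerivFamily T n u D) (hu : IsHeatSolution T u) {K : ℝ}
    (hK : ∀ t ∈ Icc 0 T, (sobolevNorm (n + 1) fun x => u x t).toReal ≤ K) {i : ℕ} (hi : i ≤ n) :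
    ∀ x ∈ Icc 0 (2 * Real.pi), ContinuousOn (fun t => D t i x) (Icc 0 T) := by
  have hpi := Real.pi_pos
  induction i with
  | zero =>
    intro x hx
    have h1 : ContinuousOn (fun t => u x t) (Icc 0 T) :=
      hu.continuousOn.comp (f := fun t : ℝ => (x, t)) (by fun_prop) fun t ht => ⟨hx, ht⟩
    exact h1.congr fun t ht => hD.eq t ht x hx
  | succ i ih =>
    intro x hx
    have ih' := ih (by omega)
    refine continuousOn_of_uniform_approx_of_continuousOn fun U hU => ?_
    obtain ⟨ε, hε, hεU⟩ := Metric.mem_uniformity_dist.1 hU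
    have hpos : 0 < |K| + 1 := by positivity
    -- Small enough that K δ < ε, and at most 1, so that one of x + δ, x - δ stays in [0, 2π].
    set δ := min (ε / (2 * (|K| + 1))) 1 with hδ
    have hδ0 : 0 < δ := lt_min (by positivity) one_pos
    have hδ1 : δ ≤ 1 := min_le_right _ _
    have hδε : (|K| + 1) * δ ≤ ε / 2 := by
      calc _ ≤ (|K| + 1) * (ε / (2 * (|K| + 1))) := by gcongr; exact min_le_left _ _
        _ = ε / 2 := by field_simp
    obtain ⟨y, hy, hyx, hyδ⟩ : ∃ y ∈ Icc 0 (2 * Real.pi), y ≠ x ∧ |y - x| ≤ δ := by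
      have := Real.pi_gt_three
      rcases le_total x Real.pi with h | h
      · exact ⟨x + δ, ⟨by linarith [hx.1], by linarith⟩, by linarith,
          by rw [add_sub_cancel_left, abs_of_pos hδ0]⟩
      · exact ⟨x - δ, ⟨by linarith, by linarith [hx.2]⟩, by linarith,
          by rw [sub_sub_cancel_left, abs_neg, abs_of_pos hδ0]⟩
    refine ⟨fun t => (D t i y - D t i x) / (y - x), ((ih' y hy).sub (ih' x hx)).div_const _,
      fun t ht => hεU ?_⟩
    have h1 : |D t i y - D t i x - D t (i + 1) x * (y - x)| ≤ K * |y - x| * |y - x| := by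
      have hsub : uIcc x y ⊆ Icc 0 (2 * Real.pi) := uIcc_subset_Icc hx hy
      have h2 := (convex_uIcc x y).norm_image_sub_le_of_norm_hasDerivWithin_le
        (f := fun z => D t i z - D t (i + 1) x * z)
        (f' := fun z => D t (i + 1) z - D t (i + 1) x) (C := K * |y - x|)
        (fun z _ => by
          have := (hD.deriv t ht i (by omega) z).sub ((hasDerivAt_id z).const_mul (D t (i + 1) x))
          simp only [mul_one] at this
          exact this.hasDerivWithinAt)
        (fun z hz => by
          refine (hD.lip t ht (i + 1) hi z (hsub hz) x hx).trans ?_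
          have hzx : |z - x| ≤ |y - x| := abs_sub_left_of_mem_uIcc hz
          exact mul_le_mul (hK t ht) hzx (abs_nonneg _)
            (ENNReal.toReal_nonneg.trans (hK t ht)))
        left_mem_uIcc right_mem_uIcc
      simp only [Real.norm_eq_abs] at h2
      convert h2 using 2
      ring
    have hyx0 : 0 < |y - x| := abs_pos.2 (sub_ne_zero.2 hyx)
    have h3 : (D t i y - D t i x) / (y - x) - D t (i + 1) x =
        (D t i y - D t i x - D t (i + 1) x * (y - x)) / (y - x) := by
      have : y - x ≠ 0 := sub_ne_zero.2 hyx
      field_simp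
    rw [dist_comm, Real.dist_eq, h3, abs_div, div_lt_iff₀ hyx0]
    refine h1.trans_lt ?_
    have h4 : K * |y - x| < ε := by
      calc K * |y - x| ≤ (|K| + 1) * δ := by
            refine mul_le_mul ?_ hyδ (abs_nonneg _) hpos.le
            linarith [le_abs_self K]
        _ < ε := by linarith
    exact mul_lt_mul_of_pos_right h4 hyx0

theorem continuousOn_prod (hD : IsDerivFamily T n u D) (hu : IsHeatSolution T u) {K : ℝ}
    (hK : ∀ t ∈ Icc 0 T, (sobolevNorm (n + 1) fun x => u x t).toReal ≤ K) {i : ℕ} (hi : i ≤ n) :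
    ContinuousOn (fun p : ℝ × ℝ => D p.2 i p.1) (Icc 0 (2 * Real.pi) ×ˢ Icc 0 T) := by
  refine continuousOn_prod_of_continuousOn_lipschitzOnWith _ K.toNNReal
    (fun x hx => hD.continuousOn_time hu hK hi x hx) fun t ht => ?_
  refine LipschitzOnWith.of_dist_le_mul fun x hx y hy => ?_
  rw [Real.coe_toNNReal _ (ENNReal.toReal_nonneg.trans (hK t ht))]
  refine (hD.lip t ht i hi x hx y hy).trans ?_
  exact mul_le_mul_of_nonneg_right (hK t ht) (abs_nonneg _)

/-- Projection to an interval, as a real-valued function. -/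
def _root_.LDG.clamp (L x : ℝ) : ℝ := max 0 (min L x)

theorem _root_.LDG.continuous_clamp (L : ℝ) : Continuous (clamp L) := by
  unfold clamp; fun_prop

theorem _root_.LDG.clamp_mem {L : ℝ} (hL : 0 ≤ L) (x : ℝ) : clamp L x ∈ Icc 0 L :=
  ⟨le_max_left _ _, max_le hL (min_le_left _ _)⟩

theorem _root_.LDG.clamp_of_mem {L x : ℝ} (hx : x ∈ Icc 0 L) : clamp L x = x := by
  rw [clamp, min_eq_right hx.2, max_eq_right hx.1]

/-- The derivatives extended to all of `ℝ²` by projection to the space-time cylinder. -/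
def _root_.LDG.clampedDeriv (T : ℝ) (D : ℝ → ℕ → ℝ → ℝ) (i : ℕ) (x t : ℝ) : ℝ :=
  D (clamp T t) i (clamp (2 * Real.pi) x)

theorem _root_.LDG.clampedDeriv_of_mem {x t : ℝ} (i : ℕ) (hx : x ∈ Icc 0 (2 * Real.pi))
    (ht : t ∈ Icc 0 T) : clampedDeriv T D i x t = D t i x := by
  rw [clampedDeriv, clamp_of_mem hx, clamp_of_mem ht]

theorem continuous_clampedDeriv (hT : 0 ≤ T) (hD : IsDerivFamily T n u D)
    (hu : IsHeatSolution T u) {K : ℝ}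
    (hK : ∀ t ∈ Icc 0 T, (sobolevNorm (n + 1) fun x => u x t).toReal ≤ K) {i : ℕ} (hi : i ≤ n) :
    Continuous fun p : ℝ × ℝ => clampedDeriv T D i p.1 p.2 := by
  have h := (hD.continuousOn_prod hu hK hi).comp_continuous
    (f := fun p : ℝ × ℝ => (clamp (2 * Real.pi) p.1, clamp T p.2))
    (by have := continuous_clamp; fun_prop)
    fun p => ⟨clamp_mem Real.two_pi_pos.le _, clamp_mem hT _⟩
  exact h

theorem integral_space (hD : IsDerivFamily T n u D) {i : ℕ} (hi : i < n) {x t : ℝ}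
    (hx : x ∈ Icc 0 (2 * Real.pi)) (ht : t ∈ Icc 0 T) :
    ∫ y in (0 : ℝ)..x, clampedDeriv T D (i + 1) y t = D t i x - D t i 0 := by
  rw [← intervalIntegral.integral_eq_sub_of_hasDerivAt (fun y _ => hD.deriv t ht i hi y)
    ((hD.cont t ht (i + 1)).intervalIntegrable _ _)]
  refine intervalIntegral.integral_congr fun y hy => ?_
  rw [uIcc_of_le hx.1] at hy
  exact clampedDeriv_of_mem _ ⟨hy.1, hy.2.trans hx.2⟩ ht

theorem dx_eq (hD : IsDerivFamily T n u D) (hn : 0 < n) {x t : ℝ}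
    (hx : x ∈ Icc 0 (2 * Real.pi)) (ht : t ∈ Icc 0 T) : dx u x t = D t 1 x := by
  have h1 := ((hD.deriv t ht 0 hn x).hasDerivWithinAt (s := Icc 0 (2 * Real.pi))).congr
    (fun y hy => (hD.eq t ht y hy).symm) (hD.eq t ht x hx).symm
  exact h1.derivWithin (uniqueDiffOn_Icc Real.two_pi_pos x hx)

theorem dx_dx_eq (hD : IsDerivFamily T n u D) (hn : 1 < n) {x t : ℝ}
    (hx : x ∈ Icc 0 (2 * Real.pi)) (ht : t ∈ Icc 0 T) : dx (dx u) x t = D t 2 x := by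
  have h1 := ((hD.deriv t ht 1 hn x).hasDerivWithinAt (s := Icc 0 (2 * Real.pi))).congr
    (f₁ := fun y => dx u y t) (fun y hy => hD.dx_eq (by omega) hy ht)
    (hD.dx_eq (by omega) hx ht)
  exact h1.derivWithin (uniqueDiffOn_Icc Real.two_pi_pos x hx)

theorem _root_.LDG.eqOn_zero_of_primitive_eq_zero {f : ℝ → ℝ} (hf : Continuous f) {L : ℝ}
    (hL : 0 < L) (h : ∀ x ∈ Icc 0 L, ∫ y in (0 : ℝ)..x, f y = 0) : ∀ x ∈ Icc 0 L, f x = 0 := by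
  intro x hx
  have h1 : HasDerivWithinAt (fun x => ∫ y in (0 : ℝ)..x, f y) (f x) (Icc 0 L) x :=
    (intervalIntegral.integral_hasDerivAt_right (hf.intervalIntegrable _ _)
      (hf.stronglyMeasurableAtFilter _ _) hf.continuousAt).hasDerivWithinAt
  have h2 : HasDerivWithinAt (fun x => ∫ y in (0 : ℝ)..x, f y) 0 (Icc 0 L) x :=
    (hasDerivWithinAt_const x (Icc 0 L) (0 : ℝ)).congr h (h x hx)
  exact (uniqueDiffOn_Icc hL x hx).eq_deriv _ h1 h2

theorem _root_.LDG.integral_swap_of_continuous {F : ℝ → ℝ → ℝ}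
    (hF : Continuous fun p : ℝ × ℝ => F p.1 p.2) (a b c d : ℝ) :
    ∫ x in a..b, ∫ y in c..d, F x y = ∫ y in c..d, ∫ x in a..b, F x y := by
  refine intervalIntegral_intervalIntegral_swap ?_
  exact (hF.continuousOn.integrableOn_compact
    (isCompact_uIcc.prod isCompact_uIcc)).mono_set (prod_mono uIoc_subset_uIcc uIoc_subset_uIcc)

/-- The heat equation, differentiated with respect to `x` and integrated in time. -/
theorem integral_time (hT : 0 < T) (hD : IsDerivFamily T n u D)
    (hu : IsHeatSolution T u) {K : ℝ}
    (hK : ∀ t ∈ Icc 0 T, (sobolevNorm (n + 1) fun x => u x t).toReal ≤ K) {i : ℕ}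
    (hi : i + 2 ≤ n) : ∀ x ∈ Icc 0 (2 * Real.pi), ∀ t ∈ Icc 0 T,
    D t i x = D 0 i x + ∫ τ in (0 : ℝ)..t, clampedDeriv T D (i + 2) x τ := by
  have h0T : (0 : ℝ) ∈ Icc 0 T := left_mem_Icc.2 hT.le
  have h0L : (0 : ℝ) ∈ Icc 0 (2 * Real.pi) := left_mem_Icc.2 Real.two_pi_pos.le
  induction i with
  | zero =>
    intro x hx t ht
    have hc := hD.continuous_clampedDeriv hT.le hu hK hi
    rw [intervalIntegral.integral_eq_sub_of_hasDerivAt_of_le (f := fun s => u x s) ht.1]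
    · rw [hD.eq t ht x hx, hD.eq 0 h0T x hx]; ring
    · have h1 : ContinuousOn (fun t => u x t) (Icc 0 T) :=
        hu.continuousOn.comp (f := fun t : ℝ => (x, t)) (by fun_prop) fun t ht => ⟨hx, ht⟩
      exact h1.mono (Icc_subset_Icc_right ht.2)
    · intro s hs
      have hs' : s ∈ Ioo 0 T := ⟨hs.1, hs.2.trans_le ht.2⟩
      have := hu.heat_eq s ⟨hs'.1, hs'.2.le⟩ x hx
      rw [hD.dx_dx_eq (by omega) hx ⟨hs'.1.le, hs'.2.le⟩] at this
      rw [clampedDeriv_of_mem _ hx ⟨hs'.1.le, hs'.2.le⟩]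
      exact this.hasDerivAt (Icc_mem_nhds hs'.1 hs'.2)
    · exact Continuous.intervalIntegrable (by fun_prop) _ _
  | succ i ih =>
    intro x hx t ht
    have ih' := ih (by omega)
    have hc1 := hD.continuous_clampedDeriv hT.le hu hK (show i + 1 ≤ n by omega)
    have hc2 := hD.continuous_clampedDeriv hT.le hu hK (show i + 2 ≤ n by omega)
    have hc3 := hD.continuous_clampedDeriv hT.le hu hK (show i + 3 ≤ n by omega)
    have hcI : Continuous fun y => ∫ τ in (0 : ℝ)..t, clampedDeriv T D (i + 3) y τ :=
      intervalIntegral.continuous_parametric_intervalIntegral_of_continuous' hc3 0 t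
    -- Exchanging the x and t derivatives is avoided: integrated over x from 0 to z, the desired
    -- identity becomes, by Fubini, the difference of the identities of order i at z and at 0. A
    -- continuous function with vanishing primitive is zero.
    have key := eqOn_zero_of_primitive_eq_zero (f := fun y => clampedDeriv T D (i + 1) y t -
      clampedDeriv T D (i + 1) y 0 - ∫ τ in (0 : ℝ)..t, clampedDeriv T D (i + 3) y τ)
      (by fun_prop) Real.two_pi_pos (fun z hz => by
        rw [intervalIntegral.integral_sub (Continuous.intervalIntegrable (by fun_prop) _ _)
          (Continuous.intervalIntegrable (by fun_prop) _ _),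
          intervalIntegral.integral_sub (Continuous.intervalIntegrable (by fun_prop) _ _)
          (Continuous.intervalIntegrable (by fun_prop) _ _),
          hD.integral_space (by omega) hz ht, hD.integral_space (by omega) hz h0T,
          integral_swap_of_continuous hc3]
        have h1 : ∫ τ in (0 : ℝ)..t, ∫ y in (0 : ℝ)..z, clampedDeriv T D (i + 3) y τ =
            (∫ τ in (0 : ℝ)..t, clampedDeriv T D (i + 2) z τ) -
              ∫ τ in (0 : ℝ)..t, clampedDeriv T D (i + 2) 0 τ := by
          rw [← intervalIntegral.integral_sub (Continuous.intervalIntegrable (by fun_prop) _ _)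
            (Continuous.intervalIntegrable (by fun_prop) _ _)]
          refine intervalIntegral.integral_congr fun τ hτ => ?_
          rw [uIcc_of_le ht.1] at hτ
          have hτ' : τ ∈ Icc 0 T := ⟨hτ.1, hτ.2.trans ht.2⟩
          rw [hD.integral_space (by omega) hz hτ', clampedDeriv_of_mem _ hz hτ',
            clampedDeriv_of_mem _ h0L hτ']
        rw [h1]
        linarith [ih' z hz t ht, ih' 0 h0L t ht]) x hx
    rw [clampedDeriv_of_mem _ hx ht, clampedDeriv_of_mem _ hx h0T] at key
    linarith

theorem _root_.LDG.hasDerivWithinAt_of_eq_primitive {f F : ℝ → ℝ} (hF : Continuous F) {c t : ℝ}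
    (ht : t ∈ Icc 0 T) (h : ∀ s ∈ Icc 0 T, f s = c + ∫ τ in (0 : ℝ)..s, F τ) :
    HasDerivWithinAt f (F t) (Icc 0 T) t := by
  have h1 : HasDerivAt (fun s => c + ∫ τ in (0 : ℝ)..s, F τ) (F t) t :=
    (intervalIntegral.integral_hasDerivAt_right (hF.intervalIntegrable _ _)
      (hF.stronglyMeasurableAtFilter _ _) hF.continuousAt).const_add c
  exact h1.hasDerivWithinAt.congr h (h t ht)

theorem hasDerivWithinAt (hT : 0 < T) (hD : IsDerivFamily T n u D)
    (hu : IsHeatSolution T u) {K : ℝ}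
    (hK : ∀ t ∈ Icc 0 T, (sobolevNorm (n + 1) fun x => u x t).toReal ≤ K) {i : ℕ}
    (hi : i + 2 ≤ n) {x t : ℝ} (hx : x ∈ Icc 0 (2 * Real.pi)) (ht : t ∈ Icc 0 T) :
    HasDerivWithinAt (fun s => D s i x) (D t (i + 2) x) (Icc 0 T) t := by
  have hc := hD.continuous_clampedDeriv hT.le hu hK hi
  have := hasDerivWithinAt_of_eq_primitive (F := fun τ => clampedDeriv T D (i + 2) x τ)
    (by fun_prop) ht fun s hs => hD.integral_time hT hu hK hi x hx s hs
  rwa [clampedDeriv_of_mem _ hx ht] at this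

/-- Fubini applied to the time-integrated heat equation writes the function of `s` as a primitive of
a continuous function, including one-sided derivatives at 0 and T. -/
theorem hasDerivWithinAt_integral (hT : 0 < T) (hD : IsDerivFamily T n u D)
    (hu : IsHeatSolution T u) {K : ℝ}
    (hK : ∀ t ∈ Icc 0 T, (sobolevNorm (n + 1) fun x => u x t).toReal ≤ K) {i : ℕ}
    (hi : i + 2 ≤ n) {a b t : ℝ} (hab : a ≤ b) (ha : 0 ≤ a) (hb : b ≤ 2 * Real.pi)
    (ht : t ∈ Icc 0 T) (p : Polynomial ℝ) :
    HasDerivWithinAt (fun s => ∫ x in a..b, D s i x * p.eval x)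
      (∫ x in a..b, D t (i + 2) x * p.eval x) (Icc 0 T) t := by
  have hc := hD.continuous_clampedDeriv hT.le hu hK hi
  have h0T : (0 : ℝ) ∈ Icc 0 T := left_mem_Icc.2 hT.le
  have hsub : ∀ x ∈ uIcc a b, x ∈ Icc 0 (2 * Real.pi) := fun x hx => by
    rw [uIcc_of_le hab] at hx; exact ⟨ha.trans hx.1, hx.2.trans hb⟩
  have hF : Continuous fun τ => ∫ x in a..b, clampedDeriv T D (i + 2) x τ * p.eval x :=
    intervalIntegral.continuous_parametric_intervalIntegral_of_continuous'
      (f := fun τ x => clampedDeriv T D (i + 2) x τ * p.eval x) (by unfold Function.uncurry; fun_prop) a b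
  have := hasDerivWithinAt_of_eq_primitive (T := T) hF ht
    (f := fun s => ∫ x in a..b, D s i x * p.eval x)
    (c := ∫ x in a..b, D 0 i x * p.eval x) fun s hs => by
      rw [← integral_swap_of_continuous
        (F := fun x τ => clampedDeriv T D (i + 2) x τ * p.eval x) (by fun_prop),
        ← intervalIntegral.integral_add]
      · refine intervalIntegral.integral_congr fun x hx => ?_
        rw [hD.integral_time hT hu hK hi x (hsub x hx) s hs, intervalIntegral.integral_mul_const,
          add_mul]
      · have := hD.cont 0 h0T i
        exact Continuous.intervalIntegrable (by fun_prop) _ _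
      · refine Continuous.intervalIntegrable ?_ _ _
        exact intervalIntegral.continuous_parametric_intervalIntegral_of_continuous'
          (f := fun x τ => clampedDeriv T D (i + 2) x τ * p.eval x)
          (by unfold Function.uncurry; fun_prop) 0 s
  convert this using 1
  refine intervalIntegral.integral_congr fun x hx => ?_
  rw [clampedDeriv_of_mem _ (hsub x hx) ht]

theorem hasDerivWithinAt_legCoef (hT : 0 < T) (hD : IsDerivFamily T n u D)
    (hu : IsHeatSolution T u) {K : ℝ}
    (hK : ∀ t ∈ Icc 0 T, (sobolevNorm (n + 1) fun x => u x t).toReal ≤ K) {i : ℕ}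
    (hi : i + 2 ≤ n) {a b t : ℝ} (hab : a ≤ b) (ha : 0 ≤ a) (hb : b ≤ 2 * Real.pi)
    (ht : t ∈ Icc 0 T) (m : ℕ) :
    HasDerivWithinAt (fun s => legCoef a b (D s i) m) (legCoef a b (D t (i + 2)) m) (Icc 0 T) t :=
  (hD.hasDerivWithinAt_integral hT hu hK hi hab ha hb ht _).const_mul _

theorem hasDerivWithinAt_coefAt (hT : 0 < T) (hD : IsDerivFamily T n u D)
    (hu : IsHeatSolution T u) {K : ℝ}
    (hK : ∀ t ∈ Icc 0 T, (sobolevNorm (n + 1) fun x => u x t).toReal ≤ K) {i : ℕ}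
    (hi : i + 2 ≤ n) {a b e ε t : ℝ} (hab : a < b) (ha : 0 ≤ a) (hb : b ≤ 2 * Real.pi)
    (he : IsEnd a b e ε) (ht : t ∈ Icc 0 T) (k : ℕ) :
    HasDerivWithinAt (fun s => coefAt k a b e ε (D s i)) (coefAt k a b e ε (D t (i + 2)))
      (Icc 0 T) t := by
  have hem := he.mem hab
  refine HasDerivWithinAt.const_mul _ (HasDerivWithinAt.add ?_ ?_)
  · exact (hD.hasDerivWithinAt hT hu hK hi ⟨ha.trans hem.1, hem.2.trans hb⟩ ht).neg
  · exact HasDerivWithinAt.fun_sum fun m _ =>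
      (hD.hasDerivWithinAt_legCoef hT hu hK hi hab.le ha hb ht m).const_mul _

/-- The Gauss–Radau projection commutes with the time derivative. -/
theorem hasDerivWithinAt_coeff_radau (hT : 0 < T) (hD : IsDerivFamily T n u D)
    (hu : IsHeatSolution T u) {K : ℝ}
    (hK : ∀ t ∈ Icc 0 T, (sobolevNorm (n + 1) fun x => u x t).toReal ≤ K) {i : ℕ}
    (hi : i + 2 ≤ n) {a b e ε t : ℝ} (hab : a < b) (ha : 0 ≤ a) (hb : b ≤ 2 * Real.pi)
    (he : IsEnd a b e ε) (ht : t ∈ Icc 0 T) (k m : ℕ) :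
    HasDerivWithinAt (fun s => (radau k a b e (D s i)).coeff m)
      ((radau k a b e (D t (i + 2))).coeff m) (Icc 0 T) t := by
  have h1 : ∀ j, ∀ s ∈ Icc 0 T, (radau k a b e (D s j)).coeff m =
      (∑ l ∈ Finset.range (k + 1), legCoef a b (D s j) l * (cellLeg l a b).coeff m)
        - coefAt k a b e ε (D s j) * (cellLeg k a b).coeff m := fun j s hs => by
    rw [radau_eq hab he (hD.cont s hs j).continuousOn, radauPoly, Polynomial.coeff_sub,
      Polynomial.finsetSum_coeff]
    simp only [Polynomial.coeff_C_mul]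
  rw [h1 _ t ht]
  refine HasDerivWithinAt.congr ?_ (h1 i) (h1 i t ht)
  refine HasDerivWithinAt.sub ?_ ?_
  · exact HasDerivWithinAt.fun_sum fun l _ =>
      (hD.hasDerivWithinAt_legCoef hT hu hK hi hab.le ha hb ht l).mul_const _
  · exact (hD.hasDerivWithinAt_coefAt hT hu hK hi hab ha hb he ht k).mul_const _

end IsDerivFamily

end

noncomputable section

open Polynomial (derivative X C)

/-! ## An energy estimate -/

/-- The function exp(λ s) (y - σ/λ) is nonincreasing and starts at or below 0. The damping is what
makes the bound independent of t. -/
theorem le_of_deriv_le_neg_mul_add {y y' : ℝ → ℝ} {t lam σ : ℝ} (hl : 0 < lam) (hσ : 0 ≤ σ)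
    (ht : 0 ≤ t) (h0 : y 0 = 0)
    (hy : ∀ s ∈ Icc 0 t, HasDerivWithinAt y (y' s) (Icc 0 t) s)
    (hle : ∀ s ∈ Icc 0 t, y' s ≤ -lam * y s + σ) : y t ≤ σ / lam := by
  set f : ℝ → ℝ := fun s => Real.exp (lam * s) * (y s - σ / lam) with hf
  have hd : ∀ s ∈ Icc 0 t, HasDerivWithinAt f
      (Real.exp (lam * s) * lam * (y s - σ / lam) + Real.exp (lam * s) * y' s) (Icc 0 t) s := by
    intro s hs
    have h1 : HasDerivAt (fun s => Real.exp (lam * s)) (Real.exp (lam * s) * lam) s := by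
      have := ((hasDerivAt_id s).const_mul lam).exp
      simpa using this
    exact h1.hasDerivWithinAt.mul ((hy s hs).sub_const _)
  have hanti : AntitoneOn f (Icc 0 t) := by
    refine antitoneOn_of_hasDerivWithinAt_nonpos (convex_Icc 0 t)
      (fun s hs => (hd s hs).continuousWithinAt)
      (fun s hs => (hd s (interior_subset hs)).mono interior_subset) fun s hs => ?_
    have h1 := hle s (interior_subset hs)
    have h2 : Real.exp (lam * s) * lam * (y s - σ / lam) + Real.exp (lam * s) * y' s =
        Real.exp (lam * s) * (lam * y s - σ + y' s) := by field_simp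
    rw [h2]
    exact mul_nonpos_of_nonneg_of_nonpos (Real.exp_pos _).le (by linarith)
  have h1 := hanti (left_mem_Icc.2 ht) (right_mem_Icc.2 ht) ht
  have h2 : f 0 ≤ 0 := by
    simp only [hf, h0, mul_zero, Real.exp_zero, one_mul, zero_sub, Left.neg_nonpos_iff]
    positivity
  have h3 : Real.exp (lam * t) * (y t - σ / lam) ≤ 0 := h1.trans h2
  have := nonpos_of_mul_nonpos_right h3 (Real.exp_pos _)
  linarith

open scoped RealInnerProductSpace in
-- The equation is tested with three elements: with z - c e, for which Poincaré gives ‖G z‖ ≤ P ‖z'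
-- + W'‖; with z', which gives a damped inequality for ‖G z‖²; and with the kernel element e, which
-- shows that ⟨z + W, e⟩ is conserved.
theorem norm_le_of_energy {V : Type*} [NormedAddCommGroup V] [InnerProductSpace ℝ V]
    [FiniteDimensional ℝ V] (G : V →ₗ[ℝ] V) {e : V} (he : G e = 0) {P : ℝ} (hP : 0 < P)
    (hPoin : ∀ v, ∃ c : ℝ, ‖v - c • e‖ ≤ P * ‖G v‖) {T t S : ℝ} (ht : t ∈ Icc 0 T)
    {z z' W W' : ℝ → V} (hz0 : z 0 = 0)
    (hz : ∀ s ∈ Icc 0 T, HasDerivWithinAt z (z' s) (Icc 0 T) s)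
    (hW : ∀ s ∈ Icc 0 T, HasDerivWithinAt W (W' s) (Icc 0 T) s)
    (heq : ∀ s ∈ Icc 0 T, ∀ v, ⟪z' s, v⟫ = -⟪G (z s), G v⟫ - ⟪W' s, v⟫)
    (hS : ∀ s ∈ Icc 0 t, ‖W s‖ ≤ S) (hS' : ∀ s ∈ Icc 0 t, ‖W' s‖ ≤ S) :
    ‖G (z t)‖ ≤ P * S ∧ ‖z t‖ ≤ 2 * P * P * S + 2 * S := by
  have h0t : (0 : ℝ) ∈ Icc 0 t := left_mem_Icc.2 ht.1
  have hsub : Icc 0 t ⊆ Icc 0 T := Icc_subset_Icc_right ht.2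
  have hS0 : 0 ≤ S := (norm_nonneg _).trans (hS 0 h0t)
  have hGz : ∀ s ∈ Icc 0 t, ‖G (z s)‖ ≤ P * ‖z' s + W' s‖ := fun s hs => by
    obtain ⟨c, hc⟩ := hPoin (z s)
    have h1 := heq s (hsub hs) (z s - c • e)
    rw [map_sub, map_smul, he, smul_zero, sub_zero, real_inner_self_eq_norm_sq] at h1
    have h2 : ‖G (z s)‖ ^ 2 = -⟪z' s + W' s, z s - c • e⟫ := by rw [inner_add_left]; linarith
    have h3 : ‖G (z s)‖ ^ 2 ≤ ‖z' s + W' s‖ * (P * ‖G (z s)‖) := by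
      rw [h2]
      refine (neg_le_abs _).trans ((abs_real_inner_le_norm _ _).trans ?_)
      exact mul_le_mul_of_nonneg_left hc (norm_nonneg _)
    rcases (norm_nonneg (G (z s))).eq_or_lt with h4 | h4
    · rw [← h4]; positivity
    · nlinarith
  have hG : ‖G (z t)‖ ≤ P * S := by
    have hd : ∀ s ∈ Icc 0 t, HasDerivWithinAt (fun s => ‖G (z s)‖ ^ 2)
        (2 * ⟪G (z s), G (z' s)⟫) (Icc 0 t) s := fun s hs => by
      have h1 := ((hz s (hsub hs)).mono hsub)
      have h2 : HasDerivWithinAt (fun s => G (z s)) (G (z' s)) (Icc 0 t) s :=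
        (LinearMap.toContinuousLinearMap G).hasFDerivAt.comp_hasDerivWithinAt s h1
      exact h2.norm_sq
    have h := le_of_deriv_le_neg_mul_add (lam := 1 / P ^ 2) (σ := S ^ 2) (by positivity)
      (by positivity) ht.1 (by simp [hz0]) hd fun s hs => by
        -- Completing the square, the derivative of ‖G z‖² is -‖z' + W'‖² - ‖z'‖² + ‖W'‖², at most
        -- -‖G z‖²/P² + S².
        have h1 := heq s (hsub hs) (z' s)
        have h2 := norm_add_sq_real (z' s) (W' s)
        rw [real_inner_self_eq_norm_sq] at h1
        rw [real_inner_comm] at h2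
        have h3 := hS' s hs
        have h4 : ‖G (z s)‖ ^ 2 ≤ P ^ 2 * ‖z' s + W' s‖ ^ 2 := by
          rw [← mul_pow]; exact pow_le_pow_left₀ (norm_nonneg _) (hGz s hs) 2
        have h5 : 1 / P ^ 2 * ‖G (z s)‖ ^ 2 ≤ ‖z' s + W' s‖ ^ 2 := by
          rw [div_mul_eq_mul_div, one_mul, div_le_iff₀ (by positivity)]; linarith
        have h6 : ‖W' s‖ ^ 2 ≤ S ^ 2 := pow_le_pow_left₀ (norm_nonneg _) h3 2
        nlinarith [sq_nonneg ‖z' s‖]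
    have h1 : ‖G (z t)‖ ^ 2 ≤ (P * S) ^ 2 := h.trans_eq (by field_simp)
    exact le_of_sq_le_sq h1 (by positivity)
  refine ⟨hG, ?_⟩
  obtain ⟨c, hc⟩ := hPoin (z t)
  -- Integrating the equation tested with e in time would cost a factor t; the conservation law does
  -- not.
  have hmean : ⟪z t, e⟫ = ⟪W 0 - W t, e⟫ := by
    have hd : ∀ s ∈ Icc 0 t, HasDerivWithinAt (fun s => ⟪z s + W s, e⟫) 0 (Icc 0 t) s :=
      fun s hs => by
        have h1 := (((hz s (hsub hs)).add (hW s (hsub hs))).mono hsub).inner ℝ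
          (hasDerivWithinAt_const s (Icc 0 t) e)
        have h2 := heq s (hsub hs) e
        rw [he, inner_zero_right] at h2
        rw [inner_zero_right, inner_add_left, h2, neg_zero, zero_sub, neg_add_cancel,
          add_zero] at h1
        exact h1
    have h1 := (convex_Icc 0 t).norm_image_sub_le_of_norm_hasDerivWithin_le (C := 0) hd
      (fun s _ => by simp) h0t (right_mem_Icc.2 ht.1)
    rw [zero_mul, norm_le_zero_iff, sub_eq_zero, hz0, zero_add, inner_add_left] at h1
    rw [inner_sub_left]
    linarith
  -- The component along e is recovered from ⟨z, e⟩ = ⟨W 0 - W t, e⟩, up to the part z - c e already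
  -- controlled by G z. No lower bound for ‖e‖ enters, and e = 0 is allowed.
  have hce : ‖c • e‖ ≤ P * ‖G (z t)‖ + 2 * S := by
    have h1 : ‖c • e‖ ^ 2 = c * (⟪W 0 - W t, e⟫ - ⟪z t - c • e, e⟫) := by
      rw [← hmean, ← inner_sub_left, sub_sub_cancel, ← real_inner_self_eq_norm_sq,
        real_inner_smul_right]
    have h2 : ‖c • e‖ ^ 2 ≤ (P * ‖G (z t)‖ + 2 * S) * ‖c • e‖ := by
      rw [h1, ← inner_sub_left, ← real_inner_smul_right]
      refine (real_inner_le_norm _ _).trans ?_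
      refine mul_le_mul_of_nonneg_right ?_ (norm_nonneg _)
      refine (norm_sub_le _ _).trans ?_
      have h3 := norm_sub_le (W 0) (W t)
      have h4 := hS 0 h0t
      have h5 := hS t (right_mem_Icc.2 ht.1)
      linarith
    rcases (norm_nonneg (c • e)).eq_or_lt with h4 | h4
    · rw [← h4]; positivity
    · nlinarith
  have h1 : ‖z t‖ ≤ ‖z t - c • e‖ + ‖c • e‖ := by
    simpa using norm_add_le (z t - c • e) (c • e)
  have h2 : P * ‖G (z t)‖ ≤ P * (P * S) := mul_le_mul_of_nonneg_left hG hP.le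
  linarith

/-! ## A discrete Poincaré inequality on a cell -/

theorem sq_integral_mul_le (p q : Polynomial ℝ) {a b : ℝ} (hab : a ≤ b) :
    (∫ x in a..b, p.eval x * q.eval x) ^ 2 ≤
      (∫ x in a..b, p.eval x ^ 2) * ∫ x in a..b, q.eval x ^ 2 := by
  have h : ∀ s : ℝ, 0 ≤ (∫ x in a..b, q.eval x ^ 2) * (s * s) +
      (-2 * ∫ x in a..b, p.eval x * q.eval x) * s + ∫ x in a..b, p.eval x ^ 2 := fun s => by
    have h1 : 0 ≤ ∫ x in a..b, (p.eval x - s * q.eval x) ^ 2 :=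
      intervalIntegral.integral_nonneg hab fun x _ => sq_nonneg _
    have h2 : ∫ x in a..b, (p.eval x - s * q.eval x) ^ 2 =
        ∫ x in a..b, ((s * s) * q.eval x ^ 2 + (-2 * s) * (p.eval x * q.eval x) + p.eval x ^ 2) := by
      congr 1; ext x; ring
    rw [h2, intervalIntegral.integral_add (Continuous.intervalIntegrable (by fun_prop) _ _)
      (Continuous.intervalIntegrable (by fun_prop) _ _),
      intervalIntegral.integral_add (Continuous.intervalIntegrable (by fun_prop) _ _)
      (Continuous.intervalIntegrable (by fun_prop) _ _), intervalIntegral.integral_const_mul,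
      intervalIntegral.integral_const_mul] at h1
    linarith
  have := discrim_le_zero h
  rw [discrim] at this
  nlinarith

theorem integral_sq_nonneg (p : Polynomial ℝ) {a b : ℝ} (hab : a ≤ b) :
    0 ≤ ∫ x in a..b, p.eval x ^ 2 :=
  intervalIntegral.integral_nonneg hab fun _ _ => sq_nonneg _

/-- A Hardy inequality. -/
theorem integral_sq_le_of_eval_eq_zero {a b e ε e' : ℝ} (hab : a < b) (he : IsEnd a b e ε)
    (he' : IsEnd a b e' (-ε)) (W : Polynomial ℝ) (hW : W.eval e' = 0) :
    ∫ x in a..b, W.eval x ^ 2 ≤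
      4 * ∫ x in a..b, ((X - C e) * derivative W).eval x ^ 2 := by
  -- Integrating ∫ ((x - e) W)' W by parts, the boundary terms vanish at one end through x - e and
  -- at the other through W. What remains is ∫ W² = -2 ∫ (x - e) W' W, and Cauchy–Schwarz gives the
  -- factor 4.
  have h1 := integral_derivative_mul ((X - C e) * W) W a b
  have hb : ((X - C e) * W).eval b * W.eval b - ((X - C e) * W).eval a * W.eval a = 0 := by
    rcases he with ⟨rfl, rfl⟩ | ⟨rfl, rfl⟩ <;> rcases he' with ⟨rfl, h⟩ | ⟨rfl, h⟩
    · norm_num at h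
    · simp [hW]
    · simp [hW]
    · norm_num at h
  rw [hb] at h1
  have h2 : ∫ x in a..b, (derivative ((X - C e) * W)).eval x * W.eval x =
      (∫ x in a..b, W.eval x ^ 2) +
        ∫ x in a..b, ((X - C e) * derivative W).eval x * W.eval x := by
    rw [← intervalIntegral.integral_add (Continuous.intervalIntegrable (by fun_prop) _ _)
      (Continuous.intervalIntegrable (by fun_prop) _ _)]
    congr 1; ext x
    simp; ring
  have h3 : ∫ x in a..b, ((X - C e) * W).eval x * (derivative W).eval x =
      ∫ x in a..b, ((X - C e) * derivative W).eval x * W.eval x := by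
    congr 1; ext x; simp; ring
  rw [h2, h3] at h1
  have h4 := sq_integral_mul_le ((X - C e) * derivative W) W hab.le
  have h5 := integral_sq_nonneg W hab.le
  have h6 := integral_sq_nonneg ((X - C e) * derivative W) hab.le
  rcases h5.eq_or_lt with h7 | h7
  · linarith
  · set A := ∫ x in a..b, W.eval x ^ 2
    set B := ∫ x in a..b, ((X - C e) * derivative W).eval x ^ 2
    have h8 : A * A ≤ 4 * B * A := by
      have : A = -2 * ∫ x in a..b, ((X - C e) * derivative W).eval x * W.eval x := by linarith
      calc A * A = 4 * (∫ x in a..b, ((X - C e) * derivative W).eval x * W.eval x) ^ 2 := by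
            rw [this]; ring
        _ ≤ 4 * (B * A) := by linarith
        _ = 4 * B * A := by ring
    exact le_of_mul_le_mul_right h8 h7

/-- Write p - p(e) = (x - e) y and test with W such that W' = -ε y and W(e') = 0. Then (p - p(e)) W'
= |x - e| y² is at least (p - p(e))² / (b - a), while the Hardy inequality bounds the norm of W by
twice that of (x - e) W', which is again the norm of p - p(e). No test polynomial sees the
neighbouring cell, as W vanishes at `e'`. -/
theorem cell_poincare {k : ℕ} (hk : 0 < k) {a b e ε e' : ℝ} (hab : a < b) (he : IsEnd a b e ε)
    (he' : IsEnd a b e' (-ε)) (p g : Polynomial ℝ) (hp : p.natDegree ≤ k)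
    (h : ∀ w : Polynomial ℝ, w.natDegree ≤ k → w.eval e' = 0 →
      ∫ x in a..b, (p - C (p.eval e)).eval x * (derivative w).eval x =
        -∫ x in a..b, g.eval x * w.eval x) :
    ∫ x in a..b, (p - C (p.eval e)).eval x ^ 2 ≤ 4 * (b - a) ^ 2 * ∫ x in a..b, g.eval x ^ 2 := by
  set z := p - C (p.eval e) with hz
  obtain ⟨y, hy⟩ : X - C e ∣ z := Polynomial.dvd_iff_isRoot.2 (by simp [hz, Polynomial.IsRoot])
  have hzk : z.natDegree ≤ k := (Polynomial.natDegree_sub_le _ _).trans (by simpa using hp)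
  have hyk : y.natDegree ≤ k - 1 := by
    rcases eq_or_ne y 0 with rfl | hy0
    · simp
    · rw [hy, Polynomial.natDegree_mul (Polynomial.X_sub_C_ne_zero e) hy0,
        Polynomial.natDegree_X_sub_C] at hzk
      omega
  obtain ⟨W₀, hW₀, hW₀k⟩ := exists_derivative_eq (C (-ε) * y)
    ((Polynomial.natDegree_C_mul_le _ _).trans hyk)
  set W := W₀ - C (W₀.eval e') with hW
  have hW' : derivative W = C (-ε) * y := by simp [hW, hW₀]
  have hWe : W.eval e' = 0 := by simp [hW]
  have hWk : W.natDegree ≤ k :=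
    (Polynomial.natDegree_sub_le _ _).trans (by simp; omega)
  have hε : ε * ε = 1 := by simpa using he.pow_mul 1
  have h1 := h W hWk hWe
  have h2 := integral_sq_le_of_eval_eq_zero hab he he' W hWe
  have h3 : ∫ x in a..b, ((X - C e) * derivative W).eval x ^ 2 = ∫ x in a..b, z.eval x ^ 2 := by
    congr 1; ext x
    rw [hW', hy]
    simp only [Polynomial.eval_mul, Polynomial.eval_C]
    linear_combination ((Polynomial.eval x (X - C e)) ^ 2 * (Polynomial.eval x y) ^ 2) * hε
  rw [h3] at h2
  have h4 : ∫ x in a..b, z.eval x ^ 2 ≤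
      (b - a) * ∫ x in a..b, z.eval x * (derivative W).eval x := by
    rw [← intervalIntegral.integral_const_mul]
    refine intervalIntegral.integral_mono_on hab.le
      (Continuous.intervalIntegrable (by fun_prop) _ _)
      (Continuous.intervalIntegrable (by fun_prop) _ _) fun x hx => ?_
    rw [hW', hy]
    simp only [Polynomial.eval_mul, Polynomial.eval_C, Polynomial.eval_sub, Polynomial.eval_X]
    have h5 : (x - e) ^ 2 ≤ (b - a) * (-ε * (x - e)) := by
      rcases he with ⟨rfl, rfl⟩ | ⟨rfl, rfl⟩ <;> nlinarith [hx.1, hx.2]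
    nlinarith [mul_le_mul_of_nonneg_right h5 (sq_nonneg (y.eval x))]
  rw [h1] at h4
  have h5 := sq_integral_mul_le g W hab.le
  have h6 := integral_sq_nonneg z hab.le
  have h7 := integral_sq_nonneg g hab.le
  have h0 : 0 < b - a := sub_pos.2 hab
  set Z := ∫ x in a..b, z.eval x ^ 2
  set Γ := ∫ x in a..b, g.eval x ^ 2
  set J := ∫ x in a..b, g.eval x * W.eval x
  rcases h6.eq_or_lt with h8 | h8
  · rw [← h8]; positivity
  · have h9 : Z * Z ≤ 4 * (b - a) ^ 2 * Γ * Z := by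
      calc Z * Z ≤ ((b - a) * -J) * ((b - a) * -J) := mul_self_le_mul_self h6 h4
        _ = (b - a) ^ 2 * J ^ 2 := by ring
        _ ≤ (b - a) ^ 2 * (Γ * (4 * Z)) := by
          gcongr
          exact h5.trans (mul_le_mul_of_nonneg_left h2 h7)
        _ = _ := by ring
    exact le_of_mul_le_mul_right h9 h8

end

noncomputable section

open Polynomial (derivative X C)

/-! ## The finite element space -/

/-- The finite element space of degree `k`, given by coefficients of polynomials on the cells. -/
def FE (M : Mesh) (k : ℕ) : Type := Fin M.N → Fin (k + 1) → ℝ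

variable {M : Mesh} {k : ℕ}

instance : AddCommGroup (FE M k) := inferInstanceAs (AddCommGroup (Fin M.N → Fin (k + 1) → ℝ))
instance : Module ℝ (FE M k) := inferInstanceAs (Module ℝ (Fin M.N → Fin (k + 1) → ℝ))
instance : Module.Finite ℝ (FE M k) :=
  inferInstanceAs (Module.Finite ℝ (Fin M.N → Fin (k + 1) → ℝ))

/-- The polynomials of a finite element function on the cells. -/
def FE.toPoly (v : FE M k) (j : ℕ) : Polynomial ℝ :=
  if h : j < M.N then ∑ m : Fin (k + 1), Polynomial.monomial (m : ℕ) (v ⟨j, h⟩ m) else 0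

/-- The finite element function with the given polynomials. -/
def FE.ofPoly (M : Mesh) (k : ℕ) (P : ℕ → Polynomial ℝ) : FE M k := fun j m => (P j).coeff m

theorem FE.coeff_toPoly (v : FE M k) {j : ℕ} (hj : j < M.N) (m : Fin (k + 1)) :
    (v.toPoly j).coeff m = v ⟨j, hj⟩ m := by
  rw [FE.toPoly, dif_pos hj, Polynomial.finsetSum_coeff, Finset.sum_eq_single m]
  · simp
  · intro l _ hl
    rw [Polynomial.coeff_monomial, if_neg]
    exact fun h => hl (Fin.ext h)
  · simp

theorem FE.toPoly_natDegree_le (v : FE M k) (j : ℕ) : (v.toPoly j).natDegree ≤ k := by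
  rw [FE.toPoly]
  split_ifs with h
  · refine Polynomial.natDegree_sum_le_of_forall_le _ _ fun m _ => ?_
    exact (Polynomial.natDegree_monomial_le _).trans (Nat.lt_succ_iff.1 m.2)
  · simp

theorem FE.ofPoly_toPoly (v : FE M k) : FE.ofPoly M k v.toPoly = v := by
  funext j m
  exact v.coeff_toPoly j.2 m

theorem FE.toPoly_ofPoly {P : ℕ → Polynomial ℝ} {j : ℕ} (hj : j < M.N)
    (hP : (P j).natDegree ≤ k) : (FE.ofPoly M k P).toPoly j = P j := by
  ext m
  by_cases hm : m < k + 1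
  · rw [FE.coeff_toPoly _ hj ⟨m, hm⟩]; rfl
  · rw [Polynomial.coeff_eq_zero_of_natDegree_lt, Polynomial.coeff_eq_zero_of_natDegree_lt]
    · omega
    · have := (FE.ofPoly M k P).toPoly_natDegree_le j; omega

theorem FE.toPoly_add (v w : FE M k) (j : ℕ) : (v + w).toPoly j = v.toPoly j + w.toPoly j := by
  simp only [FE.toPoly]
  split_ifs
  · rw [← Finset.sum_add_distrib]
    refine Finset.sum_congr rfl fun m _ => ?_
    rw [← map_add]; rfl
  · simp

theorem FE.toPoly_smul (c : ℝ) (v : FE M k) (j : ℕ) : (c • v).toPoly j = C c * v.toPoly j := by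
  simp only [FE.toPoly]
  split_ifs
  · rw [Finset.mul_sum]
    refine Finset.sum_congr rfl fun m _ => ?_
    rw [Polynomial.C_mul_monomial]; rfl
  · simp

theorem FE.toPoly_sub (v w : FE M k) (j : ℕ) : (v - w).toPoly j = v.toPoly j - w.toPoly j := by
  have h := FE.toPoly_add (v - w) w j
  rw [sub_add_cancel] at h
  rw [h, add_sub_cancel_right]

theorem FE.ofPoly_add (P Q : ℕ → Polynomial ℝ) :
    FE.ofPoly M k (fun j => P j + Q j) = FE.ofPoly M k P + FE.ofPoly M k Q := by
  funext j m
  exact Polynomial.coeff_add _ _ _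

/-- The inner product of `L²(0, 2π)`. -/
def FE.ip (v w : FE M k) : ℝ :=
  ∑ j ∈ Finset.range M.N, ∫ x in M.x j..M.x (j + 1), (v.toPoly j).eval x * (w.toPoly j).eval x

theorem Mesh.lt (M : Mesh) {j : ℕ} (hj : j ∈ Finset.range M.N) : M.x j < M.x (j + 1) :=
  M.x_lt j (Finset.mem_range.1 hj)

theorem eq_zero_of_integral_sq {a b : ℝ} (hab : a < b) (p : Polynomial ℝ)
    (h : ∫ x in a..b, p.eval x * p.eval x = 0) : p = 0 := by
  refine Polynomial.eq_zero_of_infinite_isRoot p ((Icc_infinite hab).mono fun x hx => ?_)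
  by_contra hx0
  have hc : Continuous fun x => p.eval x * p.eval x := by fun_prop
  refine (intervalIntegral.integral_pos hab hc.continuousOn
    (fun y _ => mul_self_nonneg _) ⟨x, hx, ?_⟩).ne' h
  exact mul_self_pos.2 hx0

/-- The inner product space structure of `L²(0, 2π)`. -/
@[reducible]
def FE.core (M : Mesh) (k : ℕ) : InnerProductSpace.Core ℝ (FE M k) where
  inner := FE.ip
  conj_inner_symm v w := by simp [FE.ip, mul_comm]
  re_inner_nonneg v := by
    show 0 ≤ FE.ip v v
    refine Finset.sum_nonneg fun j hj => ?_
    exact intervalIntegral.integral_nonneg (M.lt hj).le fun x _ => mul_self_nonneg _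
  add_left u v w := by
    rw [FE.ip, FE.ip, FE.ip, ← Finset.sum_add_distrib]
    refine Finset.sum_congr rfl fun j _ => ?_
    rw [FE.toPoly_add, integral_eval_mul_add]
  smul_left v w c := by
    simp only [FE.ip, conj_trivial, Finset.mul_sum]
    refine Finset.sum_congr rfl fun j _ => ?_
    rw [FE.toPoly_smul, integral_eval_C_mul]
  definite v hv := by
    have h0 : ∀ j ∈ Finset.range M.N, 0 ≤ ∫ x in M.x j..M.x (j + 1),
        (v.toPoly j).eval x * (v.toPoly j).eval x := fun j hj =>
      intervalIntegral.integral_nonneg (M.lt hj).le fun x _ => mul_self_nonneg _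
    have h1 := (Finset.sum_eq_zero_iff_of_nonneg h0).1 hv
    rw [← v.ofPoly_toPoly]
    funext j m
    have := eq_zero_of_integral_sq (M.x_lt j j.2) _ (h1 j (Finset.mem_range.2 j.2))
    show (v.toPoly j).coeff m = 0
    rw [this, Polynomial.coeff_zero]

instance : NormedAddCommGroup (FE M k) := (FE.core M k).toNormedAddCommGroup
instance : InnerProductSpace ℝ (FE M k) :=
  InnerProductSpace.ofCore (FE.core M k).toCore

theorem FE.inner_eq (v w : FE M k) : inner ℝ v w =
    ∑ j ∈ Finset.range M.N,
      ∫ x in M.x j..M.x (j + 1), (v.toPoly j).eval x * (w.toPoly j).eval x := rfl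

theorem FE.norm_sq_eq (v : FE M k) : ‖v‖ ^ 2 =
    ∑ j ∈ Finset.range M.N, ∫ x in M.x j..M.x (j + 1), (v.toPoly j).eval x ^ 2 := by
  rw [← real_inner_self_eq_norm_sq, FE.inner_eq]
  simp only [sq]

theorem FE.norm_ofPoly {P : ℕ → Polynomial ℝ} (hP : ∀ j < M.N, (P j).natDegree ≤ k) :
    ‖FE.ofPoly M k P‖ = normL2 M P := by
  rw [normL2, ← Real.sqrt_sq (norm_nonneg (FE.ofPoly M k P)), FE.norm_sq_eq]
  congr 1
  refine Finset.sum_congr rfl fun j hj => ?_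
  rw [FE.toPoly_ofPoly (Finset.mem_range.1 hj) (hP j (Finset.mem_range.1 hj))]

theorem Mesh.sum_len (M : Mesh) : ∑ j ∈ Finset.range M.N, M.len j = 2 * Real.pi := by
  simp only [Mesh.len]
  rw [Finset.sum_range_sub, M.x_last, M.x_zero, sub_zero]

theorem FE.norm_ofPoly_le {P : ℕ → Polynomial ℝ} (hP : ∀ j < M.N, (P j).natDegree ≤ k) {B : ℝ}
    (hB0 : 0 ≤ B) (hB : ∀ j < M.N, ∀ x ∈ Icc (M.x j) (M.x (j + 1)), |(P j).eval x| ≤ B) :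
    ‖FE.ofPoly M k P‖ ≤ 3 * B := by
  have h1 : ‖FE.ofPoly M k P‖ ^ 2 ≤ 2 * Real.pi * B ^ 2 := by
    rw [FE.norm_sq_eq, ← M.sum_len, Finset.sum_mul]
    refine Finset.sum_le_sum fun j hj => ?_
    have hj' := Finset.mem_range.1 hj
    rw [FE.toPoly_ofPoly hj' (hP j hj')]
    have h2 : ∫ x in M.x j..M.x (j + 1), (P j).eval x ^ 2 ≤ ∫ _ in M.x j..M.x (j + 1), B ^ 2 := by
      refine intervalIntegral.integral_mono_on (M.lt hj).le
        (Continuous.intervalIntegrable (by fun_prop) _ _)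
        (Continuous.intervalIntegrable (by fun_prop) _ _) fun x hx => ?_
      rw [← sq_abs]
      exact pow_le_pow_left₀ (abs_nonneg _) (hB j hj' x hx) 2
    rwa [intervalIntegral.integral_const, smul_eq_mul] at h2
  -- The factor 3 comes from 2π ≤ 9.
  refine le_of_sq_le_sq (h1.trans ?_) (by positivity)
  have := Real.pi_lt_d2
  nlinarith [sq_nonneg B]

/-- The finite element function that is `w` on the cell `j` and `0` on the others. -/
def FE.single (M : Mesh) (k j : ℕ) (w : Polynomial ℝ) : FE M k :=
  FE.ofPoly M k fun i => if i = j then w else 0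

theorem FE.toPoly_single {j : ℕ} {w : Polynomial ℝ} (hw : w.natDegree ≤ k) {i : ℕ}
    (hi : i < M.N) : (FE.single M k j w).toPoly i = if i = j then w else 0 := by
  refine FE.toPoly_ofPoly hi ?_
  split_ifs <;> simp [hw]

/-- The norm on `FE` is that of L², not the one of a product space, so the derivative is assembled
from the expansion in the finite coordinate basis. -/
theorem FE.hasDerivWithinAt {z : ℝ → FE M k} {z' : FE M k} {s : Set ℝ} {t : ℝ}
    (h : ∀ j m, HasDerivWithinAt (fun t => z t j m) (z' j m) s t) : HasDerivWithinAt z z' s t := by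
  let b : Fin M.N → Fin (k + 1) → FE M k := fun j m => Pi.single j (Pi.single m (1 : ℝ))
  have hb : ∀ v : FE M k, v = ∑ j, ∑ m, v j m • b j m := fun v => by
    funext j m
    have h1 : ∀ (i : Fin M.N) (l : Fin (k + 1)), (v i l • b i l : FE M k) j m =
        v i l * (Pi.single (M := fun _ => Fin (k + 1) → ℝ) i (Pi.single l (1 : ℝ)) : Fin M.N → Fin (k + 1) → ℝ) j m := fun i l => rfl
    have h2 : (∑ i, ∑ l, v i l • b i l : FE M k) j m = ∑ i, ∑ l, (v i l • b i l : FE M k) j m := by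
      refine (congrFun (Finset.sum_apply j Finset.univ fun i => ∑ l, v i l • b i l) m).trans ?_
      refine (Finset.sum_apply m Finset.univ _).trans ?_
      refine Finset.sum_congr rfl fun i _ => ?_
      refine (congrFun (Finset.sum_apply j Finset.univ fun l => v i l • b i l) m).trans ?_
      exact Finset.sum_apply m Finset.univ _
    rw [h2]
    simp only [h1]
    rw [Finset.sum_eq_single j, Finset.sum_eq_single m]
    · simp
    · intro l _ hl; simp [Pi.single_eq_of_ne (Ne.symm hl)]
    · simp
    · intro i _ hi; simp [Pi.single_eq_of_ne (Ne.symm hi)]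
    · simp
  rw [hb z', show z = fun t => ∑ j, ∑ m, z t j m • b j m from funext fun t => hb (z t)]
  exact HasDerivWithinAt.fun_sum fun j _ => HasDerivWithinAt.fun_sum fun m _ =>
    (h j m).smul_const _

end

noncomputable section

open Polynomial (derivative X C)

/-! ## The discrete gradient -/

/-- The homogeneous boundary condition. -/
def Boundary.homog : Boundary → Boundary
  | .periodic => .periodic
  | .mixed _ _ => .mixed (fun _ => 0) (fun _ => 0)

/-- The reference coordinate of the end of a cell from which the flux of `u` is taken. -/
def Flux.sgn : Flux → ℝ
  | .minusPlus => 1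
  | .plusMinus => -1

/-- The end of a cell from which the flux of `u` is taken. -/
def Flux.endU : Flux → ℝ → ℝ → ℝ
  | .minusPlus, _, b => b
  | .plusMinus, a, _ => a

/-- The end of a cell from which the flux of `q` is taken. -/
def Flux.endQ : Flux → ℝ → ℝ → ℝ
  | .minusPlus, a, _ => a
  | .plusMinus, _, b => b

theorem Flux.isEndU (fl : Flux) (a b : ℝ) : IsEnd a b (fl.endU a b) fl.sgn := by
  cases fl <;> simp [IsEnd, Flux.endU, Flux.sgn]

theorem Flux.isEndQ (fl : Flux) (a b : ℝ) : IsEnd a b (fl.endQ a b) (-fl.sgn) := by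
  cases fl <;> simp [IsEnd, Flux.endQ, Flux.sgn]

theorem Mesh.N_pos (M : Mesh) : 0 < M.N := by
  rcases Nat.eq_zero_or_pos M.N with h | h
  · have h1 := M.x_last
    rw [h, M.x_zero] at h1
    exact absurd h1 Real.two_pi_pos.ne
  · exact h

theorem traceMinus_succ (M : Mesh) (bc : Boundary) (t : ℝ) (v : ℕ → Polynomial ℝ) (j : ℕ) :
    traceMinus M bc t v (j + 1) = (v j).eval (M.x (j + 1)) := by simp [traceMinus]

theorem tracePlus_of_lt {M : Mesh} (bc : Boundary) (t : ℝ) (v : ℕ → Polynomial ℝ) {j : ℕ}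
    (hj : j < M.N) : tracePlus M bc t v j = (v j).eval (M.x j) := by simp [tracePlus, hj.ne]

/-- The right-hand side of the equations of the scheme on the cell `j`, for the flux `hat`. -/
def cellForm (M : Mesh) (hat : ℕ → ℝ) (v w : Polynomial ℝ) (j : ℕ) : ℝ :=
  -(∫ x in M.x j..M.x (j + 1), v.eval x * (derivative w).eval x)
    + hat (j + 1) * w.eval (M.x (j + 1)) - hat j * w.eval (M.x j)

variable {M : Mesh} {k : ℕ}

/-- The flux of `u` with homogeneous boundary conditions. -/
def fluxU (fl : Flux) (bc : Boundary) (v : FE M k) (i : ℕ) : ℝ := uHat M bc.homog 0 v.toPoly i fl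

/-- The flux of `q` with homogeneous boundary conditions. -/
def fluxQ (fl : Flux) (bc : Boundary) (v : FE M k) (i : ℕ) : ℝ := qHat M bc.homog 0 v.toPoly i fl

theorem fluxU_add (fl : Flux) (bc : Boundary) (v w : FE M k) (i : ℕ) :
    fluxU fl bc (v + w) i = fluxU fl bc v i + fluxU fl bc w i := by
  cases fl <;> cases bc <;> simp only [fluxU, uHat, traceMinus, tracePlus, Boundary.homog,
    FE.toPoly_add, Polynomial.eval_add] <;> split_ifs <;> simp

theorem fluxU_smul (fl : Flux) (bc : Boundary) (c : ℝ) (v : FE M k) (i : ℕ) :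
    fluxU fl bc (c • v) i = c * fluxU fl bc v i := by
  cases fl <;> cases bc <;> simp only [fluxU, uHat, traceMinus, tracePlus, Boundary.homog,
    FE.toPoly_smul, Polynomial.eval_mul, Polynomial.eval_C] <;> split_ifs <;> simp

/-- The sum over the cells of the right-hand sides of the equation for `q`. -/
def gradForm (fl : Flux) (bc : Boundary) (v w : FE M k) : ℝ :=
  ∑ j ∈ Finset.range M.N, cellForm M (fluxU fl bc v) (v.toPoly j) (w.toPoly j) j

theorem cellForm_add_left (hat hat' : ℕ → ℝ) (v v' w : Polynomial ℝ) (j : ℕ) :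
    cellForm M (fun i => hat i + hat' i) (v + v') w j =
      cellForm M hat v w j + cellForm M hat' v' w j := by
  simp only [cellForm, integral_eval_mul_add]; ring

theorem cellForm_smul_left (c : ℝ) (hat : ℕ → ℝ) (v w : Polynomial ℝ) (j : ℕ) :
    cellForm M (fun i => c * hat i) (C c * v) w j = c * cellForm M hat v w j := by
  simp only [cellForm, integral_eval_C_mul]; ring

theorem cellForm_add_right (hat : ℕ → ℝ) (v w w' : Polynomial ℝ) (j : ℕ) :
    cellForm M hat v (w + w') j = cellForm M hat v w j + cellForm M hat v w' j := by
  have h := integral_eval_mul_add (derivative w) (derivative w') v (M.x j) (M.x (j + 1))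
  simp only [cellForm, mul_comm (Polynomial.eval _ v), Polynomial.derivative_add, h]
  simp only [Polynomial.eval_add]
  ring

theorem cellForm_smul_right (c : ℝ) (hat : ℕ → ℝ) (v w : Polynomial ℝ) (j : ℕ) :
    cellForm M hat v (C c * w) j = c * cellForm M hat v w j := by
  have h := integral_eval_C_mul c (derivative w) v (M.x j) (M.x (j + 1))
  simp only [cellForm, mul_comm (Polynomial.eval _ v), Polynomial.derivative_C_mul, h]
  simp only [Polynomial.eval_mul, Polynomial.eval_C]
  ring

theorem cellForm_zero_right (hat : ℕ → ℝ) (v : Polynomial ℝ) (j : ℕ) :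
    cellForm M hat v 0 j = 0 := by simp [cellForm]

theorem gradForm_add_left (fl : Flux) (bc : Boundary) (v v' w : FE M k) :
    gradForm fl bc (v + v') w = gradForm fl bc v w + gradForm fl bc v' w := by
  simp only [gradForm, ← Finset.sum_add_distrib, ← cellForm_add_left, FE.toPoly_add]
  simp only [funext (fluxU_add fl bc v v')]

theorem gradForm_smul_left (fl : Flux) (bc : Boundary) (c : ℝ) (v w : FE M k) :
    gradForm fl bc (c • v) w = c * gradForm fl bc v w := by
  simp only [gradForm, Finset.mul_sum, ← cellForm_smul_left, FE.toPoly_smul]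
  simp only [funext (fluxU_smul fl bc c v)]

instance : CompleteSpace (FE M k) := FiniteDimensional.complete ℝ _

/-- The functional that `v` induces by `gradForm`. -/
def gradDual (fl : Flux) (bc : Boundary) (v : FE M k) : StrongDual ℝ (FE M k) :=
  LinearMap.toContinuousLinearMap
    { toFun := gradForm fl bc v
      map_add' := fun w w' => by
        simp only [gradForm, ← Finset.sum_add_distrib, FE.toPoly_add, cellForm_add_right]
      map_smul' := fun c w => by
        simp only [gradForm, Finset.mul_sum, FE.toPoly_smul, cellForm_smul_right,
          RingHom.id_apply, smul_eq_mul] }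

/-- The discrete gradient. -/
def grad (fl : Flux) (bc : Boundary) : FE M k →ₗ[ℝ] FE M k where
  toFun v := (InnerProductSpace.toDual ℝ (FE M k)).symm (gradDual fl bc v)
  map_add' v v' := by
    rw [← map_add]
    congr 1
    ext w
    exact gradForm_add_left fl bc v v' w
  map_smul' c v := by
    have : gradDual fl bc (c • v) = c • gradDual fl bc v := by
      ext w
      exact gradForm_smul_left fl bc c v w
    rw [this, map_smulₛₗ]
    simp

theorem inner_grad (fl : Flux) (bc : Boundary) (v w : FE M k) :
    inner ℝ (grad fl bc v) w = gradForm fl bc v w :=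
  InnerProductSpace.toDual_symm_apply

theorem FE.inner_single (v : FE M k) {j : ℕ} (hj : j < M.N) {w : Polynomial ℝ}
    (hw : w.natDegree ≤ k) : inner ℝ v (FE.single M k j w) =
      ∫ x in M.x j..M.x (j + 1), (v.toPoly j).eval x * w.eval x := by
  rw [FE.inner_eq, Finset.sum_eq_single j]
  · rw [FE.toPoly_single hw hj, if_pos rfl]
  · intro i hi hij
    rw [FE.toPoly_single hw (Finset.mem_range.1 hi), if_neg hij]
    simp
  · intro h; exact absurd (Finset.mem_range.2 hj) h

/-- The discrete gradient is given locally by the equation for `q`. -/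
theorem integral_grad_mul (fl : Flux) (bc : Boundary) (v : FE M k) {j : ℕ} (hj : j < M.N)
    {w : Polynomial ℝ} (hw : w.natDegree ≤ k) :
    ∫ x in M.x j..M.x (j + 1), ((grad fl bc v).toPoly j).eval x * w.eval x =
      cellForm M (fluxU fl bc v) (v.toPoly j) w j := by
  rw [← FE.inner_single _ hj hw, inner_grad, gradForm, Finset.sum_eq_single j]
  · rw [FE.toPoly_single hw hj, if_pos rfl]
  · intro i hi hij
    rw [FE.toPoly_single hw (Finset.mem_range.1 hi), if_neg hij, cellForm_zero_right]
  · intro h; exact absurd (Finset.mem_range.2 hj) h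

theorem FE.ext_integral {v w : FE M k} (h : ∀ j < M.N, ∀ p : Polynomial ℝ, p.natDegree ≤ k →
    ∫ x in M.x j..M.x (j + 1), (v.toPoly j).eval x * p.eval x =
      ∫ x in M.x j..M.x (j + 1), (w.toPoly j).eval x * p.eval x) : v = w := by
  refine ext_inner_right ℝ fun z => ?_
  rw [FE.inner_eq, FE.inner_eq]
  exact Finset.sum_congr rfl fun j hj =>
    h j (Finset.mem_range.1 hj) _ (z.toPoly_natDegree_le j)

/-- Periodic fluxes agree at both ends; in the mixed case exactly one factor is a prescribed, hence
homogeneous, value at each end. So summation by parts over the cells leaves no boundary term. -/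
theorem flux_zero_mul (fl : Flux) (bc : Boundary) (v q : FE M k) :
    fluxQ fl bc q M.N * fluxU fl bc v M.N - fluxQ fl bc q 0 * fluxU fl bc v 0 = 0 := by
  have hN := M.N_pos
  obtain ⟨n, hn⟩ : ∃ n, M.N = n + 1 := ⟨M.N - 1, by omega⟩
  cases fl <;> cases bc <;> simp [fluxU, fluxQ, uHat, qHat, traceMinus, tracePlus, Boundary.homog, hn]

/-- The form of the equation for `u` is minus the adjoint of the one of the equation for `q`. -/
theorem sum_cellForm_fluxQ (fl : Flux) (bc : Boundary) (v q : FE M k) :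
    ∑ j ∈ Finset.range M.N, cellForm M (fluxQ fl bc q) (q.toPoly j) (v.toPoly j) j =
      -gradForm fl bc v q := by
  -- At one end of the cell the flux of v is its own trace, at the other end that of q is.
  -- Integration by parts therefore leaves only the products of fluxes, which telescope. This is
  -- where the fluxes have to alternate.
  have h1 : ∀ j ∈ Finset.range M.N,
      cellForm M (fluxQ fl bc q) (q.toPoly j) (v.toPoly j) j =
        (fluxQ fl bc q (j + 1) * fluxU fl bc v (j + 1) - fluxQ fl bc q j * fluxU fl bc v j)
          - cellForm M (fluxU fl bc v) (v.toPoly j) (q.toPoly j) j := by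
    intro j hj
    have hj' := Finset.mem_range.1 hj
    have h2 := integral_derivative_mul (v.toPoly j) (q.toPoly j) (M.x j) (M.x (j + 1))
    simp only [cellForm]
    have h3 : ∫ x in M.x j..M.x (j + 1), (q.toPoly j).eval x * (derivative (v.toPoly j)).eval x =
        ∫ x in M.x j..M.x (j + 1), (derivative (v.toPoly j)).eval x * (q.toPoly j).eval x := by
      simp only [mul_comm]
    rw [h3, h2]
    cases fl
    · simp only [fluxU, fluxQ, uHat, qHat, traceMinus_succ, tracePlus_of_lt _ _ _ hj']
      ring
    · simp only [fluxU, fluxQ, uHat, qHat, traceMinus_succ, tracePlus_of_lt _ _ _ hj']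
      ring
  rw [Finset.sum_congr rfl h1, Finset.sum_sub_distrib,
    Finset.sum_range_sub fun j => fluxQ fl bc q j * fluxU fl bc v j, flux_zero_mul, gradForm]
  ring

/-! ### The kernel of the discrete gradient and the discrete Poincaré inequality -/

/-- The element that spans the kernel of the discrete gradient. -/
def kerElt (M : Mesh) (k : ℕ) : Boundary → FE M k
  | .periodic => FE.ofPoly M k fun _ => 1
  | .mixed _ _ => 0

theorem toPoly_kerElt_periodic {j : ℕ} (hj : j < M.N) :
    (kerElt M k .periodic).toPoly j = 1 :=
  FE.toPoly_ofPoly (P := fun _ => 1) hj (by simp)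

theorem fluxU_kerElt (fl : Flux) {i : ℕ} (hi : i ≤ M.N) :
    fluxU fl .periodic (kerElt M k .periodic) i = 1 := by
  have hN := M.N_pos
  cases fl
  · simp only [fluxU, uHat, traceMinus, Boundary.homog]
    split_ifs with h
    · rw [toPoly_kerElt_periodic (by omega), Polynomial.eval_one]
    · rw [toPoly_kerElt_periodic (by omega), Polynomial.eval_one]
  · simp only [fluxU, uHat, tracePlus, Boundary.homog]
    split_ifs with h
    · rw [toPoly_kerElt_periodic (by omega), Polynomial.eval_one]
    · rw [toPoly_kerElt_periodic (by omega), Polynomial.eval_one]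

theorem grad_kerElt (fl : Flux) (bc : Boundary) : grad fl bc (kerElt M k bc) = 0 := by
  cases bc with
  | mixed g₀ g₁ => exact map_zero _
  | periodic =>
    refine FE.ext_integral fun j hj p hp => ?_
    have h0 : (0 : FE M k).toPoly j = 0 := by
      have := FE.toPoly_smul 0 (0 : FE M k) j
      simpa using this
    rw [integral_grad_mul _ _ _ hj hp, cellForm, fluxU_kerElt fl (by omega),
      fluxU_kerElt fl (by omega), toPoly_kerElt_periodic hj, h0]
    have := integral_derivative_mul p 1 (M.x j) (M.x (j + 1))
    simp only [Polynomial.eval_one, mul_one, Polynomial.derivative_one, Polynomial.eval_zero,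
      mul_zero, intervalIntegral.integral_zero, sub_zero] at this
    simp only [Polynomial.eval_one, one_mul, Polynomial.eval_zero, zero_mul,
      intervalIntegral.integral_zero, this]
    ring

/-- The test function 1 on a cell: the flux of u varies like a function with derivative `grad`,
which links neighbouring cells in the Poincaré inequality. -/
theorem fluxU_succ_sub (fl : Flux) (bc : Boundary) (v : FE M k) {j : ℕ} (hj : j < M.N) :
    fluxU fl bc v (j + 1) - fluxU fl bc v j =
      ∫ x in M.x j..M.x (j + 1), ((grad fl bc v).toPoly j).eval x := by
  have := integral_grad_mul fl bc v hj (w := 1) (by simp)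
  simp only [Polynomial.eval_one, mul_one, cellForm, Polynomial.derivative_one,
    Polynomial.eval_zero, mul_zero, intervalIntegral.integral_zero, neg_zero, zero_add] at this
  exact this.symm

/-- The fluxes of `u` at the nodes differ by at most the norm of the discrete gradient. -/
theorem sq_fluxU_sub_le (fl : Flux) (bc : Boundary) (v : FE M k) {i l : ℕ} (hil : i ≤ l)
    (hl : l ≤ M.N) :
    (fluxU fl bc v l - fluxU fl bc v i) ^ 2 ≤ 2 * Real.pi * ‖grad fl bc v‖ ^ 2 := by
  set g := fun j => ((grad fl bc v).toPoly j) with hg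
  -- Telescoping, followed by Cauchy–Schwarz on each cell and then over the cells; the lengths sum
  -- up to 2π.
  have h1 : fluxU fl bc v l - fluxU fl bc v i =
      ∑ j ∈ Finset.Ico i l, ∫ x in M.x j..M.x (j + 1), (g j).eval x := by
    rw [← Finset.sum_Ico_sub _ hil]
    refine Finset.sum_congr rfl fun j hj => ?_
    exact fluxU_succ_sub fl bc v ((Finset.mem_Ico.1 hj).2.trans_le hl)
  have hmem : ∀ j ∈ Finset.Ico i l, j ∈ Finset.range M.N := fun j hj =>
    Finset.mem_range.2 ((Finset.mem_Ico.1 hj).2.trans_le hl)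
  have h2 : ∀ j ∈ Finset.Ico i l, |∫ x in M.x j..M.x (j + 1), (g j).eval x| ≤
      Real.sqrt (M.len j) * Real.sqrt (∫ x in M.x j..M.x (j + 1), (g j).eval x ^ 2) := by
    intro j hj
    have hlt := M.lt (hmem j hj)
    have h3 := sq_integral_mul_le 1 (g j) hlt.le
    simp only [Polynomial.eval_one, one_mul, one_pow, intervalIntegral.integral_const,
      smul_eq_mul, mul_one] at h3
    rw [Mesh.len, ← Real.sqrt_mul (sub_nonneg.2 hlt.le)]
    exact Real.abs_le_sqrt h3
  have h3 : |fluxU fl bc v l - fluxU fl bc v i| ≤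
      ∑ j ∈ Finset.Ico i l, Real.sqrt (M.len j) *
        Real.sqrt (∫ x in M.x j..M.x (j + 1), (g j).eval x ^ 2) := by
    rw [h1]
    exact (Finset.abs_sum_le_sum_abs _ _).trans (Finset.sum_le_sum h2)
  rw [← sq_abs]
  refine (pow_le_pow_left₀ (abs_nonneg _) h3 2).trans ?_
  refine (Finset.sum_mul_sq_le_sq_mul_sq _ _ _).trans ?_
  have hsub : Finset.Ico i l ⊆ Finset.range M.N := fun j hj => hmem j hj
  refine mul_le_mul ?_ ?_ (Finset.sum_nonneg fun _ _ => sq_nonneg _) Real.two_pi_pos.le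
  · rw [← M.sum_len]
    refine (Finset.sum_le_sum_of_subset_of_nonneg hsub fun _ _ _ => sq_nonneg _).trans_eq ?_
    exact Finset.sum_congr rfl fun j hj => Real.sq_sqrt (sub_nonneg.2 (M.lt hj).le)
  · rw [FE.norm_sq_eq]
    refine (Finset.sum_le_sum_of_subset_of_nonneg hsub fun _ _ _ => sq_nonneg _).trans_eq ?_
    exact Finset.sum_congr rfl fun j hj => Real.sq_sqrt (integral_sq_nonneg _ (M.lt hj).le)

theorem Mesh.len_le (M : Mesh) {j : ℕ} (hj : j < M.N) : M.len j ≤ 2 * Real.pi := by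
  rw [← M.sum_len]
  exact Finset.single_le_sum (f := M.len) (fun i hi => sub_nonneg.2 (M.lt hi).le)
    (Finset.mem_range.2 hj)

/-- The node of the cell `j` at which the flux of `u` is the value of the function. -/
def Flux.node : Flux → ℕ → ℕ
  | .minusPlus, j => j + 1
  | .plusMinus, j => j

theorem fluxU_node (fl : Flux) (bc : Boundary) (v : FE M k) {j : ℕ} (hj : j < M.N) :
    fluxU fl bc v (fl.node j) = (v.toPoly j).eval (fl.endU (M.x j) (M.x (j + 1))) := by
  cases fl
  · simp only [fluxU, uHat, Flux.node, Flux.endU, traceMinus_succ]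
  · simp only [fluxU, uHat, Flux.node, Flux.endU, tracePlus_of_lt _ _ _ hj]

/-- For test polynomials that vanish at the end `endQ`, the local equation of `grad` involves only
the own trace of v, as `cell_poincare` requires. -/
theorem integral_sq_sub_node_le (hk : 0 < k) (fl : Flux) (bc : Boundary) (v : FE M k) {j : ℕ}
    (hj : j < M.N) :
    ∫ x in M.x j..M.x (j + 1),
        (v.toPoly j - C (fluxU fl bc v (fl.node j))).eval x ^ 2 ≤
      4 * (2 * Real.pi) ^ 2 *
        ∫ x in M.x j..M.x (j + 1), ((grad fl bc v).toPoly j).eval x ^ 2 := by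
  have hlt := M.x_lt j hj
  rw [fluxU_node fl bc v hj]
  refine (cell_poincare hk hlt (fl.isEndU _ _) (fl.isEndQ _ _) _ ((grad fl bc v).toPoly j)
    (v.toPoly_natDegree_le j) fun w hw hw0 => ?_).trans ?_
  · rw [integral_grad_mul fl bc v hj hw, integral_eval_mul_sub, cellForm]
    have h1 := integral_derivative_mul w 1 (M.x j) (M.x (j + 1))
    simp only [Polynomial.eval_one, mul_one, Polynomial.derivative_one, Polynomial.eval_zero,
      mul_zero, intervalIntegral.integral_zero, sub_zero] at h1
    have h2 := fluxU_node fl bc v hj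
    simp only [Polynomial.eval_C]
    rw [intervalIntegral.integral_const_mul, h1]
    cases fl
    · simp only [Flux.node, Flux.endU, Flux.endQ] at h2 hw0 ⊢
      rw [h2, hw0]; ring
    · simp only [Flux.node, Flux.endU, Flux.endQ] at h2 hw0 ⊢
      rw [h2, hw0]; ring
  · have h1 := M.len_le hj
    have h2 : 0 ≤ M.x (j + 1) - M.x j := sub_nonneg.2 hlt.le
    refine mul_le_mul_of_nonneg_right ?_ (integral_sq_nonneg _ hlt.le)
    gcongr
    exact h1

/-- The discrete Poincaré inequality. -/
theorem poincare (hk : 0 < k) (fl : Flux) (bc : Boundary) (v : FE M k) :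
    ∃ c : ℝ, ‖v - c • kerElt M k bc‖ ≤ 7 * Real.pi * ‖grad fl bc v‖ := by
  have hN := M.N_pos
  have hpi := Real.pi_pos
  -- The flux at the end of [0, 2π] where the mixed condition prescribes u. There it is 0, in
  -- accordance with the trivial kernel; in the periodic case any node would do.
  set c := fluxU fl bc v (match fl with | .minusPlus => 0 | .plusMinus => M.N) with hc
  have hΓ : ∀ i ≤ M.N, (fluxU fl bc v i - c) ^ 2 ≤ 2 * Real.pi * ‖grad fl bc v‖ ^ 2 := by
    intro i hi
    cases fl
    · exact sq_fluxU_sub_le _ bc v i.zero_le hi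
    · rw [← neg_sq, neg_sub]
      exact sq_fluxU_sub_le _ bc v hi le_rfl
  have hpoly : ∀ j < M.N, (v - c • kerElt M k bc).toPoly j = v.toPoly j - C c := by
    intro j hj
    rw [FE.toPoly_sub, FE.toPoly_smul]
    cases bc with
    | periodic => rw [toPoly_kerElt_periodic hj, mul_one]
    | mixed g₀ g₁ =>
      have : c = 0 := by
        cases fl <;> simp [hc, fluxU, uHat, traceMinus, tracePlus, Boundary.homog]
      rw [this]; simp
  refine ⟨c, le_of_sq_le_sq ?_ (by positivity)⟩
  set Γ := ‖grad fl bc v‖ ^ 2 with hΓdef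
  have hcell : ∀ j ∈ Finset.range M.N,
      ∫ x in M.x j..M.x (j + 1), ((v - c • kerElt M k bc).toPoly j).eval x ^ 2 ≤
        8 * (2 * Real.pi) ^ 2 *
          (∫ x in M.x j..M.x (j + 1), ((grad fl bc v).toPoly j).eval x ^ 2) +
        M.len j * (4 * Real.pi * Γ) := by
    intro j hj
    have hj' := Finset.mem_range.1 hj
    have hlt := M.lt hj
    rw [hpoly j hj']
    set d := fluxU fl bc v (fl.node j) with hd
    have hdc : (d - c) ^ 2 ≤ 2 * Real.pi * Γ := hΓ _ (by cases fl <;> simp [Flux.node] <;> omega)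
    have h1 := integral_sq_sub_node_le hk fl bc v hj'
    have h2 : ∫ x in M.x j..M.x (j + 1), (v.toPoly j - C c).eval x ^ 2 ≤
        ∫ x in M.x j..M.x (j + 1), (2 * (v.toPoly j - C d).eval x ^ 2 + 2 * (d - c) ^ 2) := by
      refine intervalIntegral.integral_mono_on hlt.le
        (Continuous.intervalIntegrable (by fun_prop) _ _)
        (Continuous.intervalIntegrable (by fun_prop) _ _) fun x _ => ?_
      simp only [Polynomial.eval_sub, Polynomial.eval_C]
      nlinarith [sq_nonneg ((v.toPoly j).eval x - d - (d - c))]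
    rw [intervalIntegral.integral_add (Continuous.intervalIntegrable (by fun_prop) _ _)
      (Continuous.intervalIntegrable (by fun_prop) _ _), intervalIntegral.integral_const_mul,
      intervalIntegral.integral_const, smul_eq_mul] at h2
    have h3 : (M.x (j + 1) - M.x j) * (2 * (d - c) ^ 2) ≤ M.len j * (4 * Real.pi * Γ) :=
      mul_le_mul_of_nonneg_left (by linarith) (sub_nonneg.2 hlt.le)
    linarith
  rw [FE.norm_sq_eq]
  -- In total 32π² + 8π² = 40π², below (7π)².
  refine (Finset.sum_le_sum hcell).trans ?_
  rw [Finset.sum_add_distrib, ← Finset.mul_sum, ← FE.norm_sq_eq, ← Finset.sum_mul, M.sum_len,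
    mul_pow, ← hΓdef]
  have : 0 ≤ Γ * Real.pi ^ 2 := by positivity
  nlinarith

end

noncomputable section

open Polynomial (derivative X C)

/-! ## The corrected projections -/

variable {M : Mesh} {k : ℕ}

/-- The projection of `u`, where `D i` is the `i`-th derivative of `u`. -/
def famProjU (k : ℕ) (M : Mesh) (fl : Flux) (D : ℕ → ℝ → ℝ) (j : ℕ) : Polynomial ℝ :=
  radau k (M.x j) (M.x (j + 1)) (fl.endU (M.x j) (M.x (j + 1))) (D 0)

/-- The projection of `q`. -/
def famProjQ (k : ℕ) (M : Mesh) (fl : Flux) (D : ℕ → ℝ → ℝ) (j : ℕ) : Polynomial ℝ :=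
  radau k (M.x j) (M.x (j + 1)) (fl.endQ (M.x j) (M.x (j + 1))) (D 1)

/-- The coefficient of the second order correction. -/
def famAlpha (k : ℕ) (M : Mesh) (fl : Flux) (D : ℕ → ℝ → ℝ) (j : ℕ) : ℝ :=
  coefAt k (M.x j) (M.x (j + 1)) (fl.endU (M.x j) (M.x (j + 1))) fl.sgn (D 2)

/-- The coefficient of the first order correction. -/
def famBeta (k : ℕ) (M : Mesh) (fl : Flux) (D : ℕ → ℝ → ℝ) (j : ℕ) : ℝ :=
  coefAt k (M.x j) (M.x (j + 1)) (fl.endQ (M.x j) (M.x (j + 1))) (-fl.sgn) (D 1)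

/-- The correction function of `u`. -/
def famWU (k : ℕ) (M : Mesh) (fl : Flux) (D : ℕ → ℝ → ℝ) (j : ℕ) : Polynomial ℝ :=
  cellWu k (M.x j) (M.x (j + 1)) (fl.endU (M.x j) (M.x (j + 1))) (fl.endQ (M.x j) (M.x (j + 1)))
    (famAlpha k M fl D j) (famBeta k M fl D j)

/-- The correction function of `q`. -/
def famWQ (k : ℕ) (M : Mesh) (fl : Flux) (D : ℕ → ℝ → ℝ) (j : ℕ) : Polynomial ℝ :=
  cellWq k (M.x j) (M.x (j + 1)) (fl.endQ (M.x j) (M.x (j + 1))) (famAlpha k M fl D j)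

theorem famWU_natDegree_le (fl : Flux) (D : ℕ → ℝ → ℝ) {j : ℕ} (hj : j < M.N) :
    (famWU k M fl D j).natDegree ≤ k :=
  cellWu_natDegree_le (M.x_lt j hj) (fl.isEndU _ _) _ _

theorem famWQ_natDegree_le (fl : Flux) (D : ℕ → ℝ → ℝ) {j : ℕ} (hj : j < M.N) :
    (famWQ k M fl D j).natDegree ≤ k :=
  cellWq_natDegree_le (M.x_lt j hj) (fl.isEndQ _ _) _

theorem famProjU_natDegree_le (fl : Flux) {D : ℕ → ℝ → ℝ} (hD : Continuous (D 0)) {j : ℕ}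
    (hj : j < M.N) : (famProjU k M fl D j).natDegree ≤ k :=
  (isRadau_radau (M.x_lt j hj) (fl.isEndU _ _) hD.continuousOn).natDegree_le

theorem famProjQ_natDegree_le (fl : Flux) {D : ℕ → ℝ → ℝ} (hD : Continuous (D 1)) {j : ℕ}
    (hj : j < M.N) : (famProjQ k M fl D j).natDegree ≤ k :=
  (isRadau_radau (M.x_lt j hj) (fl.isEndQ _ _) hD.continuousOn).natDegree_le

theorem integral_deriv_mul_eval {f f' : ℝ → ℝ} (hf : ∀ x, HasDerivAt f (f' x) x)
    (hf' : Continuous f') (w : Polynomial ℝ) (a b : ℝ) :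
    (∫ x in a..b, f' x * w.eval x) + ∫ x in a..b, f x * (derivative w).eval x =
      f b * w.eval b - f a * w.eval a := by
  rw [intervalIntegral.integral_mul_deriv_eq_deriv_mul (u := f) (v := fun x => w.eval x)
    (fun x _ => hf x) (fun x _ => w.hasDerivAt x) (hf'.intervalIntegrable _ _)
    (Continuous.intervalIntegrable (by fun_prop) _ _)]
  ring

/-- The boundary condition for the quantity whose flux is that of `u`. -/
def bcU : Flux → Boundary → ℝ → (ℝ → ℝ) → Prop
  | _, .periodic, _, f => f 0 = f (2 * Real.pi)
  | .minusPlus, .mixed g₀ _, s, f => f 0 = g₀ s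
  | .plusMinus, .mixed _ g₁, s, f => f (2 * Real.pi) = g₁ s

/-- The boundary condition for the quantity whose flux is that of `q`. -/
def bcQ : Flux → Boundary → ℝ → (ℝ → ℝ) → Prop
  | _, .periodic, _, f => f 0 = f (2 * Real.pi)
  | .minusPlus, .mixed _ g₁, s, f => f (2 * Real.pi) = g₁ s
  | .plusMinus, .mixed g₀ _, s, f => f 0 = g₀ s

/-- Because `P` interpolates `f` at the ends where this trace is taken, the exact value can stand
for the flux of `P`. At node 0 the boundary condition of `f` cancels the datum, which leaves a
homogeneous condition for the error. -/
theorem traceMinus_sub (bc : Boundary) (s : ℝ) {V P v : ℕ → Polynomial ℝ} {f : ℝ → ℝ}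
    (hV : ∀ j < M.N, V j = P j - v j)
    (hP : ∀ j < M.N, (P j).eval (M.x (j + 1)) = f (M.x (j + 1)))
    (hbc : match bc with
      | .periodic => f 0 = f (2 * Real.pi)
      | .mixed g₀ _ => f 0 = g₀ s) {i : ℕ} (hi : i ≤ M.N) :
    traceMinus M bc.homog 0 V i = f (M.x i) - traceMinus M bc s v i := by
  have hN := M.N_pos
  rcases i with _ | i
  · cases bc with
    | periodic =>
      have h1 := hP (M.N - 1) (by omega)
      rw [show M.N - 1 + 1 = M.N by omega, M.x_last] at h1
      simp only at hbc
      simp only [traceMinus, Boundary.homog, if_true, hV (M.N - 1) (by omega),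
        Polynomial.eval_sub, M.x_last, M.x_zero, h1, hbc]
    | mixed g₀ g₁ =>
      simp only at hbc
      simp [traceMinus, Boundary.homog, M.x_zero, hbc]
  · rw [traceMinus_succ, traceMinus_succ, hV i hi, Polynomial.eval_sub, hP i hi]

theorem tracePlus_sub (bc : Boundary) (s : ℝ) {V P v : ℕ → Polynomial ℝ} {f : ℝ → ℝ}
    (hV : ∀ j < M.N, V j = P j - v j)
    (hP : ∀ j < M.N, (P j).eval (M.x j) = f (M.x j))
    (hbc : match bc with
      | .periodic => f 0 = f (2 * Real.pi)
      | .mixed _ g₁ => f (2 * Real.pi) = g₁ s) {i : ℕ} (hi : i ≤ M.N) :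
    tracePlus M bc.homog 0 V i = f (M.x i) - tracePlus M bc s v i := by
  have hN := M.N_pos
  rcases hi.eq_or_lt with rfl | hi
  · cases bc with
    | periodic =>
      have h1 := hP 0 hN
      rw [M.x_zero] at h1
      simp only at hbc
      simp only [tracePlus, Boundary.homog, if_true, hV 0 hN, Polynomial.eval_sub, M.x_zero,
        M.x_last, h1, hbc]
    | mixed g₀ g₁ =>
      simp only at hbc
      simp [tracePlus, Boundary.homog, M.x_last, hbc]
  · rw [tracePlus_of_lt _ _ _ hi, tracePlus_of_lt _ _ _ hi, hV i hi, Polynomial.eval_sub, hP i hi]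

theorem uHat_sub (fl : Flux) (bc : Boundary) (s : ℝ) {V P v : ℕ → Polynomial ℝ} {f : ℝ → ℝ}
    (hV : ∀ j < M.N, V j = P j - v j)
    (hP : ∀ j < M.N, (P j).eval (fl.endU (M.x j) (M.x (j + 1))) =
      f (fl.endU (M.x j) (M.x (j + 1))))
    (hbc : bcU fl bc s f) {i : ℕ} (hi : i ≤ M.N) :
    uHat M bc.homog 0 V i fl = f (M.x i) - uHat M bc s v i fl := by
  cases fl
  · exact traceMinus_sub bc s hV hP (by cases bc <;> exact hbc) hi
  · exact tracePlus_sub bc s hV hP (by cases bc <;> exact hbc) hi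

theorem qHat_sub (fl : Flux) (bc : Boundary) (s : ℝ) {V P v : ℕ → Polynomial ℝ} {f : ℝ → ℝ}
    (hV : ∀ j < M.N, V j = P j - v j)
    (hP : ∀ j < M.N, (P j).eval (fl.endQ (M.x j) (M.x (j + 1))) =
      f (fl.endQ (M.x j) (M.x (j + 1))))
    (hbc : bcQ fl bc s f) {i : ℕ} (hi : i ≤ M.N) :
    qHat M bc.homog 0 V i fl = f (M.x i) - qHat M bc s v i fl := by
  cases fl
  · exact tracePlus_sub bc s hV hP (by cases bc <;> exact hbc) hi
  · exact traceMinus_sub bc s hV hP (by cases bc <;> exact hbc) hi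

/-- `hPQ` is the scheme's equation for q with exact fluxes. Subtracting the discrete equation leaves
the one with homogeneous fluxes, which characterises `grad`. -/
theorem grad_sub_eq (fl : Flux) (bc : Boundary) (s : ℝ) {f : ℝ → ℝ} (hbc : bcU fl bc s f)
    {P Q uh qh : ℕ → Polynomial ℝ}
    (hP : ∀ j < M.N, (P j).natDegree ≤ k) (hQ : ∀ j < M.N, (Q j).natDegree ≤ k)
    (huh : ∀ j < M.N, (uh j).natDegree ≤ k) (hqh : ∀ j < M.N, (qh j).natDegree ≤ k)
    (hPe : ∀ j < M.N, (P j).eval (fl.endU (M.x j) (M.x (j + 1))) =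
      f (fl.endU (M.x j) (M.x (j + 1))))
    (hPQ : ∀ j < M.N, ∀ w : Polynomial ℝ, w.natDegree ≤ k →
      (∫ x in M.x j..M.x (j + 1), (Q j).eval x * w.eval x) +
        (∫ x in M.x j..M.x (j + 1), (P j).eval x * (derivative w).eval x) =
        f (M.x (j + 1)) * w.eval (M.x (j + 1)) - f (M.x j) * w.eval (M.x j))
    (heq : ∀ j < M.N, ∀ w : Polynomial ℝ, w.natDegree ≤ k →
      ∫ x in M.x j..M.x (j + 1), (qh j).eval x * w.eval x =
        cellForm M (fun i => uHat M bc s uh i fl) (uh j) w j) :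
    grad fl bc (FE.ofPoly M k fun j => P j - uh j) = FE.ofPoly M k fun j => Q j - qh j := by
  have hPd : ∀ j < M.N, (P j - uh j).natDegree ≤ k := fun j hj =>
    Polynomial.natDegree_sub_le_iff_left (huh j hj) |>.2 (hP j hj)
  have hQd : ∀ j < M.N, (Q j - qh j).natDegree ≤ k := fun j hj =>
    Polynomial.natDegree_sub_le_iff_left (hqh j hj) |>.2 (hQ j hj)
  have hflux : ∀ i ≤ M.N, fluxU fl bc (FE.ofPoly M k fun j => P j - uh j) i =
      f (M.x i) - uHat M bc s uh i fl := fun i hi =>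
    uHat_sub fl bc s (fun j hj => FE.toPoly_ofPoly (P := fun j => P j - uh j) hj (hPd j hj))
      hPe hbc hi
  refine FE.ext_integral fun j hj w hw => ?_
  rw [integral_grad_mul fl bc _ hj hw, FE.toPoly_ofPoly (P := fun j => P j - uh j) hj (hPd j hj),
    FE.toPoly_ofPoly (P := fun j => Q j - qh j) hj (hQd j hj), integral_eval_mul_sub,
    heq j hj w hw, cellForm, cellForm, hflux _ hj, hflux _ hj.le, integral_eval_mul_sub]
  linarith [hPQ j hj w hw]

/-- In the application, `P` is the projection of u_t and `W` the time derivative of the correction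
of u. Only `P` satisfies the exact relation `hPQ`, so `W` survives as the source term. The form of
the equation for u becomes an inner product with `grad` by `sum_cellForm_fluxQ`. -/
theorem inner_sub_eq (fl : Flux) (bc : Boundary) (s : ℝ) {f : ℝ → ℝ} (hbc : bcQ fl bc s f)
    {P W Q ut qh : ℕ → Polynomial ℝ}
    (hP : ∀ j < M.N, (P j).natDegree ≤ k) (hW : ∀ j < M.N, (W j).natDegree ≤ k)
    (hQ : ∀ j < M.N, (Q j).natDegree ≤ k)
    (hut : ∀ j < M.N, (ut j).natDegree ≤ k) (hqh : ∀ j < M.N, (qh j).natDegree ≤ k)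
    (hQe : ∀ j < M.N, (Q j).eval (fl.endQ (M.x j) (M.x (j + 1))) =
      f (fl.endQ (M.x j) (M.x (j + 1))))
    (hPQ : ∀ j < M.N, ∀ w : Polynomial ℝ, w.natDegree ≤ k →
      (∫ x in M.x j..M.x (j + 1), (P j).eval x * w.eval x) +
        (∫ x in M.x j..M.x (j + 1), (Q j).eval x * (derivative w).eval x) =
        f (M.x (j + 1)) * w.eval (M.x (j + 1)) - f (M.x j) * w.eval (M.x j))
    (heq : ∀ j < M.N, ∀ w : Polynomial ℝ, w.natDegree ≤ k →
      ∫ x in M.x j..M.x (j + 1), (ut j).eval x * w.eval x =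
        cellForm M (fun i => qHat M bc s qh i fl) (qh j) w j) (v : FE M k) :
    inner ℝ (FE.ofPoly M k fun j => P j - W j - ut j) v =
      -inner ℝ (FE.ofPoly M k fun j => Q j - qh j) (grad fl bc v) -
        inner ℝ (FE.ofPoly M k W) v := by
  have hQd : ∀ j < M.N, (Q j - qh j).natDegree ≤ k := fun j hj =>
    Polynomial.natDegree_sub_le_iff_left (hqh j hj) |>.2 (hQ j hj)
  have hPd : ∀ j < M.N, (P j - W j - ut j).natDegree ≤ k := fun j hj =>
    Polynomial.natDegree_sub_le_iff_left (hut j hj) |>.2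
      (Polynomial.natDegree_sub_le_iff_left (hW j hj) |>.2 (hP j hj))
  have hflux : ∀ i ≤ M.N, fluxQ fl bc (FE.ofPoly M k fun j => Q j - qh j) i =
      f (M.x i) - qHat M bc s qh i fl := fun i hi =>
    qHat_sub fl bc s (fun j hj => FE.toPoly_ofPoly (P := fun j => Q j - qh j) hj (hQd j hj))
      hQe hbc hi
  rw [real_inner_comm (grad fl bc v), inner_grad, ← sum_cellForm_fluxQ, FE.inner_eq, FE.inner_eq,
    ← Finset.sum_sub_distrib]
  refine Finset.sum_congr rfl fun j hj => ?_
  have hj := Finset.mem_range.1 hj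
  have hw := v.toPoly_natDegree_le j
  rw [FE.toPoly_ofPoly (P := fun j => P j - W j - ut j) hj (hPd j hj),
    FE.toPoly_ofPoly (P := fun j => Q j - qh j) hj (hQd j hj),
    FE.toPoly_ofPoly hj (hW j hj), integral_eval_mul_sub, integral_eval_mul_sub, heq j hj _ hw,
    cellForm, cellForm, hflux _ hj, hflux _ hj.le, integral_eval_mul_sub]
  linarith [hPQ j hj _ hw]

theorem famProjU_sub_eval (hk : 2 ≤ k) (fl : Flux) {D : ℕ → ℝ → ℝ} (hD : Continuous (D 0)) {j : ℕ}
    (hj : j < M.N) :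
    (famProjU k M fl D j - famWU k M fl D j).eval (fl.endU (M.x j) (M.x (j + 1))) =
      D 0 (fl.endU (M.x j) (M.x (j + 1))) := by
  have hlt := M.x_lt j hj
  rw [Polynomial.eval_sub, famWU, cellWu_eval_end hlt hk (fl.isEndU _ _) (fl.isEndQ _ _),
    sub_zero, famProjU, (isRadau_radau hlt (fl.isEndU _ _) hD.continuousOn).interp]

theorem famProjQ_sub_eval (hk : 2 ≤ k) (fl : Flux) {D : ℕ → ℝ → ℝ} (hD : Continuous (D 1)) {j : ℕ}
    (hj : j < M.N) :
    (famProjQ k M fl D j - famWQ k M fl D j).eval (fl.endQ (M.x j) (M.x (j + 1))) =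
      D 1 (fl.endQ (M.x j) (M.x (j + 1))) := by
  have hlt := M.x_lt j hj
  rw [Polynomial.eval_sub, famWQ, cellWq_eval_end hlt hk (fl.isEndQ _ _),
    sub_zero, famProjQ, (isRadau_radau hlt (fl.isEndQ _ _) hD.continuousOn).interp]

theorem fam_consistency_q (hk : 2 ≤ k) (fl : Flux) {D : ℕ → ℝ → ℝ}
    (h0 : Continuous (D 0)) (h1 : Continuous (D 1)) (hd : ∀ x, HasDerivAt (D 0) (D 1 x) x)
    {j : ℕ} (hj : j < M.N) {w : Polynomial ℝ} (hw : w.natDegree ≤ k) :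
    (∫ x in M.x j..M.x (j + 1), (famProjQ k M fl D j - famWQ k M fl D j).eval x * w.eval x) +
      (∫ x in M.x j..M.x (j + 1),
        (famProjU k M fl D j - famWU k M fl D j).eval x * (derivative w).eval x) =
      D 0 (M.x (j + 1)) * w.eval (M.x (j + 1)) - D 0 (M.x j) * w.eval (M.x j) := by
  rw [← integral_deriv_mul_eval hd h1]
  exact cell_consistency_q (M.x_lt j hj) hk (fl.isEndU _ _) (fl.isEndQ _ _) h0.continuousOn
    h1.continuousOn _ w hw

/-- As u_t = u_xx, the shifted family `fun i => D (i + 2)` belongs to u_t. The residual coefficient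
of its projection is the coefficient of `D 2`, that is, `famAlpha` of `D`, which is the one in
`famWQ`. -/
theorem fam_consistency_u (hk : 2 ≤ k) (fl : Flux) {D : ℕ → ℝ → ℝ}
    (h1 : Continuous (D 1)) (h2 : Continuous (D 2)) (hd : ∀ x, HasDerivAt (D 1) (D 2 x) x)
    {j : ℕ} (hj : j < M.N) {w : Polynomial ℝ} (hw : w.natDegree ≤ k) :
    (∫ x in M.x j..M.x (j + 1), (famProjU k M fl (fun i => D (i + 2)) j).eval x * w.eval x) +
      (∫ x in M.x j..M.x (j + 1),
        (famProjQ k M fl D j - famWQ k M fl D j).eval x * (derivative w).eval x) =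
      D 1 (M.x (j + 1)) * w.eval (M.x (j + 1)) - D 1 (M.x j) * w.eval (M.x j) := by
  rw [← integral_deriv_mul_eval hd h2]
  exact cell_consistency_u (M.x_lt j hj) hk (fl.isEndU _ _) (fl.isEndQ _ _) h2.continuousOn
    h1.continuousOn w hw

/-- The error of the corrected projections satisfies the equation for `q` exactly. -/
theorem grad_error_eq (hk : 2 ≤ k) (fl : Flux) (bc : Boundary) (s : ℝ) {D : ℕ → ℝ → ℝ}
    (hc : ∀ i, Continuous (D i)) (hd : ∀ x, HasDerivAt (D 0) (D 1 x) x)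
    (hbc : bcU fl bc s (D 0)) {uh qh : ℕ → Polynomial ℝ}
    (huh : ∀ j < M.N, (uh j).natDegree ≤ k) (hqh : ∀ j < M.N, (qh j).natDegree ≤ k)
    (heq : ∀ j < M.N, ∀ w : Polynomial ℝ, w.natDegree ≤ k →
      ∫ x in M.x j..M.x (j + 1), (qh j).eval x * w.eval x =
        cellForm M (fun i => uHat M bc s uh i fl) (uh j) w j) :
    grad fl bc (FE.ofPoly M k fun j => famProjU k M fl D j - famWU k M fl D j - uh j) =
      FE.ofPoly M k fun j => famProjQ k M fl D j - famWQ k M fl D j - qh j :=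
  grad_sub_eq (P := fun j => famProjU k M fl D j - famWU k M fl D j)
    (Q := fun j => famProjQ k M fl D j - famWQ k M fl D j) fl bc s hbc
    (fun _ hj => (Polynomial.natDegree_sub_le_iff_left (famWU_natDegree_le fl D hj)).2
      (famProjU_natDegree_le fl (hc 0) hj))
    (fun _ hj => (Polynomial.natDegree_sub_le_iff_left (famWQ_natDegree_le fl D hj)).2
      (famProjQ_natDegree_le fl (hc 1) hj)) huh hqh
    (fun _ hj => famProjU_sub_eval hk fl (hc 0) hj)
    (fun _ hj _ hw => fam_consistency_q hk fl (hc 0) (hc 1) hd hj hw) heq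

/-- The equation for `u` of the error of the corrected projections. -/
theorem inner_error_eq (hk : 2 ≤ k) (fl : Flux) (bc : Boundary) (s : ℝ) {D : ℕ → ℝ → ℝ}
    (hc : ∀ i, Continuous (D i)) (hd : ∀ x, HasDerivAt (D 1) (D 2 x) x)
    (hbc : bcQ fl bc s (D 1)) {ut qh : ℕ → Polynomial ℝ}
    (hut : ∀ j < M.N, (ut j).natDegree ≤ k) (hqh : ∀ j < M.N, (qh j).natDegree ≤ k)
    (heq : ∀ j < M.N, ∀ w : Polynomial ℝ, w.natDegree ≤ k →
      ∫ x in M.x j..M.x (j + 1), (ut j).eval x * w.eval x =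
        cellForm M (fun i => qHat M bc s qh i fl) (qh j) w j) (v : FE M k) :
    inner ℝ (FE.ofPoly M k fun j => famProjU k M fl (fun i => D (i + 2)) j -
        famWU k M fl (fun i => D (i + 2)) j - ut j) v =
      -inner ℝ (FE.ofPoly M k fun j => famProjQ k M fl D j - famWQ k M fl D j - qh j)
          (grad fl bc v) -
        inner ℝ (FE.ofPoly M k fun j => famWU k M fl (fun i => D (i + 2)) j) v :=
  inner_sub_eq (P := famProjU k M fl fun i => D (i + 2)) (W := famWU k M fl fun i => D (i + 2))
    (Q := fun j => famProjQ k M fl D j - famWQ k M fl D j) fl bc s hbc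
    (fun _ hj => famProjU_natDegree_le (D := fun i => D (i + 2)) fl (hc 2) hj)
    (fun _ hj => famWU_natDegree_le fl _ hj)
    (fun _ hj => (Polynomial.natDegree_sub_le_iff_left (famWQ_natDegree_le fl D hj)).2
      (famProjQ_natDegree_le fl (hc 1) hj)) hut hqh
    (fun _ hj => famProjQ_sub_eval hk fl (hc 1) hj)
    (fun _ hj _ hw => fam_consistency_u hk fl (hc 1) (hc 2) hd hj hw) heq v

/-! ## Bounds for the correction functions -/

theorem Mesh.len_le_h (M : Mesh) {j : ℕ} (hj : j < M.N) : M.len j ≤ M.h :=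
  le_ciSup (f := fun j : Fin M.N => M.len j) (Set.finite_range _).bddAbove ⟨j, hj⟩

theorem Mesh.h_pos (M : Mesh) : 0 < M.h :=
  (sub_pos.2 (M.x_lt 0 M.N_pos)).trans_le (M.len_le_h M.N_pos)

theorem Mesh.x_mem (M : Mesh) {i : ℕ} (hi : i ≤ M.N) : M.x i ∈ Icc 0 (2 * Real.pi) := by
  have hmono : ∀ i l, i ≤ l → l ≤ M.N → M.x i ≤ M.x l := fun i l hil => by
    induction l, hil using Nat.le_induction with
    | base => intro _; exact le_rfl
    | succ l _ ih => intro hl; exact (ih (by omega)).trans (M.x_lt l (by omega)).le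
  have h1 := hmono 0 i i.zero_le hi
  have h2 := hmono i M.N hi le_rfl
  rw [M.x_zero] at h1
  rw [M.x_last] at h2
  exact ⟨h1, h2⟩

/-- In `famWU` the coefficient `famAlpha` carries the square of the cell length, so h ^ k suffices
for it. This weaker requirement matters for the time derivative of the correction. In `famWQ` it
carries one power only. -/
theorem exists_correction_bound (k : ℕ) :
    ∃ A : ℝ, 0 ≤ A ∧ ∀ (M : Mesh) (fl : Flux) (D : ℕ → ℝ → ℝ) (K h : ℝ), 0 ≤ K → h ≤ 7 →
      ∀ j < M.N, M.len j ≤ h →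
      (|famAlpha k M fl D j| ≤ K * h ^ k → |famBeta k M fl D j| ≤ K * h ^ (k + 1) →
        ∀ x ∈ Icc (M.x j) (M.x (j + 1)), |(famWU k M fl D j).eval x| ≤ A * (K * h ^ (k + 2))) ∧
      (|famAlpha k M fl D j| ≤ K * h ^ (k + 1) →
        ∀ x ∈ Icc (M.x j) (M.x (j + 1)), |(famWQ k M fl D j).eval x| ≤ A * (K * h ^ (k + 2))) := by
  obtain ⟨A, hA1, hA⟩ := exists_corr_bound k
  have hA0 : 0 ≤ A := by linarith
  refine ⟨A, hA0, fun M fl D K h hK _ j hj hlen => ?_⟩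
  have hlt := M.x_lt j hj
  obtain ⟨c1, c2⟩ := hA _ _ _ _ _ _ hlt (fl.isEndU (M.x j) (M.x (j + 1)))
    (fl.isEndQ (M.x j) (M.x (j + 1)))
  obtain ⟨c3, -⟩ := hA _ _ _ _ _ _ hlt (fl.isEndQ (M.x j) (M.x (j + 1)))
    (fl.isEndQ (M.x j) (M.x (j + 1)))
  have h0 : 0 ≤ M.x (j + 1) - M.x j := sub_nonneg.2 hlt.le
  have hh0 : 0 ≤ h := h0.trans hlen
  have hhalf : (M.x (j + 1) - M.x j) / 2 ≤ h / 2 := by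
    have : M.x (j + 1) - M.x j ≤ h := hlen
    linarith
  refine ⟨fun hα hβ x hx => ?_, fun hα x hx => ?_⟩
  · rw [famWU, cellWu, Polynomial.eval_add, Polynomial.eval_mul, Polynomial.eval_mul,
      Polynomial.eval_C, Polynomial.eval_C]
    refine (abs_add_le _ _).trans ?_
    rw [abs_mul, abs_mul, abs_mul, abs_mul, abs_of_nonneg (by positivity : (0 : ℝ) ≤
      ((M.x (j + 1) - M.x j) / 2) ^ 2), abs_of_nonneg (by positivity : (0 : ℝ) ≤
      (M.x (j + 1) - M.x j) / 2)]
    have e1 : ((M.x (j + 1) - M.x j) / 2) ^ 2 * |famAlpha k M fl D j| *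
        |(corrBar k (M.x j) (M.x (j + 1)) (fl.endU (M.x j) (M.x (j + 1)))
          (fl.endQ (M.x j) (M.x (j + 1)))).eval x| ≤ (h / 2) ^ 2 * (K * h ^ k) * A := by
      gcongr
      exact c2 x hx
    have e2 : (M.x (j + 1) - M.x j) / 2 * |famBeta k M fl D j| *
        |(corr k (M.x j) (M.x (j + 1)) (fl.endU (M.x j) (M.x (j + 1)))).eval x| ≤
        h / 2 * (K * h ^ (k + 1)) * A := by
      gcongr
      exact c1 x hx
    refine (add_le_add e1 e2).trans ?_
    have : 0 ≤ A * (K * h ^ (k + 2)) := by positivity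
    calc _ = 3 / 4 * (A * (K * h ^ (k + 2))) := by ring
      _ ≤ _ := by linarith
  · rw [famWQ, cellWq, Polynomial.eval_mul, Polynomial.eval_C]
    rw [abs_mul, abs_mul, abs_of_nonneg (by positivity : (0 : ℝ) ≤ (M.x (j + 1) - M.x j) / 2)]
    have e2 : (M.x (j + 1) - M.x j) / 2 * |famAlpha k M fl D j| *
        |(corr k (M.x j) (M.x (j + 1)) (fl.endQ (M.x j) (M.x (j + 1)))).eval x| ≤
        h / 2 * (K * h ^ (k + 1)) * A := by
      gcongr
      exact c3 x hx
    refine e2.trans ?_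
    have : 0 ≤ A * (K * h ^ (k + 2)) := by positivity
    calc _ = 1 / 2 * (A * (K * h ^ (k + 2))) := by ring
      _ ≤ _ := by linarith

end

noncomputable section

/-! ## The projections of the exact solution -/

theorem IsRadau.congr {k : ℕ} {a b e : ℝ} (hab : a ≤ b) (he : e ∈ Icc a b) {v w : ℝ → ℝ}
    (h : EqOn v w (Icc a b)) {p : Polynomial ℝ} (hp : IsRadau k a b e v p) :
    IsRadau k a b e w p where
  natDegree_le := hp.natDegree_le
  moments r hr := by
    rw [hp.moments r hr]
    refine intervalIntegral.integral_congr fun x hx => ?_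
    rw [uIcc_of_le hab] at hx
    simp only [h hx]
  interp := by rw [hp.interp, h he]

open Classical in
theorem radau_congr {k : ℕ} {a b e : ℝ} (hab : a ≤ b) (he : e ∈ Icc a b) {v w : ℝ → ℝ}
    (h : EqOn v w (Icc a b)) : radau k a b e v = radau k a b e w := by
  have : IsRadau k a b e v = IsRadau k a b e w :=
    funext fun p => propext ⟨fun hp => hp.congr hab he h, fun hp => hp.congr hab he h.symm⟩
  exact congrArg (fun Q : Polynomial ℝ → Prop => if h : ∃ p, Q p then h.choose else 0) this

theorem coefAt_congr {k : ℕ} {a b e ε : ℝ} (hab : a ≤ b) (he : e ∈ Icc a b) {v w : ℝ → ℝ}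
    (h : EqOn v w (Icc a b)) : coefAt k a b e ε v = coefAt k a b e ε w := by
  have hl : ∀ m, legCoef a b v m = legCoef a b w m := fun m => by
    rw [legCoef, legCoef]
    congr 1
    refine intervalIntegral.integral_congr fun x hx => ?_
    rw [uIcc_of_le hab] at hx
    simp only [h hx]
  simp only [coefAt, hl, h he]

theorem coefMinus_eq_of_eqOn {k : ℕ} {a b : ℝ} (hab : a < b) {v w : ℝ → ℝ}
    (hw : Continuous w) (h : EqOn v w (Icc a b)) : coefMinus k a b v = coefAt k a b b 1 w := by
  rw [coefMinus_eq hab (hw.continuousOn.congr h)]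
  exact coefAt_congr hab.le (right_mem_Icc.2 hab.le) h

theorem coefPlus_eq_of_eqOn {k : ℕ} {a b : ℝ} (hab : a < b) {v w : ℝ → ℝ}
    (hw : Continuous w) (h : EqOn v w (Icc a b)) : coefPlus k a b v = coefAt k a b a (-1) w := by
  rw [coefPlus_eq hab (hw.continuousOn.congr h)]
  exact coefAt_congr hab.le (left_mem_Icc.2 hab.le) h

variable {M : Mesh} {k : ℕ}

theorem Mesh.cell_subset (M : Mesh) {j : ℕ} (hj : j < M.N) :
    Icc (M.x j) (M.x (j + 1)) ⊆ Icc 0 (2 * Real.pi) :=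
  Icc_subset_Icc (M.x_mem hj.le).1 (M.x_mem hj).2

namespace IsDerivFamily

variable {T : ℝ} {n : ℕ} {u : ℝ → ℝ → ℝ} {D : ℝ → ℕ → ℝ → ℝ}

theorem projU_eq (hD : IsDerivFamily T n u D) {t : ℝ} (ht : t ∈ Icc 0 T) (fl : Flux) {j : ℕ}
    (hj : j < M.N) : projU k M u t j fl = famProjU k M fl (D t) j := by
  have hlt := M.x_lt j hj
  have h : EqOn (fun x => u x t) (D t 0) (Icc (M.x j) (M.x (j + 1))) := fun x hx =>
    (hD.eq t ht x (M.cell_subset hj hx)).symm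
  cases fl
  · exact radau_congr hlt.le (right_mem_Icc.2 hlt.le) h
  · exact radau_congr hlt.le (left_mem_Icc.2 hlt.le) h

theorem projQ_eq (hD : IsDerivFamily T n u D) (hn : 0 < n) {t : ℝ} (ht : t ∈ Icc 0 T) (fl : Flux)
    {j : ℕ} (hj : j < M.N) : projQ k M u t j fl = famProjQ k M fl (D t) j := by
  have hlt := M.x_lt j hj
  have h : EqOn (fun x => dx u x t) (D t 1) (Icc (M.x j) (M.x (j + 1))) := fun x hx =>
    hD.dx_eq hn (M.cell_subset hj hx) ht
  cases fl
  · exact radau_congr hlt.le (left_mem_Icc.2 hlt.le) h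
  · exact radau_congr hlt.le (right_mem_Icc.2 hlt.le) h

/-- The correction in the initial value contains the time derivative of the coefficient of u;
differentiating under the integral and using the heat equation, it is the coefficient of the second
space derivative. -/
theorem correctionU_eq (hT : 0 < T) (hD : IsDerivFamily T n u D) (hu : IsHeatSolution T u) {K : ℝ}
    (hK : ∀ t ∈ Icc 0 T, (sobolevNorm (n + 1) fun x => u x t).toReal ≤ K) (hn : 2 ≤ n)
    {t : ℝ} (ht : t ∈ Icc 0 T) (fl : Flux) {j : ℕ} (hj : j < M.N) :
    correctionU k T u (M.x j) (M.x (j + 1)) t fl = famWU k M fl (D t) j := by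
  have hlt := M.x_lt j hj
  have ha := (M.x_mem hj.le).1
  have hb := (M.x_mem hj).2
  have h0 : ∀ s ∈ Icc 0 T, EqOn (fun x => u x s) (D s 0) (Icc (M.x j) (M.x (j + 1))) :=
    fun s hs x hx => (hD.eq s hs x (M.cell_subset hj hx)).symm
  have h1 : EqOn (fun x => dx u x t) (D t 1) (Icc (M.x j) (M.x (j + 1))) := fun x hx =>
    hD.dx_eq (by omega) (M.cell_subset hj hx) ht
  have hd := uniqueDiffOn_Icc hT t ht
  cases fl
  · have h2 : HasDerivWithinAt (fun s => coefMinus k (M.x j) (M.x (j + 1)) fun x => u x s)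
        (coefAt k (M.x j) (M.x (j + 1)) (M.x (j + 1)) 1 (D t 2)) (Icc 0 T) t :=
      (hD.hasDerivWithinAt_coefAt (i := 0) hT hu hK hn hlt ha hb
        (Flux.minusPlus.isEndU _ _) ht k).congr
        (fun s hs => coefMinus_eq_of_eqOn hlt (hD.cont s hs 0) (h0 s hs))
        (coefMinus_eq_of_eqOn hlt (hD.cont t ht 0) (h0 t ht))
    rw [correctionU, h2.derivWithin hd, coefPlus_eq_of_eqOn hlt (hD.cont t ht 1) h1]
    rfl
  · have h2 : HasDerivWithinAt (fun s => coefPlus k (M.x j) (M.x (j + 1)) fun x => u x s)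
        (coefAt k (M.x j) (M.x (j + 1)) (M.x j) (-1) (D t 2)) (Icc 0 T) t :=
      (hD.hasDerivWithinAt_coefAt (i := 0) hT hu hK hn hlt ha hb
        (Flux.plusMinus.isEndU _ _) ht k).congr
        (fun s hs => coefPlus_eq_of_eqOn hlt (hD.cont s hs 0) (h0 s hs))
        (coefPlus_eq_of_eqOn hlt (hD.cont t ht 0) (h0 t ht))
    rw [correctionU, h2.derivWithin hd, coefMinus_eq_of_eqOn hlt (hD.cont t ht 1) h1, famWU,
      famAlpha, famBeta, Flux.sgn, neg_neg, add_comm]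
    rfl

theorem bcU (hD : IsDerivFamily T n u D) {fl : Flux} {bc : Boundary}
    (h : SatisfiesBC T u fl bc) {t : ℝ} (ht : t ∈ Icc 0 T) : bcU fl bc t (D t 0) := by
  have h0 := hD.eq t ht 0 (left_mem_Icc.2 Real.two_pi_pos.le)
  have h1 := hD.eq t ht _ (right_mem_Icc.2 Real.two_pi_pos.le)
  cases fl <;> cases bc <;> have h2 := h t ht
  · exact h0.trans (h2.1.trans h1.symm)
  · exact h0.trans h2.1
  · exact h0.trans (h2.1.trans h1.symm)
  · exact h1.trans h2.2

theorem bcQ (hD : IsDerivFamily T n u D) (hn : 0 < n) {fl : Flux} {bc : Boundary}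
    (h : SatisfiesBC T u fl bc) {t : ℝ} (ht : t ∈ Icc 0 T) : bcQ fl bc t (D t 1) := by
  have h0 := hD.dx_eq hn (left_mem_Icc.2 Real.two_pi_pos.le) ht
  have h1 := hD.dx_eq hn (right_mem_Icc.2 Real.two_pi_pos.le) ht
  cases fl <;> cases bc <;> have h2 := h t ht
  · exact h0.symm.trans (h2.2.trans h1)
  · exact h1.symm.trans h2.2
  · exact h0.symm.trans (h2.2.trans h1)
  · exact h0.symm.trans h2.1

theorem hasDerivWithinAt_coeff_famProjU (hT : 0 < T) (hD : IsDerivFamily T n u D)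
    (hu : IsHeatSolution T u) {K : ℝ}
    (hK : ∀ t ∈ Icc 0 T, (sobolevNorm (n + 1) fun x => u x t).toReal ≤ K) (hn : 2 ≤ n)
    {t : ℝ} (ht : t ∈ Icc 0 T) (fl : Flux) {j : ℕ} (hj : j < M.N) (m : ℕ) :
    HasDerivWithinAt (fun s => (famProjU k M fl (D s) j).coeff m)
      ((famProjU k M fl (fun i => D t (i + 2)) j).coeff m) (Icc 0 T) t :=
  hD.hasDerivWithinAt_coeff_radau (i := 0) hT hu hK hn (M.x_lt j hj) (M.x_mem hj.le).1
    (M.x_mem hj).2 (fl.isEndU _ _) ht k m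

/-- The leading coefficient of the correction already involves `D 2`, so its time derivative reaches
`D 4`. -/
theorem hasDerivWithinAt_coeff_famWU (hT : 0 < T) (hD : IsDerivFamily T n u D)
    (hu : IsHeatSolution T u) {K : ℝ}
    (hK : ∀ t ∈ Icc 0 T, (sobolevNorm (n + 1) fun x => u x t).toReal ≤ K) (hn : 4 ≤ n)
    {t : ℝ} (ht : t ∈ Icc 0 T) (fl : Flux) {j : ℕ} (hj : j < M.N) (m : ℕ) :
    HasDerivWithinAt (fun s => (famWU k M fl (D s) j).coeff m)
      ((famWU k M fl (fun i => D t (i + 2)) j).coeff m) (Icc 0 T) t := by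
  have hα := hD.hasDerivWithinAt_coefAt (i := 2) hT hu hK hn (M.x_lt j hj) (M.x_mem hj.le).1
    (M.x_mem hj).2 (fl.isEndU _ _) ht k
  have hβ := hD.hasDerivWithinAt_coefAt (i := 1) hT hu hK (by omega) (M.x_lt j hj)
    (M.x_mem hj.le).1 (M.x_mem hj).2 (fl.isEndQ _ _) ht k
  simp only [famWU, cellWu, Polynomial.coeff_add, Polynomial.coeff_C_mul]
  exact ((hα.const_mul _).mul_const _).add ((hβ.const_mul _).mul_const _)

end IsDerivFamily

/-! ## The time derivative of the numerical solution -/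

/-- The polynomial whose coefficients are the time derivatives of those of `p`. -/
def timeDeriv (k : ℕ) (T : ℝ) (p : ℝ → Polynomial ℝ) (t : ℝ) : Polynomial ℝ :=
  ∑ m ∈ Finset.range (k + 1),
    Polynomial.monomial m (derivWithin (fun s => (p s).coeff m) (Icc 0 T) t)

theorem timeDeriv_natDegree_le (k : ℕ) (T : ℝ) (p : ℝ → Polynomial ℝ) (t : ℝ) :
    (timeDeriv k T p t).natDegree ≤ k :=
  Polynomial.natDegree_sum_le_of_forall_le _ _ fun _ hm =>
    (Polynomial.natDegree_monomial_le _).trans (Nat.lt_succ_iff.1 (Finset.mem_range.1 hm))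

theorem timeDeriv_coeff {T : ℝ} (p : ℝ → Polynomial ℝ) (t : ℝ) {m : ℕ} (hm : m < k + 1) :
    (timeDeriv k T p t).coeff m = derivWithin (fun s => (p s).coeff m) (Icc 0 T) t := by
  rw [timeDeriv, Polynomial.finsetSum_coeff, Finset.sum_eq_single m]
  · simp
  · intro l _ hl
    rw [Polynomial.coeff_monomial, if_neg hl]
  · intro h
    exact absurd (Finset.mem_range.2 hm) h

theorem derivWithin_eval {T : ℝ} (hT : 0 < T) {p : ℝ → Polynomial ℝ}
    (hp : ∀ t ∈ Icc 0 T, (p t).natDegree ≤ k)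
    (hd : ∀ m, DifferentiableOn ℝ (fun t => (p t).coeff m) (Icc 0 T)) {t : ℝ} (ht : t ∈ Icc 0 T)
    (x : ℝ) : derivWithin (fun s => (p s).eval x) (Icc 0 T) t = (timeDeriv k T p t).eval x := by
  have h1 : HasDerivWithinAt (fun s => ∑ m ∈ Finset.range (k + 1), (p s).coeff m * x ^ m)
      (∑ m ∈ Finset.range (k + 1), derivWithin (fun s => (p s).coeff m) (Icc 0 T) t * x ^ m)
      (Icc 0 T) t :=
    HasDerivWithinAt.fun_sum fun m _ => ((hd m t ht).hasDerivWithinAt).mul_const _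
  have h2 := h1.congr (f₁ := fun s => (p s).eval x)
    (fun s hs => Polynomial.eval_eq_sum_range' (Nat.lt_succ_of_le (hp s hs)) x)
    (Polynomial.eval_eq_sum_range' (Nat.lt_succ_of_le (hp t ht)) x)
  rw [h2.derivWithin (uniqueDiffOn_Icc hT t ht), timeDeriv, Polynomial.eval_finsetSum]
  simp

/-! ## Norms of the correction functions -/

theorem Mesh.h_le (M : Mesh) : M.h ≤ 7 := by
  have : Nonempty (Fin M.N) := ⟨⟨0, M.N_pos⟩⟩
  refine (ciSup_le fun j : Fin M.N => M.len_le j.2).trans ?_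
  linarith [Real.pi_lt_d2]

/-- With `D (k + 3)` Lipschitz continuous, the coefficient of `D i` is O(h^{l+1}) whenever l ≤ k and
i + l ≤ k + 3. For i ≤ 3 this gives the full order k + 1; for i = 4 one order is lost, which the
extra cell length in front of that coefficient makes up for. -/
theorem exists_norm_correction_bound (hk : 1 ≤ k) :
    ∃ B : ℝ, 0 ≤ B ∧ ∀ (M : Mesh) (fl : Flux) (D : ℕ → ℝ → ℝ) (K : ℝ), 0 ≤ K →
      (∀ i, Continuous (D i)) → (∀ i < k + 3, ∀ x, HasDerivAt (D i) (D (i + 1) x) x) →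
      (∀ i ≤ k + 3, ∀ x ∈ Icc 0 (2 * Real.pi), ∀ y ∈ Icc 0 (2 * Real.pi),
        |D i x - D i y| ≤ K * |x - y|) →
      ‖FE.ofPoly M k (famWU k M fl D)‖ ≤ B * (K * M.h ^ (k + 2)) ∧
      ‖FE.ofPoly M k (famWU k M fl fun i => D (i + 2))‖ ≤ B * (K * M.h ^ (k + 2)) ∧
      ‖FE.ofPoly M k (famWQ k M fl D)‖ ≤ B * (K * M.h ^ (k + 2)) := by
  obtain ⟨A, hA0, hA⟩ := exists_correction_bound k
  obtain ⟨A₁, hA1, hcoef⟩ := exists_coefAt_bound k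
  -- The factor 3 comes from `FE.norm_ofPoly_le`. The 7 is a bound for h, used to weaken h^{k+1} to
  -- h^k where the full order is available.
  refine ⟨3 * (A * (7 * A₁)), by positivity, fun M fl D K hK hc hd hl => ?_⟩
  have hh := M.h_pos
  have hK' : 0 ≤ 7 * A₁ * K := by positivity
  have hb : ∀ i l, l ≤ k → i + l ≤ k + 3 → ∀ j < M.N, ∀ e ε,
      IsEnd (M.x j) (M.x (j + 1)) e ε →
      |coefAt k (M.x j) (M.x (j + 1)) e ε (D i)| ≤ A₁ * K * M.h ^ (l + 1) := by
    intro i l hlk hil j hj e ε he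
    refine (hcoef _ _ _ _ (M.x_lt j hj) he l hlk (fun m => D (i + m)) K (hc _)
      (fun m hm x => hd (i + m) (by omega) x) fun x hx y hy =>
        hl (i + l) hil x (M.cell_subset hj hx) y (M.cell_subset hj hy)).trans ?_
    have h0 : 0 ≤ M.x (j + 1) - M.x j := sub_nonneg.2 (M.x_lt j hj).le
    have h1 : M.x (j + 1) - M.x j ≤ M.h := M.len_le_h hj
    rw [mul_assoc]
    gcongr
  have hb' : ∀ i, i ≤ 3 → ∀ j < M.N, ∀ e ε, IsEnd (M.x j) (M.x (j + 1)) e ε →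
      |coefAt k (M.x j) (M.x (j + 1)) e ε (D i)| ≤ 7 * A₁ * K * M.h ^ (k + 1) := by
    intro i hi j hj e ε he
    refine (hb i k le_rfl (by omega) j hj e ε he).trans ?_
    have : 0 ≤ A₁ * K * M.h ^ (k + 1) := by positivity
    linarith
  have hS : ∀ P : ℕ → Polynomial ℝ, (∀ j < M.N, (P j).natDegree ≤ k) →
      (∀ j < M.N, ∀ x ∈ Icc (M.x j) (M.x (j + 1)),
        |(P j).eval x| ≤ A * (7 * A₁ * K * M.h ^ (k + 2))) →
      ‖FE.ofPoly M k P‖ ≤ 3 * (A * (7 * A₁)) * (K * M.h ^ (k + 2)) := fun P hP hPb =>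
    (FE.norm_ofPoly_le hP (by positivity) hPb).trans_eq (by ring)
  refine ⟨hS _ (fun j hj => famWU_natDegree_le fl _ hj) fun j hj => ?_,
    hS _ (fun j hj => famWU_natDegree_le fl _ hj) fun j hj => ?_,
    hS _ (fun j hj => famWQ_natDegree_le fl _ hj) fun j hj => ?_⟩
  · refine (hA M fl D _ M.h hK' M.h_le j hj (M.len_le_h hj)).1 ?_
      (hb' 1 (by norm_num) j hj _ _ (fl.isEndQ _ _))
    refine (hb 2 k le_rfl (by omega) j hj _ _ (fl.isEndU _ _)).trans ?_
    have : 0 ≤ A₁ * K * M.h ^ k := by positivity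
    rw [pow_succ]
    nlinarith [M.h_le]
  · refine (hA M fl (fun i => D (i + 2)) _ M.h hK' M.h_le j hj (M.len_le_h hj)).1 ?_
      (hb' 3 le_rfl j hj _ _ (fl.isEndQ _ _))
    -- Only k - 1 derivatives of `D 4` can be used, which yields h ^ k.
    have h1 := hb 4 (k - 1) (by omega) (by omega) j hj _ _ (fl.isEndU _ _)
    rw [Nat.sub_add_cancel hk] at h1
    refine h1.trans ?_
    have : 0 ≤ A₁ * K * M.h ^ k := by positivity
    linarith
  · exact (hA M fl D _ M.h hK' M.h_le j hj (M.len_le_h hj)).2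
      (hb' 2 (by norm_num) j hj _ _ (fl.isEndU _ _))

/-! ## The error estimate -/

/-- The errors split as ξ_u = z + W_u and ξ_q = G z + W_q. The bound `K₀` on all of [0, T] serves
only to differentiate in time; the estimate at time t uses the bound `K` on [0, t]. -/
theorem exists_error_bound (hk : 2 ≤ k) :
    ∃ C : ℝ, 0 < C ∧ ∀ (T : ℝ) (_ : 0 < T) (fl : Flux) (bc : Boundary) (M : Mesh)
      (u : ℝ → ℝ → ℝ) (_ : IsHeatSolution T u) (_ : SatisfiesBC T u fl bc)
      (D : ℝ → ℕ → ℝ → ℝ) (_ : IsDerivFamily T (k + 3) u D) (K₀ : ℝ)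
      (_ : ∀ t ∈ Icc 0 T, (sobolevNorm (k + 4) fun x => u x t).toReal ≤ K₀)
      (uh qh : ℝ → ℕ → Polynomial ℝ) (_ : IsLDGSolution k T M fl bc uh qh)
      (_ : ∀ j < M.N, uh 0 j = interpU k T M u 0 j fl),
      ∀ t ∈ Icc 0 T, ∀ K : ℝ,
        (∀ s ∈ Icc 0 t, (sobolevNorm (k + 4) fun x => u x s).toReal ≤ K) →
        normL2 M (fun j => projU k M u t j fl - uh t j) ≤ C * (K * M.h ^ (k + 2)) ∧
        normL2 M (fun j => projQ k M u t j fl - qh t j) ≤ C * (K * M.h ^ (k + 2)) := by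
  obtain ⟨B, hB0, hB⟩ := exists_norm_correction_bound (show 1 ≤ k by omega)
  have hpi := Real.pi_pos
  set P : ℝ := 7 * Real.pi with hP
  have hP0 : 0 < P := by positivity
  -- ‖z‖ + ‖W_u‖ is at most (2P² + 3) S and ‖G z‖ + ‖W_q‖ at most (P + 1) S; the constant covers
  -- both, and the added 1 keeps it positive if B = 0.
  refine ⟨(2 * P * P + P + 3) * B + 1, by positivity, ?_⟩
  intro T hT fl bc M u hu hbc D hD K₀ hK₀ uh qh hs hinit t ht K hK
  have hh := M.h_pos
  have hsub : Icc 0 t ⊆ Icc 0 T := Icc_subset_Icc_right ht.2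
  have h0T : (0 : ℝ) ∈ Icc 0 T := left_mem_Icc.2 hT.le
  have hK0 : 0 ≤ K := ENNReal.toReal_nonneg.trans (hK 0 (left_mem_Icc.2 ht.1))
  set S : ℝ := B * (K * M.h ^ (k + 2)) with hS
  have hbound : ∀ s ∈ Icc 0 t, ‖FE.ofPoly M k (famWU k M fl (D s))‖ ≤ S ∧
      ‖FE.ofPoly M k (famWU k M fl fun i => D s (i + 2))‖ ≤ S ∧
      ‖FE.ofPoly M k (famWQ k M fl (D s))‖ ≤ S := fun s hs =>
    hB M fl (D s) K hK0 (hD.cont s (hsub hs)) (hD.deriv s (hsub hs)) fun i hi x hx y hy =>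
      (hD.lip s (hsub hs) i hi x hx y hy).trans
        (mul_le_mul_of_nonneg_right (hK s hs) (abs_nonneg _))
  set z : ℝ → FE M k := fun s =>
    FE.ofPoly M k fun j => famProjU k M fl (D s) j - famWU k M fl (D s) j - uh s j with hz
  set z' : ℝ → FE M k := fun s =>
    FE.ofPoly M k fun j => famProjU k M fl (fun i => D s (i + 2)) j -
      famWU k M fl (fun i => D s (i + 2)) j - timeDeriv k T (fun τ => uh τ j) s with hz'
  have hgrad : ∀ s ∈ Icc 0 T, grad fl bc (z s) = FE.ofPoly M k fun j =>
      famProjQ k M fl (D s) j - famWQ k M fl (D s) j - qh s j := fun s hs' =>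
    grad_error_eq hk fl bc s (hD.cont s hs') (hD.deriv s hs' 0 (by omega)) (hD.bcU hbc hs')
      (hs.natDegree_uh s hs') (hs.natDegree_qh s hs') (hs.eq_q s hs')
  have heq : ∀ s ∈ Icc 0 T, ∀ v : FE M k, inner ℝ (z' s) v =
      -inner ℝ (grad fl bc (z s)) (grad fl bc v) -
        inner ℝ (FE.ofPoly M k (famWU k M fl fun i => D s (i + 2))) v := fun s hs' v => by
    rw [hgrad s hs']
    refine inner_error_eq hk fl bc s (hD.cont s hs') (hD.deriv s hs' 1 (by omega))
      (hD.bcQ (by omega) hbc hs') (fun j _ => timeDeriv_natDegree_le _ _ _ _)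
      (hs.natDegree_qh s hs') (fun j hj w hw => ?_) v
    have h1 := hs.eq_u s hs' j hj w hw
    simp only [derivWithin_eval hT (fun τ hτ => hs.natDegree_uh τ hτ j hj)
      (hs.differentiableOn_uh j hj) hs'] at h1
    exact h1
  have hzd : ∀ s ∈ Icc 0 T, HasDerivWithinAt z (z' s) (Icc 0 T) s := fun s hs' =>
    FE.hasDerivWithinAt fun j m => by
      have h1 := hD.hasDerivWithinAt_coeff_famProjU (k := k) hT hu hK₀ (by omega) hs' fl j.2 m
      have h2 := hD.hasDerivWithinAt_coeff_famWU (k := k) hT hu hK₀ (by omega) hs' fl j.2 m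
      have h3 := (hs.differentiableOn_uh j j.2 m s hs').hasDerivWithinAt
      rw [← timeDeriv_coeff (fun τ => uh τ j) s m.2] at h3
      have h4 := (h1.sub h2).sub h3
      simp only [hz, hz', FE.ofPoly, Polynomial.coeff_sub]
      exact h4
  have hWd : ∀ s ∈ Icc 0 T, HasDerivWithinAt (fun s => FE.ofPoly M k (famWU k M fl (D s)))
      (FE.ofPoly M k (famWU k M fl fun i => D s (i + 2))) (Icc 0 T) s := fun s hs' =>
    FE.hasDerivWithinAt fun j m =>
      hD.hasDerivWithinAt_coeff_famWU hT hu hK₀ (by omega) hs' fl j.2 m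
  have hz0 : z 0 = 0 := by
    funext j m
    have h1 := hinit j j.2
    rw [interpU, hD.projU_eq h0T fl j.2, hD.correctionU_eq hT hu hK₀ (by omega) h0T fl j.2] at h1
    simp only [hz, FE.ofPoly, h1, sub_self, Polynomial.coeff_zero]
    rfl
  obtain ⟨e1, e2⟩ := norm_le_of_energy (grad fl bc) (grad_kerElt fl bc) hP0
    (poincare (by omega) fl bc) ht hz0 hzd hWd heq (fun s hs => (hbound s hs).1)
    fun s hs => (hbound s hs).2.1
  have hKh : 0 ≤ K * M.h ^ (k + 2) := by positivity
  have hS0 : 0 ≤ S := by positivity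
  obtain ⟨b1, -, b3⟩ := hbound t (right_mem_Icc.2 ht.1)
  have hfinal : ((2 * P * P + P + 3) * B + 1) * (K * M.h ^ (k + 2)) =
      (2 * P * P + P + 3) * S + K * M.h ^ (k + 2) := by rw [hS]; ring
  have hPS : 0 ≤ P * S := by positivity
  have hPPS : 0 ≤ P * P * S := by positivity
  rw [hfinal]
  constructor
  · have h1 : FE.ofPoly M k (fun j => projU k M u t j fl - uh t j) =
        z t + FE.ofPoly M k (famWU k M fl (D t)) := by
      rw [hz, ← FE.ofPoly_add]
      funext j m
      simp only [FE.ofPoly, hD.projU_eq ht fl j.2]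
      congr 1
      ring
    rw [← FE.norm_ofPoly (k := k), h1]
    · refine (norm_add_le _ _).trans ?_
      linarith
    · intro j hj
      rw [hD.projU_eq ht fl hj]
      exact (Polynomial.natDegree_sub_le_iff_left (hs.natDegree_uh t ht j hj)).2
        (famProjU_natDegree_le fl (hD.cont t ht 0) hj)
  · have h1 : FE.ofPoly M k (fun j => projQ k M u t j fl - qh t j) =
        grad fl bc (z t) + FE.ofPoly M k (famWQ k M fl (D t)) := by
      rw [hgrad t ht, ← FE.ofPoly_add]
      funext j m
      simp only [FE.ofPoly, hD.projQ_eq (by omega) ht fl j.2]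
      congr 1
      ring
    rw [← FE.norm_ofPoly (k := k), h1]
    · refine (norm_add_le _ _).trans ?_
      linarith
    · intro j hj
      rw [hD.projQ_eq (by omega) ht fl hj]
      exact (Polynomial.natDegree_sub_le_iff_left (hs.natDegree_qh t ht j hj)).2
        (famProjQ_natDegree_le fl (hD.cont t ht 1) hj)

/-- The bound obtained is uniform in time; the factor 1 + g ≥ 1 only weakens it. -/
theorem ofReal_le_ofReal_mul {x C h g : ℝ} {S : ℝ≥0∞} (hS : S ≠ ⊤) (hC : 0 ≤ C) (hh : 0 ≤ h)
    (hg : 0 ≤ g) (hx : x ≤ C * (S.toReal * h)) :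
    ENNReal.ofReal x ≤ ENNReal.ofReal (C * (1 + g) * h) * S := by
  rw [← ENNReal.ofReal_toReal hS, ← ENNReal.ofReal_mul (by positivity)]
  refine ENNReal.ofReal_le_ofReal (hx.trans ?_)
  have : 0 ≤ C * g * h * S.toReal := by positivity
  linarith

end

end LDG
-- The error estimate in terms of the Sobolev norm
theorem corollary4p1 (k : ℕ) (hk : 2 ≤ k) (c : ℝ) :
    ∃ C : ℝ, 0 < C ∧
      ∀ (T : ℝ) (_ : 0 < T) (fl : LDG.Flux) (bc : LDG.Boundary)
        (M : LDG.Mesh) (_ : M.QuasiUniform c)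
        (u : ℝ → ℝ → ℝ) (_ : LDG.IsHeatSolution T u) (_ : LDG.SatisfiesBC T u fl bc)
        (_ : (⨆ s ∈ Set.Icc 0 T, LDG.sobolevNorm (k + 4) (fun x => u x s)) < ⊤)
        (uh qh : ℝ → ℕ → Polynomial ℝ) (_ : LDG.IsLDGSolution k T M fl bc uh qh)
        (_ : ∀ j < M.N, uh 0 j = LDG.interpU k T M u 0 j fl),
        ∀ t ∈ Set.Icc 0 T,
          ENNReal.ofReal (LDG.normL2 M fun j => LDG.projU k M u t j fl - uh t j) ≤
              ENNReal.ofReal (C * (1 + t * M.h) * M.h ^ (k + 2)) *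
                ⨆ s ∈ Set.Icc 0 t, LDG.sobolevNorm (k + 4) (fun x => u x s) ∧
          ENNReal.ofReal (LDG.normL2 M fun j => LDG.projQ k M u t j fl - qh t j) ≤
              ENNReal.ofReal (C * (1 + Real.sqrt t * M.h) * M.h ^ (k + 2)) *
                ⨆ s ∈ Set.Icc 0 t, LDG.sobolevNorm (k + 4) (fun x => u x s) := by
  obtain ⟨C, hC, hbound⟩ := LDG.exists_error_bound hk
  refine ⟨C, hC, fun T hT fl bc M _ u hu hbc hfin uh qh hs hinit t ht => ?_⟩
  have hle : ∀ t, ∀ s ∈ Set.Icc 0 t, LDG.sobolevNorm (k + 4) (fun x => u x s) ≤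
      ⨆ s ∈ Set.Icc 0 t, LDG.sobolevNorm (k + 4) (fun x => u x s) := fun t s hs =>
    le_iSup₂ (f := fun s (_ : s ∈ Set.Icc 0 t) => LDG.sobolevNorm (k + 4) (fun x => u x s)) s hs
  have hfin' : (⨆ s ∈ Set.Icc 0 t, LDG.sobolevNorm (k + 4) (fun x => u x s)) ≠ ⊤ :=
    ((iSup₂_le fun s hs => hle T s ⟨hs.1, hs.2.trans ht.2⟩).trans_lt hfin).ne
  -- One order less than k + 4, since the last weak derivative is used only as a Lipschitz constant.
  obtain ⟨D, hD⟩ := LDG.exists_isDerivFamily (n := k + 3) hu fun s hs =>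
    (hle T s hs).trans_lt hfin
  obtain ⟨h1, h2⟩ := hbound T hT fl bc M u hu hbc D hD _
    (fun s hs => ENNReal.toReal_mono hfin.ne (hle T s hs)) uh qh hs hinit t ht _
    fun s hs => ENNReal.toReal_mono hfin' (hle t s hs)
  have hh := M.h_pos.le
  have hht := mul_nonneg ht.1 hh
  exact ⟨LDG.ofReal_le_ofReal_mul hfin' hC.le (by positivity) hht h1,
    LDG.ofReal_le_ofReal_mul hfin' hC.le (by positivity) (by positivity) h2⟩
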